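/- Let $\mathbb R\langle X_1,\dots,X_k\rangle$ be the free associative algebra and let $\mathrm F^{\mathrm{Lie}}_k$ be the free real Lie algebra on $X_1,\dots,X_k$. The Magnus commutator is \[\mu_k(X_1,\dots,X_k)=\frac{\partial^k}{\partial t_1\cdots\partial t_k}\log\bigl(\exp(t_1X_1)\cdots\exp(t_kX_k)\bigr)\Big|_{t_1=\dots=t_k=0}\in\mathbb R\langle X_1,\dots,X_k\rangle ,\] computed with formal power series in the central variables $t_i$. Let $\mu_k^{\mathrm{Lie}}\in\mathrm F^{\mathrm{Lie}}_k$ be the Lie polynomial whose commutator evaluation (the Lie homomorphism $\mathrm F^{\mathrm{Lie}}_k\to\mathbb R\langle X_1,\dots,X_k\rangle$ that fixes the variables) is $\mu_k$. Let $\mathbf M_k^{\mathrm{Lie}}\subset\mathrm F^{\mathrm{Lie}}_k$ be the finite set of the elements $\pm M$, where $M$ is a Lie monomial (iterated bracket) in which each of $X_1,\dots,X_k$ occurs exactly once. Put \[\Theta_k^{\mathrm{Lie}}=\frac1{k!}\inf\Bigl\{\sum_{\gamma\in\mathbf M_k^{\mathrm{Lie}}}|\theta_\gamma| : \theta_\gamma\in\mathbb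 R,\ \mu_k^{\mathrm{Lie}}=\sum_{\gamma\in\mathbf M_k^{\mathrm{Lie}}}\theta_\gamma\,\gamma\Bigr\}.\] Then, for $k=1,\dots,8$, the Lie polynomial $\mu_k^{\mathrm{Lie}}$ exists and is unique, and the values of $k!\,\Theta_k^{\mathrm{Lie}}$ are, respectively, \[1,\quad \tfrac12,\quad \tfrac13,\quad \tfrac13,\quad \tfrac25,\quad \tfrac{37}{60},\quad \tfrac{1621}{1540},\quad \tfrac{5242130799984621832318}{2419342933460499216625}.\] Moreover, for each of these $k$, the value $c=k!\,\Theta_k^{\mathrm{Lie}}$ has a rational certificate: there are a presentation $\mu_k^{\mathrm{Lie}}=\sum_{\gamma}\theta_\gamma\gamma$ with rational coefficients and $\sum_\gamma|\theta_\gamma|=c$, and a linear functional $\alpha$ on $\mathrm F^{\mathrm{Lie}}_k$ which takes rational values with $|\alpha(M)|\le1$ for all $M\in\mathbf M_k^{\mathrm{Lie}}$ and satisfies $\alpha(\mu_k^{\mathrm{Lie}})=c$. -/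

import Mathlib

open scoped Nat

noncomputable section

namespace Magnus

attribute [local instance 100] LieRing.ofAssociativeRing

/-- Formal power series in central variables `t_1, …, t_k` whose coefficients are noncommutative
polynomials in `X_1, …, X_k`. The index `i : Fin k` stands for the `(i + 1)`-st variable. -/
abbrev FormalSeries (k : ℕ) : Type := MvPowerSeries (Fin k) (FreeAlgebra ℝ (Fin k))

/-- The series `exp (t_i X_i) = ∑ n, t_i ^ n X_i ^ n / n!`. -/
def expVar (k : ℕ) (i : Fin k) : FormalSeries k := fun d : Fin k →₀ ℕ =>
  if d = Finsupp.single i (d i) then ((d i)! : ℝ)⁻¹ • FreeAlgebra.ι ℝ i ^ (d i) else 0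

/-- The ordered product `exp (t_1 X_1) ⋯ exp (t_k X_k)`. -/
def expProd (k : ℕ) : FormalSeries k := (List.ofFn (expVar k)).prod

/-- The logarithm `∑ s ≥ 1, (-1) ^ (s + 1) / s * (F - 1) ^ s` of a series `F` with constant
coefficient `1`. Since `(F - 1) ^ s` only has terms of total degree at least `s`, the summands
with `s > d.degree` do not contribute to the coefficient at `d`. -/
def logSeries {k : ℕ} (F : FormalSeries k) : FormalSeries k := fun d : Fin k →₀ ℕ =>
  ∑ s ∈ Finset.Icc (1 : ℕ) d.degree, ((-1 : ℝ) ^ (s + 1) / (s : ℝ)) • MvPowerSeries.coeff d ((F - 1) ^ s)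

/-- The Magnus commutator `μ_k(X_1, …, X_k)`: the derivative `∂^k / ∂t_1 ⋯ ∂t_k` at `t = 0` of
`log (exp (t_1 X_1) ⋯ exp (t_k X_k))`, which is its coefficient at `t_1 ⋯ t_k`. -/
def magnus (k : ℕ) : FreeAlgebra ℝ (Fin k) :=
  MvPowerSeries.coeff (∑ i : Fin k, Finsupp.single i 1) (logSeries (expProd k))

/-- Evaluation of Lie polynomials as commutator polynomials: the Lie algebra homomorphism from
the free Lie algebra to the free associative algebra which fixes the variables. -/
def toAssoc (k : ℕ) : FreeLieAlgebra ℝ (Fin k) →ₗ⁅ℝ⁆ FreeAlgebra ℝ (Fin k) :=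
  FreeLieAlgebra.lift ℝ (FreeAlgebra.ι ℝ)

open Classical in
/-- The Lie polynomial `μ_k^Lie(X_1, …, X_k)` associated to the Magnus commutator, i.e. the element
of the free Lie algebra whose commutator evaluation is `μ_k(X_1, …, X_k)`. -/
def magnusLie (k : ℕ) : FreeLieAlgebra ℝ (Fin k) :=
  if h : ∃ L : FreeLieAlgebra ℝ (Fin k), toAssoc k L = magnus k then h.choose else 0

/-- The element of the free Lie algebra given by a bracketed word. -/
def bracket {k : ℕ} : FreeMagma (Fin k) → FreeLieAlgebra ℝ (Fin k)
  | .of i => FreeLieAlgebra.of ℝ i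
  | .mul a b => ⁅bracket a, bracket b⁆

/-- The variables of a bracketed word, with multiplicities. -/
def letters {k : ℕ} : FreeMagma (Fin k) → Multiset (Fin k)
  | .of i => {i}
  | .mul a b => letters a + letters b

/-- The Lie monomials of `X_1, …, X_k` in which every variable has multiplicity `1`, as elements
of the free Lie algebra; along with `M` also `-M` is counted as a Lie monomial. -/
def lieMonomials (k : ℕ) : Set (FreeLieAlgebra ℝ (Fin k)) :=
  {M | ∃ w : FreeMagma (Fin k), letters w = (Finset.univ : Finset (Fin k)).val ∧
    (M = bracket w ∨ M = -bracket w)}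

/-- `θ` is a presentation of `μ_k^Lie` as a linear combination of Lie monomials. -/
def IsPresentation (k : ℕ) (θ : lieMonomials k →₀ ℝ) : Prop :=
  magnusLie k = θ.sum fun γ c => c • (γ : FreeLieAlgebra ℝ (Fin k))

/-- The sum of the absolute values of the coefficients of a presentation. -/
def cost {k : ℕ} (θ : lieMonomials k →₀ ℝ) : ℝ := θ.sum fun _ c => |c|

/-- The constant `Θ_k^Lie`. -/
def lieTheta (k : ℕ) : ℝ :=
  1 / (k ! : ℝ) * sInf {x : ℝ | ∃ θ : lieMonomials k →₀ ℝ, IsPresentation k θ ∧ x = cost θ}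

/-- `c` is certified as the minimal cost of a presentation of `μ_k^Lie`: there are a presentation
of cost `c` (primal solution), and a linear functional with values in `[-1, 1]` on the Lie monomials
and with value `c` on `μ_k^Lie` (dual solution), both of them given by rational numbers. -/
def IsCertified (k : ℕ) (c : ℝ) : Prop :=
  (∃ θ : lieMonomials k →₀ ℝ,
    IsPresentation k θ ∧ cost θ = c ∧ ∀ γ, ∃ q : ℚ, θ γ = (q : ℝ)) ∧
  ∃ α : FreeLieAlgebra ℝ (Fin k) →ₗ[ℝ] ℝ,
    (∀ M ∈ lieMonomials k, |α M| ≤ 1 ∧ ∃ q : ℚ, α M = (q : ℝ)) ∧ α (magnusLie k) = c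

end Magnus

end

/-!
The number `k! Θ_k^Lie` is the value of a finite linear program: the minimal `ℓ¹`-norm of a
presentation of the Magnus commutator by multilinear Lie monomials. By weak duality (`le_cost`),
a presentation of cost `c` and a linear functional which is bounded by `1` on the Lie monomials and
takes the value `c` on the Magnus commutator together prove that `c` is this minimum. So the task is
to exhibit such pairs of solutions for `k ≤ 8` and to verify them.

Everything is reduced to functions of words. A linear functional on the free associative algebra
is a function `g` of words, and its value on the commutator evaluation of a bracketed word `T` is
`act T g []`, where letters act by `(a g)(w) = g (a w)` and brackets by commutators
(`wordEval_toAssoc`). Applied to left-normed bracketing, this gives the injectivity of the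
commutator evaluation (`toAssoc_injective`) and the fact that a multilinear Lie polynomial is
determined by its coefficients at the words starting with a fixed letter (`eq_of_coefW_cons`).

The Magnus commutator is a coefficient of the logarithm of a group-like series. The powers of such
a series are group-like and depend polynomially on the exponent, and the logarithm is the derivative
at exponent zero; hence its coefficients are primitive (`comul_coeff_logSeries`). By Dynkin's
argument, a primitive element of degree `n` is `1 / n` times its left-normed bracketing
(`dynkin_eq_of_primitive`), so the Magnus commutator is a Lie polynomial
(`exists_multilinear_toAssoc_eq_magnus`). Counting the ways to cut a permutation into increasing
pieces yields its coefficient `(-1) ^ d a! d! / k!` at a permutation with `a` ascents and `d` descents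
(`coefW_magnus`).

A presentation is then verified by comparing its coefficients with these at all permutations that
fix the first letter (`toAssoc_lieSum`); the products of bracketed words arising from the
presentation are expanded letter by letter (`strip`). A functional which sees only words starting
with the first letter is bounded on all Lie monomials by enumerating them up to sign: each arises
from the first letter by successive insertion of the others (`exists_reaches`), which leaves
`(2k - 3)!!` bracketed words. On these the functional is evaluated in natural numbers with an offset
(`offsetAct_eq`). For eight variables the optimal presentation has 5508 terms in 306 dihedral
orbits, and the optimal functional is given by its values at the 5040 permutations which fix the
first letter; these verifications are evaluations of Boolean functions, carried out by the kernel.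
-/

noncomputable section

namespace Magnus

attribute [local instance 100] LieRing.ofAssociativeRing

open scoped TensorProduct

/-! ### Words and linear maps on the free associative algebra -/

/-- The monomial `X_{w₁} ⋯ X_{wₙ}` of the free associative algebra. -/
def word {k : ℕ} (w : List (Fin k)) : FreeAlgebra ℝ (Fin k) :=
  (w.map (FreeAlgebra.ι ℝ)).prod

@[simp] theorem word_nil {k : ℕ} : word ([] : List (Fin k)) = 1 := rfl

theorem word_cons {k : ℕ} (a : Fin k) (w : List (Fin k)) :
    word (a :: w) = FreeAlgebra.ι ℝ a * word w := by
  simp [word]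

theorem word_append {k : ℕ} (u w : List (Fin k)) : word (u ++ w) = word u * word w := by
  simp [word]

theorem basisFreeMonoid_apply {k : ℕ} (m : FreeMonoid (Fin k)) :
    FreeAlgebra.basisFreeMonoid ℝ (Fin k) m = word m.toList := by
  have h : FreeAlgebra.basisFreeMonoid ℝ (Fin k) m =
      FreeAlgebra.equivMonoidAlgebraFreeMonoid.symm (MonoidAlgebra.single m (1 : ℝ)) := rfl
  rw [h, FreeAlgebra.equivMonoidAlgebraFreeMonoid]
  simp [MonoidAlgebra.lift_single, FreeMonoid.lift_apply, word]

/-- The linear map on the free associative algebra with prescribed values on the words. -/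
def wordEval {k : ℕ} {M : Type*} [AddCommGroup M] [Module ℝ M] (g : List (Fin k) → M) :
    FreeAlgebra ℝ (Fin k) →ₗ[ℝ] M :=
  (FreeAlgebra.basisFreeMonoid ℝ (Fin k)).constr ℝ fun m => g m.toList

@[simp] theorem wordEval_word {k : ℕ} {M : Type*} [AddCommGroup M] [Module ℝ M]
    (g : List (Fin k) → M) (w : List (Fin k)) : wordEval g (word w) = g w := by
  have h := basisFreeMonoid_apply (FreeMonoid.ofList w)
  rw [FreeMonoid.toList_ofList] at h
  rw [← h, wordEval, Module.Basis.constr_basis, FreeMonoid.toList_ofList]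

theorem word_hom_ext {k : ℕ} {M : Type*} [AddCommGroup M] [Module ℝ M]
    {f g : FreeAlgebra ℝ (Fin k) →ₗ[ℝ] M} (h : ∀ w, f (word w) = g (word w)) : f = g :=
  (FreeAlgebra.basisFreeMonoid ℝ (Fin k)).ext fun m => by
    rw [basisFreeMonoid_apply]; exact h _

theorem eq_wordEval_of {k : ℕ} {M : Type*} [AddCommGroup M] [Module ℝ M]
    (f : FreeAlgebra ℝ (Fin k) →ₗ[ℝ] M) : f = wordEval fun w => f (word w) :=
  word_hom_ext fun w => by simp

/-- The coefficient functional of a word. -/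
def coefW {k : ℕ} (w : List (Fin k)) : FreeAlgebra ℝ (Fin k) →ₗ[ℝ] ℝ :=
  wordEval fun v => if v = w then 1 else 0

theorem coefW_word {k : ℕ} (w v : List (Fin k)) : coefW w (word v) = if v = w then 1 else 0 :=
  wordEval_word _ _

theorem coefW_apply {k : ℕ} (w : List (Fin k)) (p : FreeAlgebra ℝ (Fin k)) :
    coefW w p = (FreeAlgebra.basisFreeMonoid ℝ (Fin k)).repr p (FreeMonoid.ofList w) := by
  have : coefW w = (FreeAlgebra.basisFreeMonoid ℝ (Fin k)).coord (FreeMonoid.ofList w) := by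
    refine (FreeAlgebra.basisFreeMonoid ℝ (Fin k)).ext fun m => ?_
    classical
    rw [Module.Basis.coord_apply, Module.Basis.repr_self, basisFreeMonoid_apply, coefW_word,
      Finsupp.single_apply]
    exact if_congr Iff.rfl rfl rfl
  rw [this]; rfl

/-- An element of the free associative algebra is determined by its coefficients. -/
theorem eq_of_coefW {k : ℕ} {p q : FreeAlgebra ℝ (Fin k)} (h : ∀ w, coefW w p = coefW w q) :
    p = q := by
  refine (FreeAlgebra.basisFreeMonoid ℝ (Fin k)).repr.injective (Finsupp.ext fun m => ?_)
  have := h m.toList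
  rwa [coefW_apply, coefW_apply, FreeMonoid.ofList_toList] at this

/-- A linear map is evaluated on `p` by summing over any finite set of words that contains the
words occurring in `p`. -/
theorem eq_sum_coefW {k : ℕ} {M : Type*} [AddCommGroup M] [Module ℝ M]
    (f : FreeAlgebra ℝ (Fin k) →ₗ[ℝ] M) (p : FreeAlgebra ℝ (Fin k)) (s : Finset (List (Fin k)))
    (hs : ∀ w, w ∉ s → coefW w p = 0) : f p = ∑ w ∈ s, coefW w p • f (word w) := by
  have : p = ∑ w ∈ s, coefW w p • word w := by
    refine eq_of_coefW fun v => ?_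
    simp only [map_sum, map_smul, coefW_word, smul_eq_mul, mul_ite, mul_one, mul_zero,
      Finset.sum_ite_eq']
    split_ifs with h
    · rfl
    · exact hs v h
  conv_lhs => rw [this]
  simp

theorem coefW_nil_mul {k : ℕ} (p q : FreeAlgebra ℝ (Fin k)) :
    coefW [] (p * q) = coefW [] p * coefW [] q := by
  have h : (LinearMap.mul ℝ _).compr₂ (coefW (k := k) []) =
      (LinearMap.mul ℝ ℝ).compl₁₂ (coefW []) (coefW []) := by
    refine word_hom_ext fun u => word_hom_ext fun v => ?_
    simp only [LinearMap.compr₂_apply, LinearMap.mul_apply', ← word_append, coefW_word,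
      LinearMap.compl₁₂_apply]
    by_cases hu : u = [] <;> simp [hu]
  exact LinearMap.congr_fun (LinearMap.congr_fun h p) q

/-- Coefficients of a product: a word is split into its first factor and the rest. -/
theorem coefW_mul {k : ℕ} (w : List (Fin k)) (p q : FreeAlgebra ℝ (Fin k)) :
    coefW w (p * q) =
      ∑ i ∈ Finset.range (w.length + 1), coefW (w.take i) p * coefW (w.drop i) q := by
  have h : (LinearMap.mul ℝ _).compr₂ (coefW w) =
      ∑ i ∈ Finset.range (w.length + 1),
        (LinearMap.mul ℝ ℝ).compl₁₂ (coefW (w.take i)) (coefW (w.drop i)) := by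
    refine word_hom_ext fun u => word_hom_ext fun v => ?_
    simp only [LinearMap.compr₂_apply, LinearMap.mul_apply', ← word_append, coefW_word,
      LinearMap.sum_apply, LinearMap.compl₁₂_apply, mul_ite, mul_one, mul_zero, ← ite_and]
    by_cases hw : u ++ v = w
    · subst hw
      rw [if_pos rfl, Finset.sum_eq_single_of_mem u.length]
      · simp
      · simp
      · intro i hi hne
        refine if_neg fun ⟨_, hu⟩ => hne ?_
        have := congrArg List.length hu
        simp at this hi
        omega
    · rw [if_neg hw, Finset.sum_eq_zero]
      intro i _
      refine if_neg fun ⟨hv, hu⟩ => hw ?_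
      rw [hu, hv, List.take_append_drop]
  have := LinearMap.congr_fun (LinearMap.congr_fun h p) q
  simpa [LinearMap.sum_apply] using this

/-! ### Bracketed words acting on functions of words -/

/-- The left action of a bracketed word on functions of words, in which a letter `a` turns `g` into
`w ↦ g (a :: w)` and a bracket acts as a commutator. -/
def act {X M : Type*} [Sub M] (T : FreeMagma X) : (List X → M) → List X → M :=
  FreeMagma.rec (fun a g w => g (a :: w)) (fun _ _ f₁ f₂ g w => f₂ (f₁ g) w - f₁ (f₂ g) w) T

@[simp] theorem act_of {X M : Type*} [Sub M] (a : X) (g : List X → M) (w : List X) :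
    act (.of a) g w = g (a :: w) := rfl

theorem act_mul {X M : Type*} [Sub M] (S T : FreeMagma X) (g : List X → M) (w : List X) :
    act (.mul S T) g w = act T (act S g) w - act S (act T g) w := rfl

theorem act_map {X Y M : Type*} [Sub M] (f : X → Y) (T : FreeMagma X) (g : List Y → M)
    (w : List X) : act (FreeMagma.map f T) g (w.map f) = act T (fun v => g (v.map f)) w := by
  induction T generalizing g w with
  | ih1 a => rfl
  | ih2 S T hS hT =>
    change act (.mul (FreeMagma.map f S) (FreeMagma.map f T)) g _ = act (.mul S T) _ _
    rw [act_mul, act_mul, hS, hT]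
    congr 2 <;> funext v
    · exact hS g v
    · exact hT g v

theorem act_comp_hom {X M N : Type*} [AddGroup M] [AddGroup N] (c : M →+ N) (T : FreeMagma X)
    (g : List X → M) (w : List X) : act T (fun v => c (g v)) w = c (act T g w) := by
  induction T generalizing g w with
  | ih1 a => rfl
  | ih2 S T hS hT =>
    change act (.mul S T) _ w = c (act (.mul S T) g w)
    rw [act_mul, act_mul, map_sub, ← hT, ← hS]
    congr 2 <;> funext v
    · exact hS g v
    · exact hT g v

theorem act_zero {X M : Type*} [AddGroup M] (T : FreeMagma X) (w : List X) :
    act T (fun _ => (0 : M)) w = 0 := by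
  simpa using act_comp_hom (0 : M →+ M) T (fun _ => 0) w

theorem toAssoc_of {k : ℕ} (a : Fin k) :
    toAssoc k (FreeLieAlgebra.of ℝ a) = FreeAlgebra.ι ℝ a := by
  simp [toAssoc]

theorem toAssoc_lie {k : ℕ} (P Q : FreeLieAlgebra ℝ (Fin k)) :
    toAssoc k ⁅P, Q⁆ = toAssoc k P * toAssoc k Q - toAssoc k Q * toAssoc k P := by
  rw [LieHom.map_lie, LieRing.of_associative_ring_bracket]

theorem bracket_mul {k : ℕ} (S T : FreeMagma (Fin k)) :
    bracket (.mul S T) = ⁅bracket S, bracket T⁆ := rfl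

theorem wordEval_toAssoc_mul {k : ℕ} {M : Type*} [AddCommGroup M] [Module ℝ M]
    (T : FreeMagma (Fin k)) (g : List (Fin k) → M) (p : FreeAlgebra ℝ (Fin k)) :
    wordEval g (toAssoc k (bracket T) * p) = wordEval (act T g) p := by
  induction T generalizing g p with
  | ih1 a =>
    have h : wordEval g ∘ₗ LinearMap.mulLeft ℝ (FreeAlgebra.ι ℝ a) =
        wordEval (act (.of a) g) := by
      refine word_hom_ext fun w => ?_
      simp [← word_cons]
    change wordEval g (toAssoc k (FreeLieAlgebra.of ℝ a) * p) = _
    rw [toAssoc_of]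
    exact LinearMap.congr_fun h p
  | ih2 S T hS hT =>
    change wordEval g (toAssoc k (bracket (.mul S T)) * p) = wordEval (act (.mul S T) g) p
    rw [bracket_mul, toAssoc_lie, sub_mul, map_sub, mul_assoc, mul_assoc, hS, hT, hT, hS,
      ← LinearMap.sub_apply]
    congr 1
    refine word_hom_ext fun w => ?_
    simp only [LinearMap.sub_apply, wordEval_word]
    rfl

/-- The action computes linear functionals on commutator evaluations. All further computations with
bracketed words rest on this formula, by which they never leave the functions of words. -/
theorem wordEval_toAssoc {k : ℕ} {M : Type*} [AddCommGroup M] [Module ℝ M]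
    (T : FreeMagma (Fin k)) (g : List (Fin k) → M) :
    wordEval g (toAssoc k (bracket T)) = act T g [] := by
  have := wordEval_toAssoc_mul T g 1
  rwa [mul_one, ← word_nil, wordEval_word] at this

/-! ### Left-normed brackets and injectivity of the commutator evaluation -/

/-- The left-normed bracket `[…[[P, X_{w₁}], X_{w₂}], …, X_{wₙ}]`. -/
def rightAct {k : ℕ} (P : FreeLieAlgebra ℝ (Fin k)) (w : List (Fin k)) :
    FreeLieAlgebra ℝ (Fin k) :=
  w.foldl (fun Q a => ⁅Q, FreeLieAlgebra.of ℝ a⁆) P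

theorem rightAct_cons {k : ℕ} (P : FreeLieAlgebra ℝ (Fin k)) (a : Fin k) (w : List (Fin k)) :
    rightAct P (a :: w) = rightAct ⁅P, FreeLieAlgebra.of ℝ a⁆ w := rfl

theorem rightAct_sub {k : ℕ} (P Q : FreeLieAlgebra ℝ (Fin k)) (w : List (Fin k)) :
    rightAct (P - Q) w = rightAct P w - rightAct Q w := by
  induction w generalizing P Q with
  | nil => rfl
  | cons a w ih => rw [rightAct_cons, sub_lie, ih]; rfl

theorem rightAct_neg {k : ℕ} (P : FreeLieAlgebra ℝ (Fin k)) (w : List (Fin k)) :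
    rightAct (-P) w = -rightAct P w := by
  induction w generalizing P with
  | nil => rfl
  | cons a w ih => rw [rightAct_cons, neg_lie, ih]; rfl

/-- Since the evaluation of a bracketed word is a commutator, right bracketing with its letters is
right bracketing with the word itself, by the Jacobi identity. -/
theorem act_rightAct {k : ℕ} (T : FreeMagma (Fin k)) (P : FreeLieAlgebra ℝ (Fin k)) :
    act T (rightAct P) = rightAct ⁅P, bracket T⁆ := by
  induction T generalizing P with
  | ih1 a => rfl
  | ih2 S T hS hT =>
    funext w
    change act T (act S _) w - act S (act T _) w = rightAct ⁅P, ⁅bracket S, bracket T⁆⁆ w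
    rw [hS, hT, hT, hS, ← rightAct_sub]
    congr 1
    rw [lie_lie, leibniz_lie, ← lie_skew ⁅P, bracket T⁆ (bracket S)]
    abel

/-- The left-normed bracket of a word. -/
def leftNormed {k : ℕ} : List (Fin k) → FreeLieAlgebra ℝ (Fin k)
  | [] => 0
  | a :: w => rightAct (FreeLieAlgebra.of ℝ a) w

/-- The number of letters of a bracketed word is the factor by which left-normed bracketing
multiplies its Lie polynomial. -/
theorem act_leftNormed {k : ℕ} (T : FreeMagma (Fin k)) :
    act T leftNormed = rightAct ((T.length : ℝ) • bracket T) := by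
  induction T with
  | ih1 a =>
    funext w
    change rightAct (FreeLieAlgebra.of ℝ a) w = rightAct (((1 : ℕ) : ℝ) • FreeLieAlgebra.of ℝ a) w
    rw [Nat.cast_one, one_smul]
  | ih2 S T hS hT =>
    funext w
    change act T (act S _) w - act S (act T _) w =
      rightAct (((S.length + T.length : ℕ) : ℝ) • ⁅bracket S, bracket T⁆) w
    rw [hS, hT, act_rightAct, act_rightAct, ← rightAct_sub, smul_lie, smul_lie,
      ← lie_skew (bracket T) (bracket S), smul_neg, sub_neg_eq_add, ← add_smul, Nat.cast_add]

theorem wordEval_leftNormed_toAssoc_bracket {k : ℕ} (T : FreeMagma (Fin k)) :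
    wordEval leftNormed (toAssoc k (bracket T)) = (T.length : ℝ) • bracket T := by
  rw [wordEval_toAssoc, act_leftNormed]; rfl

/-- The Lie monomials span, as their span is a Lie subalgebra which contains the variables. -/
theorem span_bracket (k : ℕ) :
    Submodule.span ℝ (Set.range (bracket (k := k))) = ⊤ := by
  have hlie : ∀ {P Q : FreeLieAlgebra ℝ (Fin k)},
      P ∈ Submodule.span ℝ (Set.range (bracket (k := k))) →
      Q ∈ Submodule.span ℝ (Set.range (bracket (k := k))) →
      ⁅P, Q⁆ ∈ Submodule.span ℝ (Set.range (bracket (k := k))) := by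
    intro P Q hP hQ
    induction hP using Submodule.span_induction with
    | mem P h =>
      obtain ⟨S, rfl⟩ := h
      induction hQ using Submodule.span_induction with
      | mem Q h =>
        obtain ⟨T, rfl⟩ := h
        exact Submodule.subset_span ⟨.mul S T, rfl⟩
      | zero => simp
      | add Q Q' _ _ h h' => rw [lie_add]; exact Submodule.add_mem _ h h'
      | smul c Q _ h => rw [lie_smul]; exact Submodule.smul_mem _ _ h
    | zero => simp
    | add P P' _ _ h h' => rw [add_lie]; exact Submodule.add_mem _ h h'
    | smul c P _ h => rw [smul_lie]; exact Submodule.smul_mem _ _ h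
  let S : LieSubalgebra ℝ (FreeLieAlgebra ℝ (Fin k)) :=
    { Submodule.span ℝ (Set.range (bracket (k := k))) with lie_mem' := hlie }
  let f : FreeLieAlgebra ℝ (Fin k) →ₗ⁅ℝ⁆ S := FreeLieAlgebra.lift ℝ fun a =>
    ⟨FreeLieAlgebra.of ℝ a, Submodule.subset_span ⟨.of a, rfl⟩⟩
  have hf : S.incl.comp f = LieHom.id := FreeLieAlgebra.hom_ext fun a => by
    simp [f]
  refine (Submodule.eq_top_iff'.2 fun P => ?_)
  have : P = S.incl (f P) := (LieHom.congr_fun hf P).symm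
  rw [this]
  exact (f P).2

/-- The free Lie algebra embeds into the free associative algebra. Left-normed bracketing of the
commutator evaluation is diagonalized by the Lie monomials, with nonzero eigenvalues, the degrees;
so it is annihilated on each element by a polynomial with nonzero constant term. -/
theorem toAssoc_injective (k : ℕ) : Function.Injective (toAssoc k) := by
  rw [← LieHom.coe_toLinearMap, ← LinearMap.ker_eq_bot, LinearMap.ker_eq_bot']
  intro P hP
  let D : Module.End ℝ (FreeLieAlgebra ℝ (Fin k)) :=
    wordEval leftNormed ∘ₗ (toAssoc k : FreeLieAlgebra ℝ (Fin k) →ₗ[ℝ] FreeAlgebra ℝ (Fin k))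
  have haeval : ∀ (p : Polynomial ℝ) (Q : FreeLieAlgebra ℝ (Fin k)) (c : ℝ), D Q = c • Q →
      Polynomial.aeval D p Q = p.eval c • Q := by
    intro p Q c hQ
    by_cases h0 : Q = 0
    · simp [h0]
    · exact Module.End.aeval_apply_of_hasEigenvector
        (Module.End.hasEigenvector_iff.2 ⟨Module.End.mem_eigenspace_iff.2 hQ, h0⟩)
  let p : ℕ → Polynomial ℝ := fun N =>
    ∏ n ∈ Finset.range N, (Polynomial.X - Polynomial.C (n + 1 : ℝ))
  have hmem : P ∈ Submodule.span ℝ (Set.range (bracket (k := k))) := by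
    rw [span_bracket]; trivial
  have hN : ∃ N, ∀ M, N ≤ M → Polynomial.aeval D (p M) P = 0 := by
    clear hP
    induction hmem using Submodule.span_induction with
    | mem Q h =>
      obtain ⟨T, rfl⟩ := h
      refine ⟨T.length, fun M hM => ?_⟩
      have hD : D (bracket T) = (T.length : ℝ) • bracket T :=
        wordEval_leftNormed_toAssoc_bracket T
      have hpos := T.length_pos
      rw [haeval _ _ _ hD, Polynomial.eval_prod,
        Finset.prod_eq_zero (i := T.length - 1) (Finset.mem_range.2 (by omega)), zero_smul]
      rw [Polynomial.eval_sub, Polynomial.eval_X, Polynomial.eval_C, Nat.cast_sub hpos]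
      simp
    | zero => exact ⟨0, fun M _ => map_zero _⟩
    | add Q Q' _ _ h h' =>
      obtain ⟨N, h⟩ := h
      obtain ⟨N', h'⟩ := h'
      refine ⟨max N N', fun M hM => ?_⟩
      rw [map_add, h M (le_of_max_le_left hM), h' M (le_of_max_le_right hM), add_zero]
    | smul c Q _ h =>
      obtain ⟨N, h⟩ := h
      exact ⟨N, fun M hM => by rw [map_smul, h M hM, smul_zero]⟩
  obtain ⟨N, hN⟩ := hN
  have hD : D P = (0 : ℝ) • P := by
    rw [zero_smul]
    change wordEval leftNormed (toAssoc k P) = 0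
    have h0 : toAssoc k P = 0 := hP
    rw [h0, map_zero]
  have h := hN N le_rfl
  rw [haeval _ _ _ hD, Polynomial.eval_prod, smul_eq_zero] at h
  refine h.resolve_left (Finset.prod_ne_zero_iff.2 fun n _ => ?_)
  rw [Polynomial.eval_sub, Polynomial.eval_X, Polynomial.eval_C, zero_sub]
  exact neg_ne_zero.2 (Nat.cast_add_one_ne_zero n)

/-! ### Multilinear Lie polynomials -/

/-- The evaluation of a bracketed word is a combination of rearrangements of its letters. -/
theorem act_eq_zero_of_letters {k : ℕ} {M : Type*} [AddGroup M] (T : FreeMagma (Fin k))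
    (g : List (Fin k) → M) (v : List (Fin k))
    (h : ∀ w : List (Fin k), (w : Multiset (Fin k)) = letters T → g (w ++ v) = 0) :
    act T g v = 0 := by
  induction T generalizing g v with
  | ih1 a => exact h [a] rfl
  | ih2 S T hS hT =>
    have hST : letters (.mul S T) = letters S + letters T := rfl
    change act T (act S g) v - act S (act T g) v = 0
    rw [hT, hS, sub_zero]
    · intro w hw
      refine hT _ _ fun w' hw' => ?_
      rw [← List.append_assoc]
      refine h _ ?_
      change _ = letters (.mul S T)
      rw [hST, ← hw, ← hw', ← Multiset.coe_add, add_comm]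
    · intro w hw
      refine hS _ _ fun w' hw' => ?_
      rw [← List.append_assoc]
      refine h _ ?_
      change _ = letters (.mul S T)
      rw [hST, ← hw, ← hw', ← Multiset.coe_add]

/-- The left-normed bracket of a word that begins with the letter `z`, and `0` for other words. -/
def leftNormedFrom {k : ℕ} (z : Fin k) : List (Fin k) → FreeLieAlgebra ℝ (Fin k)
  | [] => 0
  | a :: w => if a = z then rightAct (FreeLieAlgebra.of ℝ z) w else 0

/-- Left-normed bracketing of the words beginning with `z` annihilates bracketed words without `z`
and recovers those in which `z` occurs once. -/
theorem act_leftNormedFrom {k : ℕ} (z : Fin k) (T : FreeMagma (Fin k)) :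
    ((letters T).count z = 0 → act T (leftNormedFrom z) = fun _ => 0) ∧
    ((letters T).count z = 1 → act T (leftNormedFrom z) = rightAct (bracket T)) := by
  induction T with
  | ih1 a =>
    have hl : letters (FreeMagma.of a) = {a} := rfl
    change ((letters (FreeMagma.of a)).count z = 0 → act (.of a) _ = _) ∧
      ((letters (FreeMagma.of a)).count z = 1 → act (.of a) _ = rightAct (FreeLieAlgebra.of ℝ a))
    rw [hl, Multiset.count_singleton]
    by_cases h : z = a
    · subst h
      refine ⟨by simp, fun _ => funext fun w => ?_⟩
      simp [leftNormedFrom]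
    · refine ⟨fun _ => funext fun w => ?_, by simp [h]⟩
      simp [leftNormedFrom, Ne.symm h]
  | ih2 S T hS hT =>
    have hl : letters (.mul S T) = letters S + letters T := rfl
    change ((letters (.mul S T)).count z = 0 → act (.mul S T) _ = _) ∧
      ((letters (.mul S T)).count z = 1 → act (.mul S T) _ =
        rightAct ⁅bracket S, bracket T⁆)
    rw [hl, Multiset.count_add]
    refine ⟨fun h => funext fun w => ?_, fun h => funext fun w => ?_⟩
    · rw [act_mul, hS.1 (by omega), hT.1 (by omega), act_zero, act_zero, sub_zero]
    · rw [act_mul]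
      rcases Nat.eq_zero_or_pos ((letters S).count z) with h0 | h0
      · rw [hS.1 h0, hT.2 (by omega), act_zero, act_rightAct, zero_sub,
          ← lie_skew (bracket S) (bracket T), rightAct_neg]
      · rw [hS.2 (by omega), hT.1 (by omega), act_zero, act_rightAct, sub_zero]

theorem wordEval_eq_zero {k : ℕ} {M : Type*} [AddCommGroup M] [Module ℝ M]
    (g : List (Fin k) → M) (p : FreeAlgebra ℝ (Fin k)) (h : ∀ w, g w = 0 ∨ coefW w p = 0) :
    wordEval g p = 0 := by
  rw [eq_sum_coefW (wordEval g) p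
    (((FreeAlgebra.basisFreeMonoid ℝ (Fin k)).repr p).support.image FreeMonoid.toList)]
  · refine Finset.sum_eq_zero fun w _ => ?_
    rcases h w with h | h <;> simp [h]
  · intro w hw
    rw [coefW_apply]
    by_contra h0
    exact hw (Finset.mem_image.2 ⟨FreeMonoid.ofList w, Finsupp.mem_support_iff.2 h0, rfl⟩)

/-- The space of multilinear Lie polynomials, spanned by the Lie monomials in which every variable
has multiplicity `1`. -/
def multilinear (k : ℕ) : Submodule ℝ (FreeLieAlgebra ℝ (Fin k)) :=
  Submodule.span ℝ (bracket '' {T | letters T = (Finset.univ : Finset (Fin k)).val})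

theorem bracket_mem_multilinear {k : ℕ} {T : FreeMagma (Fin k)}
    (h : letters T = (Finset.univ : Finset (Fin k)).val) : bracket T ∈ multilinear k :=
  Submodule.subset_span ⟨T, h, rfl⟩

theorem wordEval_leftNormedFrom_toAssoc {k : ℕ} (z : Fin k) {P : FreeLieAlgebra ℝ (Fin k)}
    (hP : P ∈ multilinear k) : wordEval (leftNormedFrom z) (toAssoc k P) = P := by
  induction hP using Submodule.span_induction with
  | mem P h =>
    obtain ⟨T, hT, rfl⟩ := h
    rw [wordEval_toAssoc, (act_leftNormedFrom z T).2]
    · rfl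
    · rw [hT]; exact Multiset.count_univ z
  | zero => simp
  | add P Q _ _ h h' => rw [map_add, map_add, h, h']
  | smul c P _ h => rw [map_smul, map_smul, h]

theorem coefW_toAssoc_eq_zero {k : ℕ} {P : FreeLieAlgebra ℝ (Fin k)} (hP : P ∈ multilinear k)
    {w : List (Fin k)} (hw : (w : Multiset (Fin k)) ≠ (Finset.univ : Finset (Fin k)).val) :
    coefW w (toAssoc k P) = 0 := by
  induction hP using Submodule.span_induction with
  | mem P h =>
    obtain ⟨T, hT, rfl⟩ := h
    rw [coefW, wordEval_toAssoc]
    refine act_eq_zero_of_letters T _ _ fun v hv => if_neg fun h => hw ?_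
    rw [List.append_nil] at h
    rw [← h, hv, hT]
  | zero => simp
  | add P Q _ _ h h' => rw [map_add, map_add, h, h', add_zero]
  | smul c P _ h => rw [map_smul, map_smul, h, smul_zero]

/-- A multilinear Lie polynomial is determined by its coefficients at the words which begin with a
fixed letter. -/
theorem eq_of_coefW_cons {k : ℕ} (z : Fin k) {P Q : FreeLieAlgebra ℝ (Fin k)}
    (hP : P ∈ multilinear k) (hQ : Q ∈ multilinear k)
    (h : ∀ w : List (Fin k), ((z :: w : List (Fin k)) : Multiset (Fin k)) =
      (Finset.univ : Finset (Fin k)).val →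
      coefW (z :: w) (toAssoc k P) = coefW (z :: w) (toAssoc k Q)) : P = Q := by
  rw [← sub_eq_zero, ← wordEval_leftNormedFrom_toAssoc z (Submodule.sub_mem _ hP hQ)]
  refine wordEval_eq_zero _ _ fun w => ?_
  by_cases hw : (w : Multiset (Fin k)) = (Finset.univ : Finset (Fin k)).val
  · match w with
    | [] => exact .inl rfl
    | a :: w =>
      by_cases ha : a = z
      · subst ha
        right
        rw [map_sub, map_sub, h w hw, sub_self]
      · left
        simp [leftNormedFrom, ha]
  · right
    exact coefW_toAssoc_eq_zero (Submodule.sub_mem _ hP hQ) hw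

/-! ### Primitive elements are Lie polynomials -/

open scoped TensorProduct

/-- The coproduct of the free associative algebra for which the variables are primitive. -/
def comul (k : ℕ) :
    FreeAlgebra ℝ (Fin k) →ₐ[ℝ] FreeAlgebra ℝ (Fin k) ⊗[ℝ] FreeAlgebra ℝ (Fin k) :=
  FreeAlgebra.lift ℝ fun a => FreeAlgebra.ι ℝ a ⊗ₜ 1 + 1 ⊗ₜ FreeAlgebra.ι ℝ a

/-- The commutator evaluation of the left-normed bracket. -/
def dynkin (k : ℕ) : FreeAlgebra ℝ (Fin k) →ₗ[ℝ] FreeAlgebra ℝ (Fin k) :=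
  (toAssoc k : FreeLieAlgebra ℝ (Fin k) →ₗ[ℝ] FreeAlgebra ℝ (Fin k)) ∘ₗ wordEval leftNormed

theorem dynkin_word {k : ℕ} (w : List (Fin k)) : dynkin k (word w) = toAssoc k (leftNormed w) := by
  simp [dynkin]

theorem dynkin_mul_ι {k : ℕ} (p : FreeAlgebra ℝ (Fin k)) (a : Fin k) :
    dynkin k (p * FreeAlgebra.ι ℝ a) = dynkin k p * FreeAlgebra.ι ℝ a -
      FreeAlgebra.ι ℝ a * dynkin k p + coefW [] p • FreeAlgebra.ι ℝ a := by
  have h : dynkin k ∘ₗ LinearMap.mulRight ℝ (FreeAlgebra.ι ℝ a) =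
      LinearMap.mulRight ℝ (FreeAlgebra.ι ℝ a) ∘ₗ dynkin k -
        LinearMap.mulLeft ℝ (FreeAlgebra.ι ℝ a) ∘ₗ dynkin k +
        (coefW []).smulRight (FreeAlgebra.ι ℝ a) := by
    refine word_hom_ext fun w => ?_
    have hw : word w * FreeAlgebra.ι ℝ a = word (w ++ [a]) := by
      rw [word_append, word_cons, word_nil, mul_one]
    simp only [LinearMap.comp_apply, LinearMap.mulRight_apply, LinearMap.add_apply,
      LinearMap.sub_apply, LinearMap.mulLeft_apply, LinearMap.smulRight_apply, hw, dynkin_word,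
      coefW_word]
    cases w with
    | nil =>
      change toAssoc k (FreeLieAlgebra.of ℝ a) = _
      rw [toAssoc_of]
      simp [leftNormed]
    | cons b w =>
      have : leftNormed (b :: w ++ [a]) = ⁅leftNormed (b :: w), FreeLieAlgebra.of ℝ a⁆ := by
        simp [leftNormed, rightAct, List.foldl_append]
      rw [this, toAssoc_lie, toAssoc_of]
      simp
  exact LinearMap.congr_fun h p

/-- Multiplication of the left factor with the evaluation of the left-normed brackets of the right
factor. -/
def dynkinConv (k : ℕ) :
    FreeAlgebra ℝ (Fin k) ⊗[ℝ] FreeAlgebra ℝ (Fin k) →ₗ[ℝ] FreeAlgebra ℝ (Fin k) :=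
  TensorProduct.lift ((LinearMap.mul ℝ _).compl₂ (dynkin k))

theorem dynkinConv_tmul {k : ℕ} (p q : FreeAlgebra ℝ (Fin k)) :
    dynkinConv k (p ⊗ₜ q) = p * dynkin k q := by
  simp [dynkinConv]

/-- The counit applied to the right factor. -/
def rightCounit (k : ℕ) :
    FreeAlgebra ℝ (Fin k) ⊗[ℝ] FreeAlgebra ℝ (Fin k) →ₗ[ℝ] FreeAlgebra ℝ (Fin k) :=
  TensorProduct.lift ((LinearMap.lsmul ℝ (FreeAlgebra ℝ (Fin k))).flip.compl₂ (coefW []))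

theorem rightCounit_tmul {k : ℕ} (p q : FreeAlgebra ℝ (Fin k)) :
    rightCounit k (p ⊗ₜ q) = coefW [] q • p := by
  simp [rightCounit]

theorem coefW_nil_ι {k : ℕ} (a : Fin k) : coefW [] (FreeAlgebra.ι ℝ a) = 0 := by
  have h : FreeAlgebra.ι ℝ a = word [a] := by rw [word_cons, word_nil, mul_one]
  rw [h, coefW_word]; simp

theorem coefW_nil_one {k : ℕ} : coefW [] (1 : FreeAlgebra ℝ (Fin k)) = 1 := by
  rw [← word_nil, coefW_word]; simp

theorem rightCounit_mul {k : ℕ} (z : FreeAlgebra ℝ (Fin k) ⊗[ℝ] FreeAlgebra ℝ (Fin k))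
    (a : Fin k) :
    rightCounit k (z * (FreeAlgebra.ι ℝ a ⊗ₜ 1 + 1 ⊗ₜ FreeAlgebra.ι ℝ a)) =
      rightCounit k z * FreeAlgebra.ι ℝ a := by
  induction z using TensorProduct.induction_on with
  | zero => simp
  | tmul p q =>
    rw [mul_add, map_add, Algebra.TensorProduct.tmul_mul_tmul, Algebra.TensorProduct.tmul_mul_tmul,
      rightCounit_tmul, rightCounit_tmul, rightCounit_tmul, coefW_nil_mul, coefW_nil_mul,
      coefW_nil_ι, coefW_nil_one]
    simp
  | add x y hx hy => rw [add_mul, map_add, hx, hy, map_add, add_mul]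

theorem dynkinConv_mul {k : ℕ} (z : FreeAlgebra ℝ (Fin k) ⊗[ℝ] FreeAlgebra ℝ (Fin k))
    (a : Fin k) :
    dynkinConv k (z * (FreeAlgebra.ι ℝ a ⊗ₜ 1 + 1 ⊗ₜ FreeAlgebra.ι ℝ a)) =
      dynkinConv k z * FreeAlgebra.ι ℝ a + rightCounit k z * FreeAlgebra.ι ℝ a := by
  induction z using TensorProduct.induction_on with
  | zero => simp
  | tmul p q =>
    rw [mul_add, map_add, Algebra.TensorProduct.tmul_mul_tmul, Algebra.TensorProduct.tmul_mul_tmul,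
      dynkinConv_tmul, dynkinConv_tmul, dynkinConv_tmul, rightCounit_tmul, mul_one, mul_one,
      dynkin_mul_ι, smul_mul_assoc, ← mul_smul_comm]
    noncomm_ring
  | add x y hx hy => rw [add_mul, map_add, hx, hy, map_add, map_add, add_mul, add_mul]; abel

theorem comul_ι {k : ℕ} (a : Fin k) :
    comul k (FreeAlgebra.ι ℝ a) = FreeAlgebra.ι ℝ a ⊗ₜ 1 + 1 ⊗ₜ FreeAlgebra.ι ℝ a := by
  simp [comul]

/-- The convolution of the identity with left-normed bracketing multiplies words by their
length. -/
theorem dynkinConv_comul_word {k : ℕ} (w : List (Fin k)) :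
    rightCounit k (comul k (word w)) = word w ∧
      dynkinConv k (comul k (word w)) = (w.length : ℝ) • word w := by
  induction w using List.reverseRecOn with
  | nil =>
    rw [word_nil, map_one, Algebra.TensorProduct.one_def, rightCounit_tmul, dynkinConv_tmul,
      coefW_nil_one, ← word_nil, dynkin_word]
    simp [leftNormed]
  | append_singleton w a ih =>
    have hw : word (w ++ [a]) = word w * FreeAlgebra.ι ℝ a := by
      rw [word_append, word_cons, word_nil, mul_one]
    rw [hw, map_mul, comul_ι, rightCounit_mul, dynkinConv_mul, ih.1, ih.2]
    refine ⟨rfl, ?_⟩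
    rw [List.length_append, List.length_singleton, Nat.cast_add, Nat.cast_one, add_smul, one_smul,
      smul_mul_assoc]

/-- A primitive element of degree `n` is `1 / n` times the evaluation of its left-normed
bracketing. -/
theorem dynkin_eq_of_primitive {k : ℕ} {p : FreeAlgebra ℝ (Fin k)} (n : ℕ)
    (hn : ∀ w : List (Fin k), w.length ≠ n → coefW w p = 0)
    (hp : comul k p = p ⊗ₜ 1 + 1 ⊗ₜ p) : dynkin k p = (n : ℝ) • p := by
  have h : ∀ f : FreeAlgebra ℝ (Fin k) →ₗ[ℝ] FreeAlgebra ℝ (Fin k),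
      (∀ w, f (word w) = (w.length : ℝ) • word w) → f p = (n : ℝ) • p := by
    intro f hf
    let f' : FreeAlgebra ℝ (Fin k) →ₗ[ℝ] FreeAlgebra ℝ (Fin k) := f - (n : ℝ) • LinearMap.id
    rw [← sub_eq_zero]
    change f' p = 0
    rw [eq_wordEval_of f']
    refine wordEval_eq_zero _ _ fun w => ?_
    by_cases hw : w.length = n
    · left; simp [f', hf, hw]
    · exact .inr (hn w hw)
  have h1 := h (dynkinConv k ∘ₗ (comul k).toLinearMap) fun w => (dynkinConv_comul_word w).2
  have h2 : dynkin k 1 = 0 := by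
    rw [← word_nil, dynkin_word]; simp [leftNormed]
  rw [LinearMap.comp_apply, AlgHom.toLinearMap_apply, hp, map_add, dynkinConv_tmul,
    dynkinConv_tmul, h2, mul_zero, one_mul, zero_add] at h1
  exact h1

/-! ### The derivative at zero by interpolation -/

/-- A linear functional on sequences which computes the derivative at `0` of polynomial sequences
of degree at most `n`. -/
def derivWeight (n i : ℕ) : ℝ :=
  (Lagrange.basis (Finset.range (n + 1)) (fun j : ℕ => (j : ℝ)) i).derivative.eval 0

theorem sum_derivWeight {n : ℕ} {p : Polynomial ℝ} (hp : p.natDegree ≤ n) :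
    ∑ i ∈ Finset.range (n + 1), derivWeight n i * p.eval (i : ℝ) = p.derivative.eval 0 := by
  have h := Lagrange.eq_interpolate (s := Finset.range (n + 1)) (v := fun j : ℕ => (j : ℝ)) (f := p)
    (fun i _ j _ h => Nat.cast_injective h) (by
      rw [Finset.card_range]
      exact lt_of_le_of_lt Polynomial.degree_le_natDegree (by exact_mod_cast Nat.lt_succ_of_le hp))
  conv_rhs => rw [h]
  rw [Lagrange.interpolate_apply, Polynomial.derivative_sum, Polynomial.eval_finsetSum]
  refine Finset.sum_congr rfl fun i _ => ?_
  rw [Polynomial.derivative_C_mul, Polynomial.eval_C_mul, mul_comm]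
  rfl

/-- The binomial coefficient `x ↦ x (x - 1) ⋯ (x - s + 1) / s!`. -/
def binomPoly (s : ℕ) : Polynomial ℝ := Polynomial.C ((s ! : ℝ)⁻¹) * descPochhammer ℝ s

theorem eval_binomPoly (s i : ℕ) : (binomPoly s).eval (i : ℝ) = (i.choose s : ℝ) := by
  rw [binomPoly, Polynomial.eval_C_mul, descPochhammer_eval_eq_descFactorial,
    Nat.descFactorial_eq_factorial_mul_choose, Nat.cast_mul, inv_mul_cancel_left₀]
  exact_mod_cast s.factorial_ne_zero

theorem natDegree_binomPoly (s : ℕ) : (binomPoly s).natDegree ≤ s :=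
  (Polynomial.natDegree_C_mul_le _ _).trans (descPochhammer_natDegree ℝ s).le

theorem eval_zero_binomPoly_succ (s : ℕ) : (binomPoly (s + 1)).eval 0 = 0 := by
  have := eval_binomPoly (s + 1) 0
  simpa using this

theorem descPochhammer_eval_neg_one (s : ℕ) :
    (descPochhammer ℝ s).eval (-1) = (-1) ^ s * (s ! : ℝ) := by
  induction s with
  | zero => simp
  | succ s ih =>
    rw [descPochhammer_succ_eval, ih, Nat.factorial_succ]
    push_cast
    ring

theorem derivative_binomPoly_succ (s : ℕ) :
    (binomPoly (s + 1)).derivative.eval 0 = (-1) ^ s / (s + 1 : ℝ) := by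
  rw [binomPoly, Polynomial.derivative_C_mul, descPochhammer_succ_left, Polynomial.derivative_mul,
    Polynomial.eval_C_mul, Polynomial.eval_add, Polynomial.eval_mul, Polynomial.eval_mul]
  simp only [Polynomial.derivative_X, Polynomial.eval_one, Polynomial.eval_X, zero_mul, add_zero,
    one_mul, Polynomial.eval_comp, Polynomial.eval_sub, zero_sub]
  rw [descPochhammer_eval_neg_one, Nat.factorial_succ]
  have : (s ! : ℝ) ≠ 0 := by exact_mod_cast s.factorial_ne_zero
  push_cast
  field_simp

/-! ### The logarithm of a group-like series is primitive -/

theorem coeff_pow_eq_zero {k : ℕ} {G : FormalSeries k} (hG : MvPowerSeries.coeff 0 G = 0) (s : ℕ)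
    (d : Fin k →₀ ℕ) (hd : d.degree < s) : MvPowerSeries.coeff d (G ^ s) = 0 := by
  classical
  induction s generalizing d with
  | zero => omega
  | succ s ih =>
    rw [pow_succ', MvPowerSeries.coeff_mul]
    refine Finset.sum_eq_zero fun p hp => ?_
    rw [Finset.HasAntidiagonal.mem_antidiagonal] at hp
    by_cases h0 : p.1 = 0
    · rw [h0, hG, zero_mul]
    · have h1 : p.1.degree ≠ 0 := by rwa [Ne, Finsupp.degree_eq_zero_iff]
      have h2 : p.1.degree + p.2.degree = d.degree := by rw [← hp, map_add]
      rw [ih p.2 (by omega), mul_zero]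

/-- The coefficients of the powers of a series with constant coefficient `1` are polynomials in the
exponent, of degree at most the degree of the coefficient. -/
theorem coeff_pow_eq_sum {k : ℕ} {F : FormalSeries k} (hF : MvPowerSeries.coeff 0 (F - 1) = 0)
    (d : Fin k →₀ ℕ) (i : ℕ) : MvPowerSeries.coeff d (F ^ i) =
      ∑ s ∈ Finset.range (d.degree + 1),
        (binomPoly s).eval (i : ℝ) • MvPowerSeries.coeff d ((F - 1) ^ s) := by
  have h1 : F ^ i = ∑ s ∈ Finset.range (i + 1), (i.choose s) • (F - 1) ^ s := by
    conv_lhs => rw [← sub_add_cancel F 1, (Commute.one_right _).add_pow]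
    refine Finset.sum_congr rfl fun s _ => ?_
    rw [one_pow, mul_one, nsmul_eq_mul, Nat.cast_comm]
  have h2 : ∀ N, d.degree ≤ N → i ≤ N → MvPowerSeries.coeff d (F ^ i) =
      ∑ s ∈ Finset.range (N + 1),
        (binomPoly s).eval (i : ℝ) • MvPowerSeries.coeff d ((F - 1) ^ s) := by
    intro N _ hN
    rw [h1, map_sum]
    refine (Finset.sum_subset (Finset.range_mono (by omega)) ?_).trans
      (Finset.sum_congr rfl fun s _ => ?_)
    · intro s _ hs
      rw [Finset.mem_range] at hs
      rw [Nat.choose_eq_zero_of_lt (by omega), zero_smul, map_zero]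
    · rw [map_nsmul, eval_binomPoly, Nat.cast_smul_eq_nsmul]
  rw [h2 (max d.degree i) (le_max_left _ _) (le_max_right _ _)]
  symm
  refine Finset.sum_subset (Finset.range_mono (by have := le_max_left d.degree i; omega)) ?_
  intro s _ hs
  rw [Finset.mem_range] at hs
  rw [coeff_pow_eq_zero hF s d (by omega), smul_zero]

theorem coeff_zero_pow {k : ℕ} {F : FormalSeries k} (hF : MvPowerSeries.coeff 0 (F - 1) = 0)
    (i : ℕ) : MvPowerSeries.coeff 0 (F ^ i) = 1 := by
  classical
  rw [coeff_pow_eq_sum hF]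
  have h := eval_binomPoly 0 i
  simp [h]

/-- The logarithm is the derivative at exponent `0` of the powers. -/
theorem coeff_logSeries {k : ℕ} {F : FormalSeries k} (hF : MvPowerSeries.coeff 0 (F - 1) = 0)
    (d : Fin k →₀ ℕ) : MvPowerSeries.coeff d (logSeries F) =
      ∑ i ∈ Finset.range (d.degree + 1),
        derivWeight d.degree i • MvPowerSeries.coeff d (F ^ i) := by
  have h1 : ∀ s ∈ Finset.range (d.degree + 1),
      ∑ i ∈ Finset.range (d.degree + 1), derivWeight d.degree i * (binomPoly s).eval (i : ℝ) =
        (binomPoly s).derivative.eval 0 := fun s hs =>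
    sum_derivWeight ((natDegree_binomPoly s).trans (by rw [Finset.mem_range] at hs; omega))
  simp_rw [coeff_pow_eq_sum hF, Finset.smul_sum, smul_smul]
  rw [Finset.sum_comm]
  simp_rw [← Finset.sum_smul]
  rw [Finset.sum_congr rfl fun s hs => by rw [h1 s hs], Finset.sum_range_succ']
  have h0 : (binomPoly 0).derivative.eval 0 = 0 := by simp [binomPoly]
  rw [h0, zero_smul, add_zero]
  change ∑ s ∈ Finset.Icc 1 d.degree, ((-1 : ℝ) ^ (s + 1) / (s : ℝ)) •
    MvPowerSeries.coeff d ((F - 1) ^ s) = _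
  rw [Finset.range_eq_Ico, Finset.sum_Ico_add' (fun s => (binomPoly s).derivative.eval 0 •
    MvPowerSeries.coeff d ((F - 1) ^ s)) 0 d.degree 1, zero_add]
  refine Finset.sum_congr (by ext; simp) fun s hs => ?_
  obtain ⟨t, rfl⟩ : ∃ t, s = t + 1 := ⟨s - 1, by rw [Finset.mem_Ico] at hs; omega⟩
  rw [derivative_binomPoly_succ]
  push_cast
  ring_nf

/-- The coefficientwise embedding into the left tensor factor. -/
def seriesLeft (k : ℕ) : FormalSeries k →+*
    MvPowerSeries (Fin k) (FreeAlgebra ℝ (Fin k) ⊗[ℝ] FreeAlgebra ℝ (Fin k)) :=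
  MvPowerSeries.map
    (Algebra.TensorProduct.includeLeft : _ →ₐ[ℝ]
      FreeAlgebra ℝ (Fin k) ⊗[ℝ] FreeAlgebra ℝ (Fin k)).toRingHom

/-- The coefficientwise embedding into the right tensor factor. -/
def seriesRight (k : ℕ) : FormalSeries k →+*
    MvPowerSeries (Fin k) (FreeAlgebra ℝ (Fin k) ⊗[ℝ] FreeAlgebra ℝ (Fin k)) :=
  MvPowerSeries.map
    (Algebra.TensorProduct.includeRight : _ →ₐ[ℝ]
      FreeAlgebra ℝ (Fin k) ⊗[ℝ] FreeAlgebra ℝ (Fin k)).toRingHom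

/-- The coproduct, applied coefficientwise. -/
def seriesComul (k : ℕ) : FormalSeries k →+*
    MvPowerSeries (Fin k) (FreeAlgebra ℝ (Fin k) ⊗[ℝ] FreeAlgebra ℝ (Fin k)) :=
  MvPowerSeries.map (comul k).toRingHom

theorem coeff_seriesLeft {k : ℕ} (d : Fin k →₀ ℕ) (F : FormalSeries k) :
    MvPowerSeries.coeff d (seriesLeft k F) = MvPowerSeries.coeff d F ⊗ₜ 1 := by
  rw [seriesLeft, MvPowerSeries.coeff_map]; rfl

theorem coeff_seriesRight {k : ℕ} (d : Fin k →₀ ℕ) (F : FormalSeries k) :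
    MvPowerSeries.coeff d (seriesRight k F) = 1 ⊗ₜ MvPowerSeries.coeff d F := by
  rw [seriesRight, MvPowerSeries.coeff_map]; rfl

theorem coeff_seriesComul {k : ℕ} (d : Fin k →₀ ℕ) (F : FormalSeries k) :
    MvPowerSeries.coeff d (seriesComul k F) = comul k (MvPowerSeries.coeff d F) := by
  rw [seriesComul, MvPowerSeries.coeff_map]; rfl

theorem coeff_seriesLeft_mul_seriesRight {k : ℕ} (d : Fin k →₀ ℕ) (F G : FormalSeries k) :
    MvPowerSeries.coeff d (seriesLeft k F * seriesRight k G) =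
      ∑ p ∈ Finset.HasAntidiagonal.antidiagonal d,
        MvPowerSeries.coeff p.1 F ⊗ₜ[ℝ] MvPowerSeries.coeff p.2 G := by
  classical
  rw [MvPowerSeries.coeff_mul]
  refine Finset.sum_congr rfl fun p _ => ?_
  rw [coeff_seriesLeft, coeff_seriesRight, Algebra.TensorProduct.tmul_mul_tmul, mul_one, one_mul]

theorem commute_seriesLeft_seriesRight {k : ℕ} (F G : FormalSeries k) :
    Commute (seriesLeft k F) (seriesRight k G) := by
  classical
  refine MvPowerSeries.ext fun d => ?_
  rw [coeff_seriesLeft_mul_seriesRight, MvPowerSeries.coeff_mul]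
  conv_rhs => rw [← Finset.HasAntidiagonal.map_prodComm_antidiagonal, Finset.sum_map]
  refine Finset.sum_congr rfl fun p _ => ?_
  change _ = MvPowerSeries.coeff p.2 (seriesRight k G) * MvPowerSeries.coeff p.1 (seriesLeft k F)
  rw [coeff_seriesLeft, coeff_seriesRight, Algebra.TensorProduct.tmul_mul_tmul, mul_one, one_mul]

theorem coeff_expVar {k : ℕ} (i : Fin k) (d : Fin k →₀ ℕ) :
    MvPowerSeries.coeff d (expVar k i) =
      if d = Finsupp.single i (d i) then ((d i)! : ℝ)⁻¹ • FreeAlgebra.ι ℝ i ^ (d i) else 0 := rfl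

theorem coeff_single_expVar {k : ℕ} (i : Fin k) (n : ℕ) :
    MvPowerSeries.coeff (Finsupp.single i n) (expVar k i) =
      (n ! : ℝ)⁻¹ • FreeAlgebra.ι ℝ i ^ n := by
  rw [coeff_expVar, Finsupp.single_eq_same, if_pos rfl]

theorem coeff_expVar_of_ne {k : ℕ} (i : Fin k) (d : Fin k →₀ ℕ)
    (h : ∀ n, d ≠ Finsupp.single i n) : MvPowerSeries.coeff d (expVar k i) = 0 := by
  rw [coeff_expVar, if_neg (h _)]

theorem seriesComul_expVar {k : ℕ} (i : Fin k) :
    seriesComul k (expVar k i) = seriesLeft k (expVar k i) * seriesRight k (expVar k i) := by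
  classical
  refine MvPowerSeries.ext fun d => ?_
  rw [coeff_seriesComul, coeff_seriesLeft_mul_seriesRight]
  by_cases hd : ∃ n, d = Finsupp.single i n
  · obtain ⟨n, rfl⟩ := hd
    rw [coeff_single_expVar, Finsupp.antidiagonal_single, Finset.sum_map, map_smul, map_pow,
      comul_ι]
    have hc : Commute (FreeAlgebra.ι ℝ i ⊗ₜ[ℝ] (1 : FreeAlgebra ℝ (Fin k)))
        ((1 : FreeAlgebra ℝ (Fin k)) ⊗ₜ[ℝ] FreeAlgebra.ι ℝ i) := by
      simp [Commute, SemiconjBy, Algebra.TensorProduct.tmul_mul_tmul]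
    rw [hc.add_pow', Finset.smul_sum]
    refine Finset.sum_congr rfl fun p hp => ?_
    rw [Finset.HasAntidiagonal.mem_antidiagonal] at hp
    change _ = MvPowerSeries.coeff (Finsupp.single i p.1) (expVar k i) ⊗ₜ[ℝ]
      MvPowerSeries.coeff (Finsupp.single i p.2) (expVar k i)
    rw [coeff_single_expVar, coeff_single_expVar, ← TensorProduct.smul_tmul',
      TensorProduct.tmul_smul,
      Algebra.TensorProduct.tmul_pow, Algebra.TensorProduct.tmul_pow, one_pow, one_pow,
      Algebra.TensorProduct.tmul_mul_tmul, mul_one, one_mul, ← Nat.cast_smul_eq_nsmul ℝ,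
      smul_smul, smul_smul]
    congr 1
    rw [← hp, Nat.cast_add_choose]
    have := fun n : ℕ => (Nat.cast_ne_zero (R := ℝ)).2 n.factorial_ne_zero
    field_simp [this]
  · rw [coeff_expVar_of_ne i d fun n h => hd ⟨n, h⟩, map_zero]
    symm
    refine Finset.sum_eq_zero fun p hp => ?_
    rw [Finset.HasAntidiagonal.mem_antidiagonal] at hp
    by_cases h1 : ∃ n, p.1 = Finsupp.single i n
    · by_cases h2 : ∃ n, p.2 = Finsupp.single i n
      · obtain ⟨n, h1⟩ := h1
        obtain ⟨m, h2⟩ := h2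
        exact absurd ⟨n + m, by rw [← hp, h1, h2, Finsupp.single_add]⟩ hd
      · rw [coeff_expVar_of_ne i p.2 fun n h => h2 ⟨n, h⟩, TensorProduct.tmul_zero]
    · rw [coeff_expVar_of_ne i p.1 fun n h => h1 ⟨n, h⟩, TensorProduct.zero_tmul]

theorem seriesComul_list_prod {k : ℕ} (l : List (FormalSeries k))
    (h : ∀ F ∈ l, seriesComul k F = seriesLeft k F * seriesRight k F) :
    seriesComul k l.prod = seriesLeft k l.prod * seriesRight k l.prod := by
  induction l with
  | nil => simp
  | cons F l ih =>
    rw [List.prod_cons, map_mul, map_mul, map_mul, h F (by simp),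
      ih fun G hG => h G (by simp [hG]), mul_assoc, mul_assoc, ← mul_assoc (seriesRight k F),
      ← (commute_seriesLeft_seriesRight l.prod F).eq, mul_assoc]

/-- The product of the exponentials is group-like. -/
theorem seriesComul_expProd (k : ℕ) :
    seriesComul k (expProd k) = seriesLeft k (expProd k) * seriesRight k (expProd k) := by
  refine seriesComul_list_prod _ fun F hF => ?_
  obtain ⟨i, rfl⟩ := (List.mem_ofFn' _ _).1 hF
  exact seriesComul_expVar i

theorem coeff_zero_expProd (k : ℕ) : MvPowerSeries.coeff 0 (expProd k - 1) = 0 := by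
  classical
  have h : MvPowerSeries.coeff 0 (expProd k) = 1 := by
    change MvPowerSeries.constantCoeff (List.ofFn (expVar k)).prod = 1
    rw [map_list_prod]
    refine List.prod_eq_one fun x hx => ?_
    obtain ⟨F, hF, rfl⟩ := List.mem_map.1 hx
    obtain ⟨i, rfl⟩ := (List.mem_ofFn' _ _).1 hF
    change MvPowerSeries.coeff 0 (expVar k i) = 1
    have := coeff_single_expVar i 0
    rw [Finsupp.single_zero] at this
    rw [this]; simp
  rw [map_sub, h, MvPowerSeries.coeff_one, if_pos rfl, sub_self]

/-- The coefficients of the logarithm of a group-like series are primitive: the derivative at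
exponent `0` of a product of two polynomials vanishing at `0` is zero, so that only the extreme
terms of the coproduct contribute. -/
theorem comul_coeff_logSeries {k : ℕ} {F : FormalSeries k}
    (hF : MvPowerSeries.coeff 0 (F - 1) = 0)
    (hF' : seriesComul k F = seriesLeft k F * seriesRight k F) {d : Fin k →₀ ℕ} (hd : d ≠ 0) :
    comul k (MvPowerSeries.coeff d (logSeries F)) =
      MvPowerSeries.coeff d (logSeries F) ⊗ₜ 1 + 1 ⊗ₜ MvPowerSeries.coeff d (logSeries F) := by
  classical
  have hpow : ∀ i, seriesComul k (F ^ i) = seriesLeft k (F ^ i) * seriesRight k (F ^ i) := by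
    intro i
    rw [map_pow, map_pow, map_pow, hF', (commute_seriesLeft_seriesRight F F).mul_pow]
  rw [coeff_logSeries hF, map_sum]
  simp_rw [map_smul, ← coeff_seriesComul, hpow, coeff_seriesLeft_mul_seriesRight, Finset.smul_sum]
  rw [Finset.sum_comm, Finset.sum_eq_add_of_mem (d, 0) (0, d) (by simp) (by simp)
    (by simp [Prod.ext_iff, hd])]
  · congr 1
    · rw [TensorProduct.sum_tmul]
      refine Finset.sum_congr rfl fun i _ => ?_
      rw [coeff_zero_pow hF, TensorProduct.smul_tmul']
    · rw [TensorProduct.tmul_sum]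
      refine Finset.sum_congr rfl fun i _ => ?_
      rw [coeff_zero_pow hF, TensorProduct.tmul_smul]
  · rintro ⟨u, v⟩ huv ⟨hne1, hne2⟩
    rw [Finset.HasAntidiagonal.mem_antidiagonal] at huv
    change u + v = d at huv
    have hu : u ≠ 0 := by
      rintro rfl
      rw [zero_add] at huv
      exact hne2 (by rw [huv])
    have hv : v ≠ 0 := by
      rintro rfl
      rw [add_zero] at huv
      exact hne1 (by rw [huv])
    have hdeg : u.degree + v.degree = d.degree := by rw [← huv, map_add]
    change ∑ i ∈ Finset.range (d.degree + 1), derivWeight d.degree i •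
      (MvPowerSeries.coeff u (F ^ i) ⊗ₜ[ℝ] MvPowerSeries.coeff v (F ^ i)) = 0
    simp_rw [coeff_pow_eq_sum hF, TensorProduct.sum_tmul, TensorProduct.tmul_sum,
      ← TensorProduct.smul_tmul', TensorProduct.tmul_smul, Finset.smul_sum, smul_smul]
    rw [Finset.sum_comm]
    refine Finset.sum_eq_zero fun s hs => ?_
    rw [Finset.sum_comm]
    refine Finset.sum_eq_zero fun t ht => ?_
    rw [← Finset.sum_smul]
    rw [Finset.mem_range] at hs ht
    match s, t with
    | 0, t => simp [MvPowerSeries.coeff_one, hu]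
    | s + 1, 0 => simp [MvPowerSeries.coeff_one, hv]
    | s + 1, t + 1 =>
      have h := sum_derivWeight (n := d.degree) (p := binomPoly (s + 1) * binomPoly (t + 1))
        (Polynomial.natDegree_mul_le.trans ((add_le_add (natDegree_binomPoly _)
          (natDegree_binomPoly _)).trans (by omega)))
      simp_rw [Polynomial.eval_mul, Polynomial.derivative_mul, Polynomial.eval_add,
        Polynomial.eval_mul, eval_zero_binomPoly_succ, mul_zero, zero_mul, add_zero] at h
      convert zero_smul ℝ _ using 2

/-! ### The coefficients of the Magnus commutator -/

/-- The multiplicities of the variables in a word. -/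
def content {k : ℕ} (w : List (Fin k)) : Fin k →₀ ℕ := (w.map fun i => Finsupp.single i 1).sum

@[simp] theorem content_nil {k : ℕ} : content ([] : List (Fin k)) = 0 := rfl

theorem content_cons {k : ℕ} (a : Fin k) (w : List (Fin k)) :
    content (a :: w) = Finsupp.single a 1 + content w := by
  simp [content]

theorem content_append {k : ℕ} (u v : List (Fin k)) :
    content (u ++ v) = content u + content v := by
  simp [content]

theorem content_replicate {k : ℕ} (i : Fin k) (n : ℕ) :
    content (List.replicate n i) = Finsupp.single i n := by
  simp [content]

theorem content_apply {k : ℕ} (w : List (Fin k)) (i : Fin k) : content w i = w.count i := by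
  induction w with
  | nil => rfl
  | cons a w ih =>
    rw [content_cons, Finsupp.add_apply, ih, List.count_cons, Finsupp.single_apply, add_comm]
    simp

/-- A series in which each variable `X_i` comes with a factor `t_i`. -/
def IsBalanced {k : ℕ} (F : FormalSeries k) : Prop :=
  ∀ d w, coefW w (MvPowerSeries.coeff d F) ≠ 0 → content w = d

/-- The coefficient of a word in a balanced series. -/
def serCoef {k : ℕ} (F : FormalSeries k) (w : List (Fin k)) : ℝ :=
  coefW w (MvPowerSeries.coeff (content w) F)

theorem coefW_one {k : ℕ} (w : List (Fin k)) : coefW w 1 = if w = [] then 1 else 0 := by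
  rw [← word_nil, coefW_word]; exact if_congr eq_comm rfl rfl

theorem isBalanced_one {k : ℕ} : IsBalanced (1 : FormalSeries k) := by
  classical
  intro d w h
  rw [MvPowerSeries.coeff_one] at h
  split_ifs at h with hd
  · rw [coefW_one] at h
    rw [hd, (ite_ne_right_iff.1 h).1]; rfl
  · simp at h

theorem IsBalanced.sub {k : ℕ} {F G : FormalSeries k} (hF : IsBalanced F) (hG : IsBalanced G) :
    IsBalanced (F - G) := by
  intro d w h
  rw [map_sub, map_sub] at h
  by_cases h1 : coefW w (MvPowerSeries.coeff d F) = 0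
  · refine hG d w fun h2 => h ?_
    rw [h1, h2, sub_zero]
  · exact hF d w h1

theorem IsBalanced.mul {k : ℕ} {F G : FormalSeries k} (hF : IsBalanced F) (hG : IsBalanced G) :
    IsBalanced (F * G) := by
  classical
  intro d w h
  rw [MvPowerSeries.coeff_mul, map_sum] at h
  obtain ⟨p, hp, h⟩ := Finset.exists_ne_zero_of_sum_ne_zero h
  rw [coefW_mul] at h
  obtain ⟨i, _, h⟩ := Finset.exists_ne_zero_of_sum_ne_zero h
  rw [Finset.HasAntidiagonal.mem_antidiagonal] at hp
  rw [← hp, ← hF _ _ (left_ne_zero_of_mul h), ← hG _ _ (right_ne_zero_of_mul h), ← content_append,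
    List.take_append_drop]

theorem IsBalanced.pow {k : ℕ} {F : FormalSeries k} (hF : IsBalanced F) (s : ℕ) :
    IsBalanced (F ^ s) := by
  induction s with
  | zero => rw [pow_zero]; exact isBalanced_one
  | succ s ih => rw [pow_succ]; exact ih.mul hF

theorem ι_pow {k : ℕ} (i : Fin k) (n : ℕ) :
    FreeAlgebra.ι ℝ i ^ n = word (List.replicate n i) := by
  simp [word]

theorem isBalanced_expVar {k : ℕ} (i : Fin k) : IsBalanced (expVar k i) := by
  intro d w h
  by_cases hd : ∃ n, d = Finsupp.single i n
  · obtain ⟨n, rfl⟩ := hd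
    rw [coeff_single_expVar, map_smul, ι_pow, coefW_word] at h
    have := (ite_ne_right_iff.1 (right_ne_zero_of_smul h)).1
    rw [← this, content_replicate]
  · rw [coeff_expVar_of_ne i d fun n h => hd ⟨n, h⟩, map_zero] at h
    exact absurd rfl h

theorem isBalanced_list_prod {k : ℕ} (l : List (FormalSeries k)) (h : ∀ F ∈ l, IsBalanced F) :
    IsBalanced l.prod := by
  induction l with
  | nil => exact isBalanced_one
  | cons F l ih =>
    rw [List.prod_cons]
    exact (h F (by simp)).mul (ih fun G hG => h G (by simp [hG]))

theorem serCoef_one {k : ℕ} (w : List (Fin k)) :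
    serCoef (1 : FormalSeries k) w = if w = [] then 1 else 0 := by
  classical
  rw [serCoef, MvPowerSeries.coeff_one]
  by_cases h : w = []
  · subst h; simp [coefW_one]
  · rw [if_neg h]
    split_ifs
    · rw [coefW_one, if_neg h]
    · simp

/-- On balanced series, multiplication is given by deconcatenation of words. -/
theorem serCoef_mul {k : ℕ} {F : FormalSeries k} (hF : IsBalanced F) (G : FormalSeries k)
    (w : List (Fin k)) : serCoef (F * G) w =
      ∑ i ∈ Finset.range (w.length + 1), serCoef F (w.take i) * serCoef G (w.drop i) := by
  classical
  rw [serCoef, MvPowerSeries.coeff_mul, map_sum]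
  simp_rw [coefW_mul]
  rw [Finset.sum_comm]
  refine Finset.sum_congr rfl fun i _ => ?_
  have hw : content (w.take i) + content (w.drop i) = content w := by
    rw [← content_append, List.take_append_drop]
  rw [Finset.sum_eq_single_of_mem (content (w.take i), content (w.drop i))
    (Finset.HasAntidiagonal.mem_antidiagonal.2 hw)]
  · rfl
  · rintro ⟨u, v⟩ huv hne
    rw [Finset.HasAntidiagonal.mem_antidiagonal] at huv
    change u + v = _ at huv
    by_contra h
    have h1 : content (w.take i) = u := hF _ _ (left_ne_zero_of_mul h)
    rw [← hw, ← h1] at huv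
    exact hne (Prod.ext h1.symm (add_left_cancel huv))

theorem serCoef_expVar {k : ℕ} (i : Fin k) {w : List (Fin k)} (hw : w.Nodup) :
    serCoef (expVar k i) w = if w = [] ∨ w = [i] then 1 else 0 := by
  rw [serCoef]
  by_cases h : ∃ n, w = List.replicate n i
  · obtain ⟨n, rfl⟩ := h
    have hn : n ≤ 1 := List.nodup_replicate.1 hw
    rw [content_replicate, coeff_single_expVar, map_smul, ι_pow, coefW_word, if_pos rfl, if_pos]
    · interval_cases n <;> simp
    · interval_cases n <;> simp
  · rw [if_neg]
    · by_contra h0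
      by_cases hd : ∃ n, content w = Finsupp.single i n
      · obtain ⟨n, hn⟩ := hd
        rw [hn, coeff_single_expVar, map_smul, ι_pow, coefW_word] at h0
        exact h ⟨n, (ite_ne_right_iff.1 (right_ne_zero_of_smul h0)).1.symm⟩
      · rw [coeff_expVar_of_ne i _ fun n h => hd ⟨n, h⟩, map_zero] at h0
        exact h0 rfl
    · rintro (rfl | rfl)
      · exact h ⟨0, rfl⟩
      · exact h ⟨1, rfl⟩

/-- On words without repetitions an ordered product of exponentials is the indicator function of
the subwords of the word of its factors. -/
theorem serCoef_prod_expVar {k : ℕ} (l : List (Fin k)) (hl : l.Nodup) {w : List (Fin k)}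
    (hw : w.Nodup) :
    serCoef (l.map (expVar k)).prod w = if w.Sublist l then 1 else 0 := by
  induction l generalizing w with
  | nil =>
    rw [List.map_nil, List.prod_nil, serCoef_one]
    simp
  | cons i l ih =>
    rw [List.nodup_cons] at hl
    rw [List.map_cons, List.prod_cons, serCoef_mul (isBalanced_expVar i)]
    cases w with
    | nil =>
      simp [serCoef_expVar i List.nodup_nil, ih hl.2 List.nodup_nil]
    | cons a w =>
      have ha := (List.nodup_cons.1 hw).2
      rw [List.length_cons, Finset.sum_range_succ', Finset.sum_range_succ', Finset.sum_eq_zero,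
        zero_add]
      · simp only [zero_add, List.take_succ_cons, List.take_zero, List.drop_succ_cons,
          List.drop_zero]
        rw [serCoef_expVar i (List.nodup_singleton a), serCoef_expVar i List.nodup_nil,
          ih hl.2 ha, ih hl.2 hw]
        by_cases hai : a = i
        · subst hai
          have : ¬ (a :: w).Sublist l := fun h => hl.1 (h.subset (by simp))
          simp [this]
        · have : (a :: w).Sublist (i :: l) ↔ (a :: w).Sublist l := by
            rw [List.cons_sublist_cons']
            simp [hai]
          simp [this, hai]
      · intro j hj
        rw [serCoef_expVar i (hw.sublist (List.take_sublist _ _)), if_neg, zero_mul]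
        rw [Finset.mem_range] at hj
        rintro (h | h)
        · simp at h
        · have := congrArg List.length h
          rw [List.length_take, List.length_cons, List.length_singleton] at this
          omega

theorem sublist_finRange_iff {k : ℕ} (w : List (Fin k)) :
    w.Sublist (List.finRange k) ↔ w.Pairwise (· < ·) := by
  refine ⟨fun h => (List.pairwise_lt_finRange k).sublist h, fun h => ?_⟩
  have hn : w.Nodup := h.imp fun h => h.ne
  exact List.sublist_of_subperm_of_pairwise (hn.subperm fun a _ => List.mem_finRange a)
    h (List.pairwise_lt_finRange k)

theorem isBalanced_expProd_sub_one (k : ℕ) : IsBalanced (expProd k - 1) := by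
  refine IsBalanced.sub (isBalanced_list_prod _ fun F hF => ?_) isBalanced_one
  obtain ⟨i, rfl⟩ := (List.mem_ofFn' _ _).1 hF
  exact isBalanced_expVar i

theorem serCoef_expProd_sub_one {k : ℕ} {w : List (Fin k)} (hw : w.Nodup) :
    serCoef (expProd k - 1) w = if w ≠ [] ∧ w.Pairwise (· < ·) then 1 else 0 := by
  have h : serCoef (expProd k - 1) w = serCoef (expProd k) w - serCoef 1 w := by
    simp [serCoef]
  rw [h, expProd, List.ofFn_eq_map, serCoef_prod_expVar _ (List.nodup_finRange k) hw, serCoef_one]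
  simp only [sublist_finRange_iff]
  by_cases h0 : w = []
  · subst h0; simp
  · simp [h0]

theorem serCoef_pow_zero {k : ℕ} (w : List (Fin k)) (G : FormalSeries k) :
    serCoef (G ^ 0) w = if w = [] then 1 else 0 := by rw [pow_zero, serCoef_one]

theorem serCoef_pow_succ {k : ℕ} (w : List (Fin k)) (s : ℕ) :
    serCoef ((expProd k - 1) ^ (s + 1)) w = ∑ i ∈ Finset.range (w.length + 1),
      serCoef (expProd k - 1) (w.take i) * serCoef ((expProd k - 1) ^ s) (w.drop i) := by
  rw [pow_succ', serCoef_mul (isBalanced_expProd_sub_one k)]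

theorem serCoef_pow_nil {k : ℕ} (s : ℕ) :
    serCoef ((expProd k - 1) ^ s) [] = if s = 0 then 1 else 0 := by
  cases s with
  | zero => simp [serCoef_one]
  | succ s => simp [serCoef_pow_succ, serCoef_expProd_sub_one]

/-- The first letter of a word is cut off, or, if the second letter is greater, possibly kept
together with the second one. -/
theorem serCoef_pow_cons_cons {k : ℕ} (a b : Fin k) (w : List (Fin k))
    (hw : (a :: b :: w).Nodup) (s : ℕ) :
    serCoef ((expProd k - 1) ^ (s + 1)) (a :: b :: w) =
      serCoef ((expProd k - 1) ^ s) (b :: w) +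
        if a < b then serCoef ((expProd k - 1) ^ (s + 1)) (b :: w) else 0 := by
  have hw' := (List.nodup_cons.1 hw).2
  rw [serCoef_pow_succ, Finset.sum_range_succ']
  have h0 : serCoef (expProd k - 1) ((a :: b :: w).take 0) = 0 := by
    rw [List.take_zero, serCoef_expProd_sub_one List.nodup_nil]; simp
  rw [h0, zero_mul, add_zero, serCoef_pow_succ (b :: w)]
  have hterm : ∀ i, serCoef (expProd k - 1) ((a :: b :: w).take (i + 1)) =
      (if i = 0 then 1 else 0) +
        if a < b then serCoef (expProd k - 1) ((b :: w).take i) else 0 := by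
    intro i
    rw [serCoef_expProd_sub_one (hw.sublist (List.take_sublist _ _)),
      serCoef_expProd_sub_one (hw'.sublist (List.take_sublist _ _))]
    cases i with
    | zero => simp
    | succ i =>
      simp only [List.take_succ_cons, List.pairwise_cons_cons_iff_of_trans]
      by_cases hab : a < b <;> simp [hab]
  have hlen : (a :: b :: w).length = (b :: w).length + 1 := rfl
  rw [hlen]
  simp_rw [hterm, List.drop_succ_cons, add_mul, Finset.sum_add_distrib]
  congr 1
  · simp
  · split_ifs
    · rfl
    · simp

/-- The generating polynomial for the number of ways to cut a word into increasing pieces. -/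
def runPoly {k : ℕ} : List (Fin k) → Polynomial ℝ
  | [] => 1
  | [_] => .X
  | a :: b :: w => (if a < b then 1 + .X else .X) * runPoly (b :: w)

theorem serCoef_pow_eq_coeff_runPoly {k : ℕ} (w : List (Fin k)) (hw : w.Nodup) (s : ℕ) :
    serCoef ((expProd k - 1) ^ s) w = (runPoly w).coeff s := by
  induction w generalizing s with
  | nil => rw [serCoef_pow_nil, runPoly, Polynomial.coeff_one]
  | cons a w ih =>
    cases w with
    | nil =>
      cases s with
      | zero => simp [serCoef_one, runPoly]
      | succ s =>
        rw [serCoef_pow_succ, runPoly, Polynomial.coeff_X]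
        simp [Finset.sum_range_succ, serCoef_expProd_sub_one, serCoef_pow_nil, eq_comm]
    | cons b w =>
      have hw' := (List.nodup_cons.1 hw).2
      cases s with
      | zero =>
        rw [serCoef_pow_zero, runPoly]
        have h0 := ih hw' 0
        rw [serCoef_pow_zero] at h0
        simp only [reduceCtorEq, if_false] at h0 ⊢
        rw [Polynomial.mul_coeff_zero, ← h0, mul_zero]
      | succ s =>
        rw [serCoef_pow_cons_cons a b w hw, ih hw', ih hw', runPoly]
        split_ifs
        · rw [add_mul, one_mul, Polynomial.coeff_add, Polynomial.coeff_X_mul, add_comm]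
        · rw [Polynomial.coeff_X_mul, add_zero]

/-- The number of ascents of a word. -/
def ascents {X : Type*} [LT X] [DecidableLT X] : List X → ℕ
  | [] => 0
  | [_] => 0
  | a :: b :: w => (if a < b then 1 else 0) + ascents (b :: w)

/-- The number of descents of a word, where equal neighbours count as a descent. -/
def descents {X : Type*} [LT X] [DecidableLT X] : List X → ℕ
  | [] => 0
  | [_] => 0
  | a :: b :: w => (if a < b then 0 else 1) + descents (b :: w)

theorem runPoly_eq {k : ℕ} (w : List (Fin k)) (hw : w ≠ []) :
    runPoly w = .X ^ (descents w + 1) * (1 + .X) ^ ascents w := by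
  induction w with
  | nil => exact absurd rfl hw
  | cons a w ih =>
    cases w with
    | nil => simp [runPoly, ascents, descents]
    | cons b w =>
      rw [runPoly, ih (by simp), ascents, descents]
      split_ifs <;> ring

theorem ascents_add_descents {X : Type*} [LT X] [DecidableLT X] (w : List X) :
    ascents w + descents w = w.length - 1 := by
  induction w with
  | nil => rfl
  | cons a w ih =>
    cases w with
    | nil => rfl
    | cons b w =>
      rw [ascents, descents]
      simp only [List.length_cons] at ih ⊢
      split_ifs <;> omega

/-- The logarithmic weights of the numbers of pieces, a discrete form of the beta integral. -/
theorem sum_log_coeff (n a d : ℕ) (h : a + d + 1 ≤ n) :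
    ∑ s ∈ Finset.Icc 1 n, ((-1 : ℝ) ^ (s + 1) / s) *
      (Polynomial.X ^ (d + 1) * (1 + Polynomial.X) ^ a : Polynomial ℝ).coeff s =
    (-1) ^ d * (a ! * d ! / (a + d + 1)! : ℝ) := by
  induction a generalizing d with
  | zero =>
    simp only [pow_zero, mul_one, Polynomial.coeff_X_pow, mul_ite, mul_zero]
    rw [Finset.sum_ite_eq' (Finset.Icc 1 n) (d + 1), if_pos (Finset.mem_Icc.2 ⟨by omega, by omega⟩),
      zero_add, Nat.factorial_succ]
    have : (d ! : ℝ) ≠ 0 := by exact_mod_cast d.factorial_ne_zero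
    push_cast
    rw [pow_add, pow_add]
    field_simp
    simp
  | succ a ih =>
    have hp : (Polynomial.X ^ (d + 1) * (1 + Polynomial.X) ^ (a + 1) : Polynomial ℝ) =
        Polynomial.X ^ (d + 1) * (1 + Polynomial.X) ^ a +
          Polynomial.X ^ (d + 1 + 1) * (1 + Polynomial.X) ^ a := by ring
    simp_rw [hp, Polynomial.coeff_add, mul_add, Finset.sum_add_distrib]
    rw [ih d (by omega), ih (d + 1) (by omega)]
    have e1 : a + 1 + d + 1 = (a + d + 1) + 1 := by ring
    have e2 : a + (d + 1) + 1 = (a + d + 1) + 1 := by ring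
    rw [e1, e2, Nat.factorial_succ a, Nat.factorial_succ d, Nat.factorial_succ (a + d + 1)]
    have : ((a + d + 1)! : ℝ) ≠ 0 := by exact_mod_cast (a + d + 1).factorial_ne_zero
    have h3 : ((a + d + 1 : ℕ) : ℝ) + 1 ≠ 0 := by positivity
    push_cast at h3 ⊢
    field_simp
    ring

theorem content_eq_ones_iff {k : ℕ} (w : List (Fin k)) :
    content w = (∑ i : Fin k, Finsupp.single i 1) ↔
      (w : Multiset (Fin k)) = (Finset.univ : Finset (Fin k)).val := by
  classical
  have h1 : ∀ i : Fin k, (∑ i : Fin k, Finsupp.single i 1 : Fin k →₀ ℕ) i = 1 := by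
    intro i
    rw [Finsupp.finsetSum_apply]
    simp [Finsupp.single_apply]
  rw [Finsupp.ext_iff, Multiset.ext]
  refine forall_congr' fun i => ?_
  rw [h1, content_apply, Multiset.coe_count, Multiset.count_univ]

theorem degree_ones (k : ℕ) : (∑ i : Fin k, Finsupp.single i 1 : Fin k →₀ ℕ).degree = k := by
  rw [map_sum]; simp

theorem magnus_eq_sum (k : ℕ) : magnus k = ∑ s ∈ Finset.Icc 1 k, ((-1 : ℝ) ^ (s + 1) / (s : ℝ)) •
    MvPowerSeries.coeff (∑ i : Fin k, Finsupp.single i 1) ((expProd k - 1) ^ s) := by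
  change ∑ s ∈ Finset.Icc 1 (∑ i : Fin k, Finsupp.single i 1 : Fin k →₀ ℕ).degree, _ = _
  rw [degree_ones]

theorem coefW_magnus_eq_zero {k : ℕ} {w : List (Fin k)}
    (hw : (w : Multiset (Fin k)) ≠ (Finset.univ : Finset (Fin k)).val) :
    coefW w (magnus k) = 0 := by
  rw [magnus_eq_sum, map_sum]
  refine Finset.sum_eq_zero fun s _ => ?_
  rw [map_smul]
  by_contra h
  exact hw ((content_eq_ones_iff w).1
    ((isBalanced_expProd_sub_one k).pow s _ _ (right_ne_zero_of_smul h)))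

/-- The coefficient of a permutation in the Magnus commutator. The coefficient of the `s`-th power
in the logarithm counts the ways to cut the word into `s` increasing pieces. -/
theorem coefW_magnus {k : ℕ} {w : List (Fin k)}
    (hw : (w : Multiset (Fin k)) = (Finset.univ : Finset (Fin k)).val) (h0 : w ≠ []) :
    coefW w (magnus k) = (-1) ^ descents w * ((ascents w)! * (descents w)! / k ! : ℝ) := by
  have hnd : w.Nodup := by
    rw [← Multiset.coe_nodup, hw]; exact Finset.univ.nodup
  have hlen : w.length = k := by
    rw [← Multiset.coe_card, hw]; simp
  have hlen' : ascents w + descents w + 1 = k := by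
    have := ascents_add_descents w
    have := List.length_pos_iff.2 h0
    omega
  have h := sum_log_coeff k (ascents w) (descents w) hlen'.le
  rw [hlen'] at h
  rw [← h, magnus_eq_sum, map_sum]
  refine Finset.sum_congr rfl fun s _ => ?_
  rw [map_smul, smul_eq_mul, ← runPoly_eq w h0, ← serCoef_pow_eq_coeff_runPoly w hnd, serCoef,
    (content_eq_ones_iff w).2 hw]

/-- The Magnus commutator is a multilinear Lie polynomial, namely `1 / k` times its left-normed
bracketing. -/
theorem exists_multilinear_toAssoc_eq_magnus (k : ℕ) [NeZero k] :
    ∃ P ∈ multilinear k, toAssoc k P = magnus k := by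
  have hprim : comul k (magnus k) = magnus k ⊗ₜ 1 + 1 ⊗ₜ magnus k := by
    refine comul_coeff_logSeries (coeff_zero_expProd k) (seriesComul_expProd k) fun h => ?_
    have := degree_ones k
    rw [h, map_zero] at this
    exact NeZero.ne k this.symm
  have hdyn := dynkin_eq_of_primitive k (fun w hw => coefW_magnus_eq_zero fun h => hw (by
    rw [← Multiset.coe_card, h]; simp)) hprim
  refine ⟨(k : ℝ)⁻¹ • wordEval leftNormed (magnus k), Submodule.smul_mem _ _ ?_, ?_⟩
  · rw [eq_sum_coefW (wordEval leftNormed) (magnus k)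
      (((FreeAlgebra.basisFreeMonoid ℝ (Fin k)).repr (magnus k)).support.image FreeMonoid.toList)]
    · refine Submodule.sum_mem _ fun w _ => ?_
      by_cases hw : (w : Multiset (Fin k)) = (Finset.univ : Finset (Fin k)).val
      · refine Submodule.smul_mem _ _ ?_
        rw [wordEval_word]
        cases w with
        | nil =>
          have := congrArg Multiset.card hw
          simp at this
          exact absurd this.symm (NeZero.ne k)
        | cons a w =>
          have h : ∀ (w : List (Fin k)) (T : FreeMagma (Fin k)),
              ∃ T' : FreeMagma (Fin k), letters T' = letters T + w ∧
                rightAct (bracket T) w = bracket T' := by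
            intro w
            induction w with
            | nil => exact fun T => ⟨T, by simp, rfl⟩
            | cons b w ih =>
              intro T
              obtain ⟨T', h1, h2⟩ := ih (.mul T (.of b))
              refine ⟨T', ?_, h2⟩
              have : letters (.mul T (.of b)) = letters T + {b} := rfl
              rw [h1, this, add_assoc, ← Multiset.cons_coe, Multiset.singleton_add]
          obtain ⟨T', h1, h2⟩ := h w (.of a)
          change rightAct (bracket (.of a)) w ∈ _
          rw [h2]
          refine bracket_mem_multilinear ?_
          have : letters (FreeMagma.of a) = {a} := rfl
          rw [h1, this, ← hw, ← Multiset.cons_coe, Multiset.singleton_add]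
      · rw [coefW_magnus_eq_zero hw, zero_smul]
        exact Submodule.zero_mem _
    · intro w hw
      rw [coefW_apply]
      by_contra h0
      exact hw (Finset.mem_image.2 ⟨FreeMonoid.ofList w, Finsupp.mem_support_iff.2 h0, rfl⟩)
  · rw [map_smul]
    have h : toAssoc k (wordEval leftNormed (magnus k)) = dynkin k (magnus k) := rfl
    rw [h, hdyn, smul_smul, inv_mul_cancel₀ (Nat.cast_ne_zero.2 (NeZero.ne k)), one_smul]

/-! ### Enumeration of the Lie monomials up to sign -/

/-- The letters of a bracketed word, from left to right. -/
def leaves {X : Type*} (T : FreeMagma X) : List X :=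
  FreeMagma.rec (fun a => [a]) (fun _ _ l₁ l₂ => l₁ ++ l₂) T

theorem leaves_of {X : Type*} (a : X) : leaves (.of a) = [a] := rfl

theorem leaves_mul {X : Type*} (S T : FreeMagma X) :
    leaves (.mul S T) = leaves S ++ leaves T := rfl

theorem leaves_ne_nil {X : Type*} (T : FreeMagma X) : leaves T ≠ [] := by
  induction T with
  | ih1 a => exact List.cons_ne_nil _ _
  | ih2 S T hS hT => exact List.append_ne_nil_of_left_ne_nil hS _

theorem leaves_map {X Y : Type*} (f : X → Y) (T : FreeMagma X) :
    leaves (FreeMagma.map f T) = (leaves T).map f := by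
  induction T with
  | ih1 a => rfl
  | ih2 S T hS hT =>
    change leaves (FreeMagma.map f S) ++ leaves (FreeMagma.map f T) = (leaves S ++ leaves T).map f
    rw [hS, hT, List.map_append]

theorem letters_eq_leaves {k : ℕ} (T : FreeMagma (Fin k)) :
    letters T = (leaves T : Multiset (Fin k)) := by
  induction T with
  | ih1 a => rfl
  | ih2 S T hS hT =>
    change letters S + letters T = ((leaves S ++ leaves T : List (Fin k)) : Multiset (Fin k))
    rw [hS, hT, Multiset.coe_add]

theorem letters_eq_univ_iff {k : ℕ} (T : FreeMagma (Fin k)) :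
    letters T = (Finset.univ : Finset (Fin k)).val ↔
      ((leaves T).map Fin.val).Perm (List.range k) := by
  have h : (Finset.univ : Finset (Fin k)).val = (List.finRange k : Multiset (Fin k)) := rfl
  rw [letters_eq_leaves, h, Multiset.coe_eq_coe, ← List.map_coe_finRange_eq_range]
  exact (List.map_perm_map_iff Fin.val_injective).symm

/-- Bracketed words that agree up to swapping the two sides of brackets. -/
inductive SwapEquiv {X : Type*} : FreeMagma X → FreeMagma X → Prop
  | refl (A) : SwapEquiv A A
  | trans {A B C} : SwapEquiv A B → SwapEquiv B C → SwapEquiv A C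
  | swap (A B) : SwapEquiv (.mul A B) (.mul B A)
  | mul {A A' B B'} : SwapEquiv A A' → SwapEquiv B B' → SwapEquiv (.mul A B) (.mul A' B')

/-- Swapping the sides of a bracket changes the sign. -/
theorem SwapEquiv.act {X : Type*} {A B : FreeMagma X} (h : SwapEquiv A B) :
    ∃ s : ℤˣ, ∀ (g : List X → ℤ) (w : List X), act A g w = s * act B g w := by
  induction h with
  | refl A => exact ⟨1, fun g w => by simp⟩
  | trans _ _ h₁ h₂ =>
    obtain ⟨s, hs⟩ := h₁
    obtain ⟨t, ht⟩ := h₂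
    exact ⟨s * t, fun g w => by rw [hs, ht]; push_cast; ring⟩
  | swap A B => exact ⟨-1, fun g w => by rw [act_mul, act_mul]; push_cast; ring⟩
  | @mul A A' B B' _ _ h₁ h₂ =>
    obtain ⟨s, hs⟩ := h₁
    obtain ⟨t, ht⟩ := h₂
    refine ⟨s * t, fun g w => ?_⟩
    have e₁ : Magnus.act A g = fun v => AddMonoidHom.mulLeft (s : ℤ) (Magnus.act A' g v) :=
      funext (hs g)
    have e₂ : Magnus.act B g = fun v => AddMonoidHom.mulLeft (t : ℤ) (Magnus.act B' g v) :=
      funext (ht g)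
    rw [act_mul, act_mul, ht, hs, e₁, e₂, act_comp_hom, act_comp_hom]
    simp only [AddMonoidHom.coe_mulLeft]
    push_cast
    ring

/-- `IsInsertion x A A'` says that `A'` arises from `A` by replacing one subtree `B` of `A`
by `[B, x]`. -/
inductive IsInsertion {X : Type*} (x : X) : FreeMagma X → FreeMagma X → Prop
  | here (A) : IsInsertion x A (.mul A (.of x))
  | left {A A'} (B) : IsInsertion x A A' → IsInsertion x (.mul A B) (.mul A' B)
  | right (A) {B B'} : IsInsertion x B B' → IsInsertion x (.mul A B) (.mul A B')

theorem IsInsertion.leaves {X : Type*} {x : X} {A A' : FreeMagma X} (h : IsInsertion x A A') :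
    (leaves A').Perm (x :: leaves A) := by
  induction h with
  | here A => exact List.perm_append_singleton _ _
  | left B _ ih => exact ih.append_right _
  | right A _ ih => exact (ih.append_left _).trans List.perm_middle

theorem SwapEquiv.exists_isInsertion {X : Type*} {x : X} {A B : FreeMagma X}
    (h : SwapEquiv A B) : ∀ {A'}, IsInsertion x A A' →
      ∃ B', IsInsertion x B B' ∧ SwapEquiv A' B' := by
  induction h with
  | refl A => exact fun hA => ⟨_, hA, .refl _⟩
  | trans _ _ h₁ h₂ =>
    intro A' hA
    obtain ⟨B', hB, e₁⟩ := h₁ hA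
    obtain ⟨C', hC, e₂⟩ := h₂ hB
    exact ⟨C', hC, e₁.trans e₂⟩
  | swap A B =>
    intro A' hA
    cases hA with
    | here => exact ⟨_, .here _, (SwapEquiv.swap A B).mul (.refl _)⟩
    | left _ hA => exact ⟨_, .right _ hA, .swap _ _⟩
    | right _ hA => exact ⟨_, .left _ hA, .swap _ _⟩
  | mul e₁ e₂ h₁ h₂ =>
    intro A' hA
    cases hA with
    | here => exact ⟨_, .here _, (e₁.mul e₂).mul (.refl _)⟩
    | left _ hA =>
      obtain ⟨B', hB, e⟩ := h₁ hA
      exact ⟨_, .left _ hB, e.mul e₂⟩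
    | right _ hA =>
      obtain ⟨B', hB, e⟩ := h₂ hA
      exact ⟨_, .right _ hB, e₁.mul e⟩

/-- A letter of a bracketed word with at least two letters can be removed: its sibling takes the
place of their common bracket. -/
theorem exists_isInsertion_of_mem {X : Type*} {x : X} (T : FreeMagma X) (hx : x ∈ leaves T) :
    T = .of x ∨ ∃ A A', IsInsertion x A A' ∧ SwapEquiv T A' := by
  induction T with
  | ih1 a =>
    rw [leaves_of, List.mem_singleton] at hx
    exact Or.inl (by rw [hx])
  | ih2 S T hS hT =>
    right
    change x ∈ leaves S ++ leaves T at hx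
    change ∃ A A', IsInsertion x A A' ∧ SwapEquiv (.mul S T) A'
    rcases List.mem_append.1 hx with h | h
    · rcases hS h with rfl | ⟨A, A', hA, e⟩
      · exact ⟨_, _, .here T, .swap _ _⟩
      · exact ⟨_, _, .left T hA, e.mul (.refl _)⟩
    · rcases hT h with rfl | ⟨A, A', hA, e⟩
      · exact ⟨_, _, .here S, .refl _⟩
      · exact ⟨_, _, .right S hA, (SwapEquiv.refl _).mul e⟩

theorem SwapEquiv.leaves {X : Type*} {A B : FreeMagma X} (h : SwapEquiv A B) :
    (leaves A).Perm (leaves B) := by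
  induction h with
  | refl A => exact .refl _
  | trans _ _ h₁ h₂ => exact h₁.trans h₂
  | swap A B => exact List.perm_append_comm
  | mul _ _ h₁ h₂ => exact h₁.append h₂

/-- `Reaches l A T` says that `T` arises from `A` by inserting the letters of `l` one by one. -/
inductive Reaches {X : Type*} : List X → FreeMagma X → FreeMagma X → Prop
  | nil (A) : Reaches [] A A
  | cons {x l A A' T} : IsInsertion x A A' → Reaches l A' T → Reaches (x :: l) A T

theorem Reaches.concat {X : Type*} {x : X} {l : List X} {A T T' : FreeMagma X}
    (h : Reaches l A T) (hT : IsInsertion x T T') : Reaches (l ++ [x]) A T' := by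
  induction h with
  | nil A => exact .cons hT (.nil _)
  | cons hA _ ih => exact .cons hA (ih hT)

/-- Up to swaps, every bracketed word with distinct letters is obtained from one of its letters
by successive insertion of the others. -/
theorem exists_reaches {X : Type*} (z : X) (l : List X) (T : FreeMagma X)
    (hT : (leaves T).Perm (z :: l)) : ∃ A, Reaches l (.of z) A ∧ SwapEquiv T A := by
  induction l using List.reverseRecOn generalizing T with
  | nil =>
    rcases exists_isInsertion_of_mem T (hT.symm.subset List.mem_cons_self) with
      rfl | ⟨A, A', hA, e⟩
    · exact ⟨_, .nil _, .refl _⟩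
    · have := (e.leaves.symm.trans hT).length_eq
      rw [hA.leaves.length_eq] at this
      exact absurd (List.length_eq_zero_iff.1 (Nat.succ.inj this)) (leaves_ne_nil A)
  | append_singleton l x ih =>
    have hx : x ∈ leaves T := hT.symm.subset (by simp)
    rcases exists_isInsertion_of_mem T hx with rfl | ⟨A, A', hA, e⟩
    · have := hT.length_eq
      simp [leaves_of] at this
    · have h : (leaves A).Perm (z :: l) := by
        have h₁ := hA.leaves.symm.trans (e.leaves.symm.trans hT)
        exact (h₁.trans (List.perm_append_singleton x (z :: l))).cons_inv
      obtain ⟨B, hB, e'⟩ := ih A h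
      obtain ⟨B', hB', e''⟩ := e'.exists_isInsertion hA
      exact ⟨B', hB.concat hB', e.trans e''⟩

/-- The Boolean test whether `p` holds for all insertions of `x` into `A`. The recursors are
written out for fast evaluation in the kernel, and the continuation `p` receives its argument in
normal form. -/
def forInsertions (x : ℕ) (A : FreeMagma ℕ) : (FreeMagma ℕ → Bool) → Bool :=
  FreeMagma.rec (fun a p => p (.mul (.of a) (.of x)))
    (fun B C fB fC p => Bool.rec false
      (Bool.rec false (fC fun C' => p (.mul B C')) (fB fun B' => p (.mul B' C)))
      (p (.mul (.mul B C) (.of x)))) A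

theorem boolRec_eq_true {a b : Bool} (h : Bool.rec false b a = true) : a = true ∧ b = true := by
  cases a <;> simp_all

theorem of_forInsertions {x : ℕ} {A A' : FreeMagma ℕ} (hA : IsInsertion x A A') :
    ∀ {p : FreeMagma ℕ → Bool}, forInsertions x A p = true → p A' = true := by
  induction hA with
  | here A =>
    intro p h
    cases A with
    | of a => exact h
    | mul B C => exact (boolRec_eq_true h).1
  | left B _ ih => exact fun h => ih (boolRec_eq_true (boolRec_eq_true h).2).1
  | right A _ ih => exact fun h => ih (boolRec_eq_true (boolRec_eq_true h).2).2

/-! ### The action with leftmost letter fixed -/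

/-- The function on words which vanishes unless the word starts with `a`, and is `h` on the rest
of the word in this case. -/
def prepend {X M : Type*} [DecidableEq X] [Zero M] (a : X) (h : List X → M) (w : List X) : M :=
  List.casesOn w 0 fun b v => if b = a then h v else 0

theorem prepend_cons {X M : Type*} [DecidableEq X] [Zero M] (a : X) (h : List X → M) (b : X)
    (v : List X) : prepend a h (b :: v) = if b = a then h v else 0 := rfl

theorem act_eq_zero {X M : Type*} [AddGroup M] (T : FreeMagma X) (g : List X → M)
    (h : ∀ c ∈ leaves T, ∀ w, g (c :: w) = 0) : act T g = fun _ => 0 := by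
  induction T generalizing g with
  | ih1 a => exact funext fun w => h a (List.mem_singleton_self a) w
  | ih2 S T hS hT =>
    change act (.mul S T) g = _
    funext w
    rw [act_mul, hS g fun c hc => h c (List.mem_append_left _ hc),
      hT g fun c hc => h c (List.mem_append_right _ hc), act_zero, act_zero, sub_zero]

/-- The action of a bracketed word whose leftmost letter is left out. -/
def actTail {X M : Type*} [Sub M] (T : FreeMagma X) (g : List X → M) : List X → M :=
  FreeMagma.rec (fun _ => g) (fun _ C fB _ => act C fB) T

/-- The leftmost letter is `z`, and it does not occur elsewhere. -/
def Leads {X : Type*} (z : X) (T : FreeMagma X) : Prop :=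
  FreeMagma.rec (fun a => a = z) (fun _ C hB _ => hB ∧ z ∉ leaves C) T

theorem IsInsertion.leads {X : Type*} {x z : X} {A A' : FreeMagma X} (h : IsInsertion x A A')
    (hx : z ≠ x) (hA : Leads z A) : Leads z A' := by
  induction h with
  | here A => exact ⟨hA, by simpa [leaves_of] using hx⟩
  | left B _ ih => exact ⟨ih hA.1, hA.2⟩
  | right A h _ =>
    refine ⟨hA.1, fun hz => ?_⟩
    rcases List.mem_cons.1 (h.leaves.subset hz) with h | h
    · exact hx h
    · exact hA.2 h

theorem Reaches.leads {X : Type*} {z : X} {l : List X} {A T : FreeMagma X} (h : Reaches l A T)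
    (hl : z ∉ l) (hA : Leads z A) : Leads z T := by
  induction h with
  | nil A => exact hA
  | cons hA' _ ih =>
    rw [List.mem_cons, not_or] at hl
    exact ih hl.2 (hA'.leads hl.1 hA)

/-- If the function only sees words starting with `z`, then a bracket `[B, C]` with the only `z` in `B` acts
like the product `B C`. -/
theorem act_prepend {X M : Type*} [DecidableEq X] [AddGroup M] {z : X} {T : FreeMagma X}
    (h : Leads z T) (g : List X → M) : act T (prepend z g) = actTail T g := by
  induction T with
  | ih1 a =>
    funext w
    exact (prepend_cons z g a w).trans (if_pos h)
  | ih2 B C hB _ =>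
    have hC : act C (prepend z g) = fun _ => 0 :=
      act_eq_zero C _ fun c hc w => by
        rw [prepend_cons, if_neg]
        rintro rfl
        exact h.2 hc
    funext w
    change act (.mul B C) _ w = act C (actTail B g) w
    rw [act_mul, hC, act_zero, sub_zero, hB h.1]

/-! ### Natural number arithmetic with an offset -/

/-- The action on integer valued functions, where an integer `x` is represented by the natural
number `x + c`. -/
def offsetAct (c : ℕ) (T : FreeMagma ℕ) : (List ℕ → ℕ) → List ℕ → ℕ :=
  FreeMagma.rec (fun a f w => f (a :: w))
    (fun _ _ fB fC f w => Nat.sub (Nat.add (fC (fB f) w) c) (fB (fC f) w)) T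

/-- The counterpart of `actTail` for `offsetAct`. -/
def offsetActTail (c : ℕ) (T : FreeMagma ℕ) (g : List ℕ → ℕ) : List ℕ → ℕ :=
  FreeMagma.rec (fun _ => g) (fun _ C fB _ => offsetAct c C fB) T

/-- Each bracket at most doubles a bound `M` on the values. So subtraction of natural numbers is not
truncated if `M * 2 ^ n ≤ c` for the number `n` of letters. -/
theorem offsetAct_eq (c : ℕ) (T : FreeMagma ℕ) (M : ℕ) (f : List ℕ → ℕ) (F : List ℕ → ℤ)
    (hM : M * 2 ^ (leaves T).length ≤ c) (h : ∀ w, (f w : ℤ) = F w + c ∧ |F w| ≤ M) :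
    ∀ w, (offsetAct c T f w : ℤ) = act T F w + c ∧
      |act T F w| ≤ (M * 2 ^ ((leaves T).length - 1) : ℕ) := by
  induction T generalizing M f F with
  | ih1 a =>
    intro w
    have e : M * 2 ^ ((leaves (FreeMagma.of a)).length - 1) = M := by simp [leaves_of]
    rw [e]
    exact h (a :: w)
  | ih2 S T hS hT =>
    intro w
    change M * 2 ^ (leaves S ++ leaves T).length ≤ c at hM
    change (Nat.sub (Nat.add (offsetAct c T (offsetAct c S f) w) c)
      (offsetAct c S (offsetAct c T f) w) : ℕ) = act T (act S F) w - act S (act T F) w + (c : ℤ) ∧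
      |act T (act S F) w - act S (act T F) w| ≤
        (M * 2 ^ ((leaves S ++ leaves T).length - 1) : ℕ)
    have pS := List.length_pos_of_ne_nil (leaves_ne_nil S)
    have pT := List.length_pos_of_ne_nil (leaves_ne_nil T)
    rw [List.length_append] at hM ⊢
    generalize (leaves S).length = s at *
    generalize (leaves T).length = t at *
    obtain ⟨s, rfl⟩ : ∃ s', s = s' + 1 := ⟨s - 1, by omega⟩
    obtain ⟨t, rfl⟩ : ∃ t', t = t' + 1 := ⟨t - 1, by omega⟩
    simp only [Nat.add_sub_cancel] at hS hT
    have e : M * 2 ^ (s + 1 + (t + 1)) = 4 * (M * 2 ^ s * 2 ^ t) := by ring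
    have le : M ≤ M * 2 ^ s * 2 ^ t := by
      rw [mul_assoc]; exact Nat.le_mul_of_pos_right _ (by positivity)
    have les : M * 2 ^ s ≤ M * 2 ^ s * 2 ^ t := Nat.le_mul_of_pos_right _ (by positivity)
    have let' : M * 2 ^ t ≤ M * 2 ^ s * 2 ^ t := by
      rw [mul_right_comm]; exact Nat.le_mul_of_pos_right _ (by positivity)
    have h₁ := hS M f F (by rw [pow_succ, ← mul_assoc]; omega) h
    have h₂ := hT M f F (by rw [pow_succ, ← mul_assoc]; omega) h
    have h₃ := (hT (M * 2 ^ s) _ _ (by rw [pow_succ, ← mul_assoc]; omega) h₁) w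
    have h₄ := (hS (M * 2 ^ t) _ _
      (by rw [mul_right_comm, pow_succ, ← mul_assoc, mul_right_comm]; omega) h₂) w
    have e' : M * 2 ^ (s + 1 + (t + 1) - 1) = 2 * (M * 2 ^ s * 2 ^ t) := by
      rw [show s + 1 + (t + 1) - 1 = s + t + 1 by omega]; ring
    rw [e']
    rw [mul_right_comm] at h₄
    rw [e] at hM
    generalize M * 2 ^ s * 2 ^ t = N at *
    have := abs_le.1 h₃.2
    have := abs_le.1 h₄.2
    rw [abs_le]
    change ((offsetAct c T (offsetAct c S f) w + c - offsetAct c S (offsetAct c T f) w : ℕ) : ℤ) =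
      _ ∧ _
    omega

theorem offsetActTail_eq (c : ℕ) (T : FreeMagma ℕ) (M : ℕ) (f : List ℕ → ℕ) (F : List ℕ → ℤ)
    (hM : M * 2 ^ (leaves T).length ≤ c) (h : ∀ w, (f w : ℤ) = F w + c ∧ |F w| ≤ M) :
    ∀ w, (offsetActTail c T f w : ℤ) = actTail T F w + c ∧
      |actTail T F w| ≤ (M * 2 ^ ((leaves T).length - 1) : ℕ) := by
  induction T with
  | ih1 a =>
    have e : M * 2 ^ ((leaves (FreeMagma.of a)).length - 1) = M := by simp [leaves_of]
    rw [e]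
    exact h
  | ih2 S T hS _ =>
    intro w
    change M * 2 ^ (leaves S ++ leaves T).length ≤ c at hM
    have pS := List.length_pos_of_ne_nil (leaves_ne_nil S)
    have pT := List.length_pos_of_ne_nil (leaves_ne_nil T)
    have e : (leaves S).length + (leaves T).length - 1 =
        (leaves S).length - 1 + (leaves T).length := by omega
    change (offsetAct c T (offsetActTail c S f) w : ℤ) = act T (actTail S F) w + c ∧
      |act T (actTail S F) w| ≤ (M * 2 ^ ((leaves S ++ leaves T).length - 1) : ℕ)
    rw [List.length_append] at hM ⊢
    have h₁ := hS (le_trans (Nat.mul_le_mul_left _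
      (Nat.pow_le_pow_right two_pos (Nat.le_add_right _ _))) hM)
    have h₂ := offsetAct_eq c T _ _ _ (le_trans (by
      rw [mul_assoc, ← pow_add]
      exact Nat.mul_le_mul_left _ (Nat.pow_le_pow_right two_pos (by omega))) hM) h₁ w
    refine ⟨h₂.1, h₂.2.trans ?_⟩
    rw [mul_assoc, ← pow_add]
    exact_mod_cast Nat.mul_le_mul_left _ (Nat.pow_le_pow_right two_pos (by omega))

/-! ### Bounding a functional on all Lie monomials -/

/-- The Boolean test whether `|g(T) - c| ≤ D` for all bracketed words `T` obtained from `A` by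
insertion of the letters of `l`, where `g(T)` is computed by `offsetActTail`. -/
def boundedOn (g : List ℕ → ℕ) (c D : ℕ) (l : List ℕ) : FreeMagma ℕ → Bool :=
  List.rec (fun A => (fun x => Bool.rec false (Nat.ble x (c + D)) (Nat.ble c (x + D)))
    (offsetActTail c A g [])) (fun x _ f A => forInsertions x A f) l

theorem of_boundedOn {g : List ℕ → ℕ} {c D : ℕ} {l : List ℕ} {A T : FreeMagma ℕ}
    (hT : Reaches l A T) (h : boundedOn g c D l A = true) :
    |(offsetActTail c T g [] : ℤ) - c| ≤ D := by
  induction hT with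
  | nil A =>
    obtain ⟨h₁, h₂⟩ := boolRec_eq_true h
    have := Nat.le_of_ble_eq_true h₁
    have := Nat.le_of_ble_eq_true h₂
    rw [abs_le]
    omega
  | cons hA _ ih => exact ih (of_forInsertions hA h)

/-- The test for the three bracketed words in the first three letters suffices. -/
theorem boundedOn_pair {g : List ℕ → ℕ} {c D : ℕ} {x y z : ℕ} {l : List ℕ}
    (h₁ : boundedOn g c D l (.mul (.mul (.of z) (.of x)) (.of y)) = true)
    (h₂ : boundedOn g c D l (.mul (.mul (.of z) (.of y)) (.of x)) = true)
    (h₃ : boundedOn g c D l (.mul (.of z) (.mul (.of x) (.of y))) = true) :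
    boundedOn g c D (x :: y :: l) (.of z) = true := by
  change Bool.rec false (Bool.rec false (boundedOn g c D l (.mul (.of z) (.mul (.of x) (.of y))))
    (boundedOn g c D l (.mul (.mul (.of z) (.of y)) (.of x))))
    (boundedOn g c D l (.mul (.mul (.of z) (.of x)) (.of y))) = true
  rw [h₁, h₂, h₃]

/-- A bound for a functional on all multilinear Lie monomials. Up to sign each of them comes from
a bracketed word obtained from the letter `0` by insertion of the other letters. -/
theorem abs_act_le {k : ℕ} (g : List ℕ → ℕ) (c D M : ℕ) (hM : M * 2 ^ (k + 1) ≤ c)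
    (hg : ∀ w, |(g w : ℤ) - c| ≤ M) (h : boundedOn g c D (List.range' 1 k) (.of 0) = true)
    (T : FreeMagma (Fin (k + 1))) (hT : letters T = (Finset.univ : Finset (Fin (k + 1))).val) :
    |act T (fun w => prepend 0 (fun v => (g v : ℤ) - c) (w.map Fin.val)) []| ≤ D := by
  rw [letters_eq_univ_iff, ← leaves_map, List.range_eq_range', List.range'_succ] at hT
  obtain ⟨A, hA, e⟩ := exists_reaches 0 _ _ hT
  have hl : Leads 0 A := hA.leads (by simp) rfl
  obtain ⟨s, hs⟩ := e.act
  have h₁ := act_map Fin.val T (prepend 0 fun v => (g v : ℤ) - c) []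
  have hlen : (leaves A).length = k + 1 := by
    rw [← e.leaves.length_eq, hT.length_eq]; simp
  have h₂ := (offsetActTail_eq c A M g (fun v => (g v : ℤ) - c) (by rwa [hlen])
    (fun w => ⟨by ring, hg w⟩) []).1
  have h₃ := of_boundedOn hA h
  rw [h₂, add_sub_cancel_right] at h₃
  rw [← h₁, List.map_nil, hs, act_prepend hl]
  rcases Int.units_eq_one_or s with rfl | rfl
  · simpa using h₃
  · simpa using h₃

/-! ### Linear combinations of Lie monomials given by forests -/

/-- A list of bracketed words `A₁, …, Aₘ` in the letters `1, 2, …`, standing for the Lie monomial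
`[…[[0, A₁], A₂], …, Aₘ]`, together with the coefficient `pos - neg`. -/
structure WeightedForest where
  /-- The bracketed words `A₁, …, Aₘ`. -/
  forest : List (FreeMagma ℕ)
  /-- The positive part of the coefficient. -/
  pos : ℕ
  /-- The negative part of the coefficient. -/
  neg : ℕ

/-- The action of the product `A₁ ⋯ Aₘ`. -/
def actForest : List (FreeMagma ℕ) → (List ℕ → ℤ) → List ℕ → ℤ
  | [], g => g
  | A :: F, g => actForest F (act A g)

/-- The value on a linear combination of the functional which sends the Lie monomial
`[…[[0, A₁], A₂], …, Aₘ]` to the value of `g` on the product `A₁ ⋯ Aₘ`. -/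
def weightedSum (ts : List WeightedForest) (g : List ℕ → ℤ) : ℤ :=
  (ts.map fun t => ((t.pos : ℤ) - t.neg) * actForest t.forest g []).sum

theorem act_sub (T : FreeMagma ℕ) (f g : List ℕ → ℤ) (w : List ℕ) :
    act T (fun v => f v - g v) w = act T f w - act T g w := by
  induction T generalizing f g w with
  | ih1 a => rfl
  | ih2 S T hS hT =>
    change act (.mul S T) _ w = act (.mul S T) f w - act (.mul S T) g w
    rw [act_mul, act_mul, act_mul, show act S (fun v => f v - g v) = _ from funext (hS f g),
      show act T (fun v => f v - g v) = _ from funext (hT f g), hT, hS]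
    ring

theorem actForest_sub (F : List (FreeMagma ℕ)) (f g : List ℕ → ℤ) (w : List ℕ) :
    actForest F (fun v => f v - g v) w = actForest F f w - actForest F g w := by
  induction F generalizing f g with
  | nil => rfl
  | cons A F ih =>
    rw [actForest, actForest, actForest, ← ih]
    congr 1
    exact funext (act_sub A f g)

theorem actForest_zero (F : List (FreeMagma ℕ)) (w : List ℕ) :
    actForest F (fun _ => 0) w = 0 := by
  simpa using actForest_sub F (fun _ => 0) (fun _ => 0) w

theorem actForest_mul_cons (B C : FreeMagma ℕ) (F : List (FreeMagma ℕ)) (g : List ℕ → ℤ)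
    (w : List ℕ) : actForest (.mul B C :: F) g w =
      actForest (B :: C :: F) g w - actForest (C :: B :: F) g w := by
  simp only [actForest]
  rw [← actForest_sub]
  rfl

/-- Expands a product `A F` with coefficient `p - n` according to the first letter, and puts the
remainders of the terms starting with `a` in front of `ts`. -/
def stripTree (a : ℕ) (A : FreeMagma ℕ) :
    List (FreeMagma ℕ) → ℕ → ℕ → List WeightedForest → List WeightedForest :=
  FreeMagma.rec (fun b F p n ts => Bool.rec ts (⟨F, p, n⟩ :: ts) (Nat.beq a b))
    (fun B C fB fC F p n ts => fB (C :: F) p n (fC (B :: F) n p ts)) A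

/-- The terms starting with `a` in a linear combination of products, with the letter `a` removed,
in front of `us`. -/
def strip (a : ℕ) (ts us : List WeightedForest) : List WeightedForest :=
  List.rec us (fun t _ ih => WeightedForest.rec (fun F p n =>
    List.rec ih (fun A F _ => stripTree a A F p n ih) F) t) ts

theorem weightedSum_cons (F : List (FreeMagma ℕ)) (p n : ℕ) (ts : List WeightedForest)
    (g : List ℕ → ℤ) : weightedSum (⟨F, p, n⟩ :: ts) g =
      (p - n) * actForest F g [] + weightedSum ts g := by
  simp [weightedSum]

theorem weightedSum_append (ts us : List WeightedForest) (g : List ℕ → ℤ) :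
    weightedSum (ts ++ us) g = weightedSum ts g + weightedSum us g := by
  simp [weightedSum]

theorem weightedSum_stripTree (a : ℕ) (A : FreeMagma ℕ) (F : List (FreeMagma ℕ)) (p n : ℕ)
    (ts : List WeightedForest) (g : List ℕ → ℤ) :
    weightedSum (stripTree a A F p n ts) g =
      (p - n) * actForest (A :: F) (prepend a g) [] + weightedSum ts g := by
  induction A generalizing F p n ts with
  | ih1 b =>
    change weightedSum (Bool.rec ts (⟨F, p, n⟩ :: ts) (Nat.beq a b)) g =
      (p - n) * actForest F (fun w => prepend a g (b :: w)) [] + _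
    simp only [prepend_cons]
    cases h : Nat.beq a b with
    | false =>
      have : b ≠ a := Ne.symm (Nat.ne_of_beq_eq_false h)
      simp [this, actForest_zero]
    | true =>
      have : b = a := (Nat.eq_of_beq_eq_true h).symm
      simp [this, weightedSum_cons]
  | ih2 B C hB hC =>
    change weightedSum (stripTree a B (C :: F) p n (stripTree a C (B :: F) n p ts)) g =
      (p - n) * actForest (.mul B C :: F) (prepend a g) [] + _
    rw [hB, hC, actForest_mul_cons]
    ring

theorem weightedSum_strip (a : ℕ) (ts us : List WeightedForest) (g : List ℕ → ℤ) :
    weightedSum (strip a ts us) g = weightedSum ts (prepend a g) + weightedSum us g := by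
  induction ts with
  | nil => simp [strip, weightedSum]
  | cons t ts ih =>
    obtain ⟨F, p, n⟩ := t
    rw [weightedSum_cons, add_assoc, ← ih]
    cases F with
    | nil =>
      change weightedSum (strip a ts us) g = (p - n) * 0 + _
      rw [mul_zero, zero_add]
    | cons A F => exact weightedSum_stripTree a A F p n _ g

/-- The indicator function of a word. -/
def delta (w : List ℕ) : List ℕ → ℤ :=
  w.foldr prepend fun v => if v = [] then 1 else 0

theorem delta_apply (w v : List ℕ) : delta w v = if v = w then 1 else 0 := by
  induction w generalizing v with
  | nil => rfl
  | cons a w ih =>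
    change prepend a (delta w) v = _
    cases v with
    | nil => rfl
    | cons b v =>
      rw [prepend_cons, ih]
      by_cases h : b = a <;> simp [h]

theorem actForest_delta_nil (A : FreeMagma ℕ) (F : List (FreeMagma ℕ)) :
    actForest (A :: F) (delta []) [] = 0 := by
  rw [actForest, act_eq_zero A (delta []) fun c _ w => rfl, actForest_zero]

/-- The sum of the positive parts of the coefficients of the empty product. -/
def sumPos (ts : List WeightedForest) : ℕ :=
  List.rec 0 (fun t _ ih => WeightedForest.rec (fun F p _ =>
    List.rec (Nat.add p ih) (fun _ _ _ => ih) F) t) ts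

/-- The sum of the negative parts of the coefficients of the empty product. -/
def sumNeg (ts : List WeightedForest) : ℕ :=
  List.rec 0 (fun t _ ih => WeightedForest.rec (fun F _ n =>
    List.rec (Nat.add n ih) (fun _ _ _ => ih) F) t) ts

theorem weightedSum_delta_nil (ts : List WeightedForest) :
    weightedSum ts (delta []) = sumPos ts - sumNeg ts := by
  induction ts with
  | nil => rfl
  | cons t ts ih =>
    obtain ⟨F, p, n⟩ := t
    rw [weightedSum_cons, ih]
    cases F with
    | nil =>
      change (p - n) * (1 : ℤ) + _ = ((p + sumPos ts : ℕ) : ℤ) - ((n + sumNeg ts : ℕ) : ℤ)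
      push_cast
      ring
    | cons A F =>
      rw [actForest_delta_nil, mul_zero, zero_add]
      rfl

/-! ### Running over all permutations -/

/-- The Boolean test whether `p a S'` holds whenever `a` is an entry of `S` and `S'` consists of the
other entries of `S` and of `pre`. -/
def forPicks (p : ℕ → List ℕ → Bool) (S : List ℕ) : List ℕ → Bool :=
  List.rec (fun _ => true) (fun a S ih pre => Bool.rec false (ih (a :: pre))
    (p a (List.rec S (fun b _ r => b :: r) pre))) S

/-- The sum of `f a S'` where `a` runs over `S` and `S'` consists of the other entries of `S` and
of `pre`. -/
def sumPicks (f : ℕ → List ℕ → ℕ) (S : List ℕ) : List ℕ → ℕ :=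
  List.rec (fun _ => 0) (fun a S ih pre => Nat.add (f a (List.rec S (fun b _ r => b :: r) pre))
    (ih (a :: pre))) S

theorem listRec_eq_append (S pre : List ℕ) :
    List.rec (motive := fun _ => List ℕ) S (fun b _ r => b :: r) pre = pre ++ S := by
  induction pre with
  | nil => rfl
  | cons b pre ih => exact congrArg (b :: ·) ih

theorem of_forPicks {p : ℕ → List ℕ → Bool} {a : ℕ} {S : List ℕ} (ha : a ∈ S) :
    ∀ {pre}, forPicks p S pre = true →
      ∃ S', (a :: S').Perm (pre ++ S) ∧ p a S' = true := by
  induction S with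
  | nil => exact absurd ha List.not_mem_nil
  | cons b S ih =>
    intro pre h
    obtain ⟨h₁, h₂⟩ := boolRec_eq_true h
    rw [listRec_eq_append] at h₁
    rcases List.mem_cons.1 ha with rfl | ha
    · exact ⟨_, List.perm_middle.symm, h₁⟩
    · obtain ⟨S', hS, h⟩ := ih ha h₂
      exact ⟨S', hS.trans List.perm_middle.symm, h⟩

theorem sumPicks_eq {f : ℕ → List ℕ → ℕ} {S₀ : List ℕ} {K : ℕ → ℤ}
    (hf : ∀ a S', (a :: S').Perm S₀ → (f a S' : ℤ) = K a) (S pre : List ℕ)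
    (h : (pre ++ S).Perm S₀) : (sumPicks f S pre : ℤ) = (S.map K).sum := by
  induction S generalizing pre with
  | nil => rfl
  | cons a S ih =>
    change ((f a (List.rec S (fun b _ r => b :: r) pre) + sumPicks f S (a :: pre) : ℕ) : ℤ) = _
    rw [listRec_eq_append, Nat.cast_add, hf a _ (List.perm_middle.symm.trans h),
      ih (a :: pre) (List.perm_middle.symm.trans h), List.map_cons, List.sum_cons]

/-- Factorials, by kernel friendly recursion. -/
def fact (n : ℕ) : ℕ := Nat.rec 1 (fun n ih => Nat.mul (Nat.succ n) ih) n

theorem fact_eq (n : ℕ) : fact n = n ! := by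
  induction n with
  | zero => rfl
  | succ n ih =>
    rw [Nat.factorial_succ, ← ih]
    rfl

/-- Parity, by kernel friendly recursion. -/
def isEven (n : ℕ) : Bool := Nat.rec true (fun _ b => Bool.rec true false b) n

theorem neg_one_pow_eq (n : ℕ) : (-1 : ℤ) ^ n = if isEven n = true then 1 else -1 := by
  induction n with
  | zero => rfl
  | succ n ih =>
    have e : isEven (n + 1) = Bool.rec true false (isEven n) := rfl
    rw [pow_succ, ih, e]
    cases isEven n <;> simp

/-- The Boolean test whether a linear combination of products has the coefficient
`E (-1) ^ d a! d!` at each word `w` in the letters `S`, where `a` and `d` are the numbers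
of ascents and descents of `b :: w`, enlarged by `asc` and `des`. The number `n` is the length
of `S`. -/
def hasMagnusCoeffs (E n : ℕ) :
    List ℕ → ℕ → ℕ → ℕ → List WeightedForest → Bool :=
  Nat.rec
    (fun _ _ asc des ts => Bool.rec
      (Nat.beq (sumNeg ts) (Nat.add (sumPos ts) (Nat.mul E (Nat.mul (fact asc) (fact des)))))
      (Nat.beq (sumPos ts) (Nat.add (sumNeg ts) (Nat.mul E (Nat.mul (fact asc) (fact des)))))
      (isEven des))
    (fun _ ih S b asc des ts => forPicks (fun a S' => Bool.rec
      (ih S' a asc (Nat.succ des) (strip a ts [])) (ih S' a (Nat.succ asc) des (strip a ts []))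
      (Nat.ble (Nat.succ b) a)) S []) n

theorem hasMagnusCoeffs_succ (E n : ℕ) (S : List ℕ) (b asc des : ℕ) (ts : List WeightedForest) :
    hasMagnusCoeffs E (n + 1) S b asc des ts = forPicks (fun a S' => Bool.rec
      (hasMagnusCoeffs E n S' a asc (Nat.succ des) (strip a ts []))
      (hasMagnusCoeffs E n S' a (Nat.succ asc) des (strip a ts []))
      (Nat.ble (Nat.succ b) a)) S [] := rfl

theorem weightedSum_delta_of_hasMagnusCoeffs {E n : ℕ} {S : List ℕ} {b asc des : ℕ}
    {ts : List WeightedForest} (h : hasMagnusCoeffs E n S b asc des ts = true)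
    (hn : S.length = n) {w : List ℕ} (hw : w.Perm S) :
    weightedSum ts (delta w) = (-1) ^ (descents (b :: w) + des) *
      (E * ((ascents (b :: w) + asc)! * (descents (b :: w) + des)!) : ℕ) := by
  induction n generalizing S b asc des ts w with
  | zero =>
    rw [List.length_eq_zero_iff] at hn
    subst hn
    rw [List.perm_nil] at hw
    subst hw
    have e : descents [b] = 0 := rfl
    have e' : ascents [b] = 0 := rfl
    rw [weightedSum_delta_nil, neg_one_pow_eq, e, e', zero_add, zero_add, ← fact_eq, ← fact_eq]
    change Bool.rec
      (Nat.beq (sumNeg ts) (Nat.add (sumPos ts) (Nat.mul E (Nat.mul (fact asc) (fact des)))))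
      (Nat.beq (sumPos ts) (Nat.add (sumNeg ts) (Nat.mul E (Nat.mul (fact asc) (fact des)))))
      (isEven des) = true at h
    cases he : isEven des with
    | false =>
      rw [he] at h
      have : sumNeg ts = sumPos ts + E * (fact asc * fact des) := Nat.eq_of_beq_eq_true h
      rw [this, if_neg Bool.false_ne_true]
      push_cast
      ring
    | true =>
      rw [he] at h
      have : sumPos ts = sumNeg ts + E * (fact asc * fact des) := Nat.eq_of_beq_eq_true h
      rw [this, if_pos rfl]
      push_cast
      ring
  | succ n ih =>
    cases w with
    | nil =>
      rw [List.nil_perm] at hw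
      subst hw
      simp at hn
    | cons a w =>
      rw [hasMagnusCoeffs_succ] at h
      obtain ⟨S', hS, h'⟩ := of_forPicks (hw.subset List.mem_cons_self) h
      have hw' : w.Perm S' := (hw.trans hS.symm).cons_inv
      have hn' : S'.length = n := by
        have := hS.length_eq
        rw [List.nil_append, hn, List.length_cons] at this
        omega
      have e : weightedSum ts (delta (a :: w)) = weightedSum (strip a ts []) (delta w) := by
        rw [weightedSum_strip]
        exact (add_zero _).symm
      rw [e, ascents, descents]
      change Bool.rec (hasMagnusCoeffs E n S' a asc (Nat.succ des) (strip a ts []))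
        (hasMagnusCoeffs E n S' a (Nat.succ asc) des (strip a ts []))
        (Nat.ble (Nat.succ b) a) = true at h'
      cases hb : Nat.ble (Nat.succ b) a with
      | false =>
        have : ¬ b < a := fun h => by simp [Nat.ble_eq_true_of_le h] at hb
        rw [hb] at h'
        rw [ih h' hn' hw', if_neg this, if_neg this]
        simp only [add_zero, Nat.succ_eq_add_one, add_comm, add_left_comm]
      | true =>
        have : b < a := Nat.le_of_ble_eq_true hb
        rw [hb] at h'
        rw [ih h' hn' hw', if_pos this, if_pos this]
        simp only [add_zero, Nat.succ_eq_add_one, add_comm, add_left_comm]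

/-- The sum of `a! d! g(w)` for even `d` and `a! d! (2 c - g(w))` for odd `d`, where `g ≤ 2 c`, over
all words `w` in the letters `S`, where `a` and `d` are the numbers of ascents and descents of `b :: w`,
enlarged by `asc` and `des`. The number `n` is the length of `S`. -/
def signedSum (c n : ℕ) : List ℕ → ℕ → ℕ → ℕ → (List ℕ → ℕ) → ℕ :=
  Nat.rec
    (fun _ _ asc des g => Nat.mul (Nat.mul (fact asc) (fact des))
      (Bool.rec (Nat.sub (Nat.add c c) (g [])) (g []) (isEven des)))
    (fun _ ih S b asc des g => sumPicks (fun a S' => Bool.rec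
      (ih S' a asc (Nat.succ des) fun w => g (a :: w))
      (ih S' a (Nat.succ asc) des fun w => g (a :: w)) (Nat.ble (Nat.succ b) a)) S []) n

/-- The finite set of all rearrangements of a list. -/
def rearrangements {X : Type*} [DecidableEq X] (S : List X) : Finset (List X) :=
  S.permutations.toFinset

theorem mem_rearrangements {X : Type*} [DecidableEq X] {S w : List X} :
    w ∈ rearrangements S ↔ w.Perm S := by
  rw [rearrangements, List.mem_toFinset, List.mem_permutations]

theorem sum_rearrangements {M : Type*} [AddCommMonoid M] {S : List ℕ} (hS : S.Nodup)
    (h0 : S ≠ []) (f : List ℕ → M) : ∑ w ∈ rearrangements S, f w =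
      (S.map fun a => ∑ w ∈ rearrangements (S.erase a), f (a :: w)).sum := by
  rw [← List.sum_toFinset _ hS, Finset.sum_sigma']
  refine (Finset.sum_bij' (fun x _ => x.1 :: x.2) (fun w _ => ⟨w.headD 0, w.tail⟩)
    ?_ ?_ ?_ ?_ ?_).symm
  · rintro ⟨a, w⟩ h
    rw [Finset.mem_sigma, List.mem_toFinset, mem_rearrangements] at h
    exact mem_rearrangements.2 ((h.2.cons a).trans (List.perm_cons_erase h.1).symm)
  · intro w h
    rw [mem_rearrangements] at h
    cases w with
    | nil => exact absurd (List.nil_perm.1 h) h0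
    | cons a w =>
      have ha : a ∈ S := h.subset List.mem_cons_self
      rw [Finset.mem_sigma, List.mem_toFinset, mem_rearrangements]
      exact ⟨ha, (h.trans (List.perm_cons_erase ha)).cons_inv⟩
  · rintro ⟨a, w⟩ _
    rfl
  · intro w h
    rw [mem_rearrangements] at h
    cases w with
    | nil => exact absurd (List.nil_perm.1 h) h0
    | cons a w => rfl
  · rintro ⟨a, w⟩ _
    rfl

theorem signedSum_eq {c n : ℕ} {S : List ℕ} (hS : S.Nodup) (hn : S.length = n) (b asc des : ℕ)
    (g : List ℕ → ℕ) (hg : ∀ w, g w ≤ 2 * c) :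
    (signedSum c n S b asc des g : ℤ) = ∑ w ∈ rearrangements S,
      ((ascents (b :: w) + asc)! * (descents (b :: w) + des)! *
        ((-1) ^ (descents (b :: w) + des) * (g w - c) + c) : ℤ) := by
  induction n generalizing S b asc des g with
  | zero =>
    rw [List.length_eq_zero_iff] at hn
    subst hn
    have e : rearrangements ([] : List ℕ) = {[]} := by
      ext w
      rw [mem_rearrangements, List.perm_nil, Finset.mem_singleton]
    have e₁ : descents [b] = 0 := rfl
    have e₂ : ascents [b] = 0 := rfl
    rw [e, Finset.sum_singleton, e₁, e₂, zero_add, zero_add, neg_one_pow_eq, ← fact_eq, ← fact_eq]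
    change ((fact asc * fact des *
      (Bool.rec (c + c - g []) (g []) (isEven des) : ℕ) : ℕ) : ℤ) = _
    have := hg []
    cases isEven des with
    | false =>
      change ((fact asc * fact des * (c + c - g []) : ℕ) : ℤ) = _
      rw [Nat.cast_mul, Nat.cast_sub (by omega), if_neg Bool.false_ne_true]
      push_cast
      ring
    | true =>
      rw [if_pos rfl]
      push_cast
      ring
  | succ n ih =>
    have h0 : S ≠ [] := by
      rintro rfl
      simp at hn
    rw [sum_rearrangements hS h0]
    change (sumPicks (fun a S' => Bool.rec
      (signedSum c n S' a asc (Nat.succ des) fun w => g (a :: w))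
      (signedSum c n S' a (Nat.succ asc) des fun w => g (a :: w)) (Nat.ble (Nat.succ b) a)) S []
      : ℤ) = _
    refine sumPicks_eq (S₀ := S) ?_ S [] (.refl _)
    intro a S' h
    have hS' : S'.Nodup := (h.nodup_iff.2 hS).of_cons
    have hn' : S'.length = n := by
      have := h.length_eq
      rw [hn, List.length_cons] at this
      omega
    have e : rearrangements (S.erase a) = rearrangements S' := by
      ext w
      rw [mem_rearrangements, mem_rearrangements]
      have : (S.erase a).Perm S' := by
        simpa using (h.erase a).symm
      exact ⟨fun h => h.trans this, fun h => h.trans this.symm⟩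
    rw [e]
    simp only [ascents, descents]
    cases hb : Nat.ble (Nat.succ b) a with
    | false =>
      have : ¬ b < a := fun h => by simp [Nat.ble_eq_true_of_le h] at hb
      change (signedSum c n S' a asc (Nat.succ des) fun w => g (a :: w) : ℤ) = _
      rw [ih hS' hn' _ _ _ _ fun w => hg _]
      simp only [if_neg this, add_zero, Nat.succ_eq_add_one, add_comm, add_left_comm]
    | true =>
      have : b < a := Nat.le_of_ble_eq_true hb
      change (signedSum c n S' a (Nat.succ asc) des fun w => g (a :: w) : ℤ) = _
      rw [ih hS' hn' _ _ _ _ fun w => hg _]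
      simp only [if_pos this, add_zero, Nat.succ_eq_add_one, add_comm, add_left_comm]

/-! ### Validity and cost of presentations -/

/-- The Boolean test whether `p` holds for what is left of `S` after removal of `a`, and `false` if
`a` does not occur in `S`. -/
def removing (a : ℕ) (S : List ℕ) : (List ℕ → Bool) → Bool :=
  List.rec (fun _ => false) (fun b S ih p =>
    Bool.rec (ih fun S' => p (b :: S')) (p S) (Nat.beq a b)) S

/-- The version of `removing` which removes the letters of a bracketed word. -/
def removingLeaves (A : FreeMagma ℕ) : List ℕ → (List ℕ → Bool) → Bool :=
  FreeMagma.rec (fun a S p => removing a S p) (fun _ _ fB fC S p => fB S fun S' => fC S' p) A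

/-- The Boolean test whether the letters of a forest are those of `S`. -/
def hasLeaves (F : List (FreeMagma ℕ)) : List ℕ → Bool :=
  List.rec (fun S => List.rec true (fun _ _ _ => false) S)
    (fun A _ ih S => removingLeaves A S ih) F

/-- The Boolean test whether the letters of all forests in `bs` are those of `S`. -/
def allHaveLeaves (S : List ℕ) (bs : List (List WeightedForest)) : Bool :=
  List.rec true (fun ts _ ih => Bool.rec false ih (List.rec true (fun t _ ih' =>
    Bool.rec false ih' (WeightedForest.rec (fun F _ _ => hasLeaves F S) t)) ts)) bs

theorem of_removing {a : ℕ} {S : List ℕ} {p : List ℕ → Bool} (h : removing a S p = true) :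
    ∃ S', S.Perm (a :: S') ∧ p S' = true := by
  induction S generalizing p with
  | nil => exact absurd h Bool.false_ne_true
  | cons b S ih =>
    change Bool.rec (removing a S fun S' => p (b :: S')) (p S) (Nat.beq a b) = true at h
    cases hab : Nat.beq a b with
    | false =>
      rw [hab] at h
      obtain ⟨S', hS, h⟩ := ih h
      exact ⟨_, (hS.cons b).trans (.swap a b S'), h⟩
    | true =>
      rw [hab] at h
      rw [Nat.eq_of_beq_eq_true hab]
      exact ⟨S, .refl _, h⟩

theorem of_removingLeaves {A : FreeMagma ℕ} {S : List ℕ} {p : List ℕ → Bool}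
    (h : removingLeaves A S p = true) : ∃ S', S.Perm (leaves A ++ S') ∧ p S' = true := by
  induction A generalizing S p with
  | ih1 a => exact of_removing h
  | ih2 B C hB hC =>
    obtain ⟨S', hS, h⟩ := hB (S := S) (p := fun S' => removingLeaves C S' p) h
    obtain ⟨S'', hS', h⟩ := hC h
    refine ⟨S'', hS.trans ((hS'.append_left _).trans ?_), h⟩
    rw [← List.append_assoc]
    exact .refl _

theorem of_hasLeaves {F : List (FreeMagma ℕ)} {S : List ℕ} (h : hasLeaves F S = true) :
    (F.flatMap leaves).Perm S := by
  induction F generalizing S with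
  | nil =>
    cases S with
    | nil => exact .refl _
    | cons a S => exact absurd h Bool.false_ne_true
  | cons A F ih =>
    obtain ⟨S', hS, h⟩ := of_removingLeaves (A := A) (S := S) (p := hasLeaves F) h
    exact ((ih h).append_left _).trans hS.symm

theorem of_allHaveLeaves {S : List ℕ} {bs : List (List WeightedForest)}
    (h : allHaveLeaves S bs = true) : ∀ t ∈ bs.flatten, (t.forest.flatMap leaves).Perm S := by
  induction bs with
  | nil => simp
  | cons ts bs ih =>
    obtain ⟨h₁, h₂⟩ := boolRec_eq_true h
    intro t ht
    rw [List.flatten_cons, List.mem_append] at ht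
    obtain ht | ht := ht
    · replace h₁ : ∀ t ∈ ts, (t.forest.flatMap leaves).Perm S := by
        clear ht ih h h₂
        induction ts with
        | nil => simp
        | cons u ts ih' =>
          obtain ⟨h₂, h₃⟩ := boolRec_eq_true h₁
          exact List.forall_mem_cons.2 ⟨of_hasLeaves h₂, ih' h₃⟩
      exact h₁ t ht
    · exact ih h₂ t ht

/-- The sum of the absolute values of the coefficients. -/
def totalCost (bs : List (List WeightedForest)) : ℕ :=
  List.rec 0 (fun ts _ ih => Nat.add (List.rec 0 (fun t _ ih' =>
    WeightedForest.rec (fun _ p n => Nat.add (Nat.add p n) ih') t) ts) ih) bs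

theorem totalCost_eq (bs : List (List WeightedForest)) :
    totalCost bs = (bs.flatten.map fun t => t.pos + t.neg).sum := by
  induction bs with
  | nil => rfl
  | cons ts bs ih =>
    rw [List.flatten_cons, List.map_append, List.sum_append, ← ih]
    refine congrArg (· + totalCost bs) ?_
    induction ts with
    | nil => rfl
    | cons t ts ih' => exact congrArg (t.pos + t.neg + ·) ih'

/-- The version of `strip` for a list of lists. -/
def stripBlocks (a : ℕ) (bs : List (List WeightedForest)) : List WeightedForest :=
  List.rec [] (fun ts _ ih => strip a ts ih) bs

theorem weightedSum_stripBlocks (a : ℕ) (bs : List (List WeightedForest)) (g : List ℕ → ℤ) :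
    weightedSum (stripBlocks a bs) g = weightedSum bs.flatten (prepend a g) := by
  induction bs with
  | nil => rfl
  | cons ts bs ih =>
    rw [List.flatten_cons, weightedSum_append, ← ih]
    exact weightedSum_strip a ts _ g

/-- The Boolean test whether the coefficients at all permutations of `1, …, k` starting with one of
the letters in `l` are `E` times `k + 1` factorial times those of the Magnus commutator. -/
def hasMagnusCoeffsFrom (E k : ℕ) (bs : List (List WeightedForest)) (l : List ℕ) : Bool :=
  List.rec true (fun a _ ih => Bool.rec false ih (hasMagnusCoeffs E (Nat.pred k)
    ((List.range' 1 k).erase a) a 1 0 (stripBlocks a bs))) l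

theorem weightedSum_delta_of_hasMagnusCoeffsFrom {E k : ℕ} {bs : List (List WeightedForest)}
    {l : List ℕ} (h : hasMagnusCoeffsFrom E k bs l = true) {a : ℕ} (ha : a ∈ l) {w : List ℕ}
    (hw : (a :: w).Perm (List.range' 1 k)) :
    weightedSum bs.flatten (delta (a :: w)) = (-1) ^ descents (0 :: a :: w) *
      (E * ((ascents (0 :: a :: w))! * (descents (0 :: a :: w))!) : ℕ) := by
  induction l with
  | nil => simp at ha
  | cons b l ih =>
    obtain ⟨h₁, h₂⟩ := boolRec_eq_true h
    rcases List.mem_cons.1 ha with rfl | ha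
    · have hak : a ∈ List.range' 1 k := hw.subset List.mem_cons_self
      have ha0 : 0 < a := by
        rw [List.mem_range'_1] at hak
        omega
      have hw' : w.Perm ((List.range' 1 k).erase a) :=
        (hw.trans (List.perm_cons_erase hak)).cons_inv
      have h := weightedSum_delta_of_hasMagnusCoeffs h₁
        (by rw [List.length_erase_of_mem hak, List.length_range', Nat.pred_eq_sub_one]) hw'
      rw [weightedSum_stripBlocks] at h
      rw [ascents, descents, if_pos ha0, if_pos ha0, zero_add, add_comm 1]
      exact h
    · exact ih h₂ ha

/-! ### Presentations from forests -/

/-- The bracketed word `[…[[0, A₁], A₂], …, Aₘ]`. -/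
def treeOfForest (F : List (FreeMagma ℕ)) : FreeMagma ℕ := F.foldl FreeMagma.mul (.of 0)

theorem leaves_foldl_mul (F : List (FreeMagma ℕ)) (A : FreeMagma ℕ) :
    leaves (F.foldl FreeMagma.mul A) = leaves A ++ F.flatMap leaves := by
  induction F generalizing A with
  | nil => exact (List.append_nil _).symm
  | cons B F ih =>
    rw [List.foldl_cons, ih, leaves_mul, List.flatMap_cons, List.append_assoc]

theorem actTail_foldl_mul (F : List (FreeMagma ℕ)) (A : FreeMagma ℕ) (g : List ℕ → ℤ) :
    actTail (F.foldl FreeMagma.mul A) g = actForest F (actTail A g) := by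
  induction F generalizing A with
  | nil => rfl
  | cons B F ih =>
    rw [List.foldl_cons, ih]
    rfl

theorem leads_foldl_mul {z : ℕ} (F : List (FreeMagma ℕ)) (A : FreeMagma ℕ) (hA : Leads z A)
    (hF : z ∉ F.flatMap leaves) : Leads z (F.foldl FreeMagma.mul A) := by
  induction F generalizing A with
  | nil => exact hA
  | cons B F ih =>
    rw [List.flatMap_cons, List.mem_append, not_or] at hF
    exact ih _ ⟨hA, hF.1⟩ hF.2

theorem map_val_map_ofNat {k : ℕ} (T : FreeMagma ℕ) (hT : ∀ a ∈ leaves T, a < k + 1) :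
    FreeMagma.map Fin.val (FreeMagma.map (Fin.ofNat (k + 1)) T) = T := by
  induction T with
  | ih1 a =>
    exact congrArg FreeMagma.of (Nat.mod_eq_of_lt (hT a (List.mem_singleton_self a)))
  | ih2 S T hS hT' =>
    exact congrArg₂ FreeMagma.mul (hS fun a ha => hT a (List.mem_append_left _ ha))
      (hT' fun a ha => hT a (List.mem_append_right _ ha))

/-- The bracketed word `[…[[0, A₁], A₂], …, Aₘ]` in the variables indexed by `Fin (k + 1)`. -/
def forestWord (k : ℕ) (F : List (FreeMagma ℕ)) : FreeMagma (Fin (k + 1)) :=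
  FreeMagma.map (Fin.ofNat (k + 1)) (treeOfForest F)

section forestWord

variable {k : ℕ} {F : List (FreeMagma ℕ)}

theorem map_val_forestWord (hF : (F.flatMap leaves).Perm (List.range' 1 k)) :
    FreeMagma.map Fin.val (forestWord k F) = treeOfForest F := by
  refine map_val_map_ofNat _ fun a ha => ?_
  rw [treeOfForest, leaves_foldl_mul, List.mem_append] at ha
  rcases ha with ha | ha
  · rw [leaves_of, List.mem_singleton] at ha
    omega
  · have := hF.subset ha
    rw [List.mem_range'_1] at this
    omega

theorem letters_forestWord (hF : (F.flatMap leaves).Perm (List.range' 1 k)) :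
    letters (forestWord k F) = (Finset.univ : Finset (Fin (k + 1))).val := by
  rw [letters_eq_univ_iff, ← leaves_map, map_val_forestWord hF, treeOfForest, leaves_foldl_mul,
    List.range_eq_range', List.range'_succ]
  exact hF.cons 0

theorem act_forestWord (hF : (F.flatMap leaves).Perm (List.range' 1 k)) (g : List ℕ → ℤ) :
    act (forestWord k F) (fun w => prepend 0 g (w.map Fin.val)) [] = actForest F g [] := by
  have h := act_map Fin.val (forestWord k F) (prepend 0 g) []
  have hl : Leads 0 (treeOfForest F) := by
    refine leads_foldl_mul F _ rfl fun h => ?_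
    have := hF.subset h
    rw [List.mem_range'_1] at this
    omega
  rw [← h, map_val_forestWord hF, act_prepend hl, treeOfForest, actTail_foldl_mul]
  rfl

theorem coefW_forestWord (hF : (F.flatMap leaves).Perm (List.range' 1 k))
    (w : List (Fin (k + 1))) :
    coefW (0 :: w) (toAssoc (k + 1) (bracket (forestWord k F))) =
      (actForest F (delta (w.map Fin.val)) [] : ℝ) := by
  have h := act_comp_hom (Int.castAddHom ℝ) (forestWord k F)
    (fun v => prepend 0 (delta (w.map Fin.val)) (v.map Fin.val)) []
  simp only [Int.coe_castAddHom] at h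
  rw [← act_forestWord hF, coefW, wordEval_toAssoc, ← h]
  congr 1
  funext v
  have : prepend 0 (delta (w.map Fin.val)) (v.map Fin.val) =
      delta ((0 :: w).map Fin.val) (v.map Fin.val) := rfl
  rw [this, delta_apply]
  simp only [(List.map_injective_iff.2 Fin.val_injective).eq_iff]
  split_ifs <;> simp

end forestWord

/-- The Lie polynomial with coefficients `(pos - neg) / N`. -/
def lieSum (k N : ℕ) (ts : List WeightedForest) : FreeLieAlgebra ℝ (Fin (k + 1)) :=
  (ts.map fun t => (((t.pos : ℝ) - t.neg) / N) • bracket (forestWord k t.forest)).sum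

theorem coefW_lieSum {k N : ℕ} {ts : List WeightedForest}
    (h : ∀ t ∈ ts, (t.forest.flatMap leaves).Perm (List.range' 1 k)) (w : List (Fin (k + 1))) :
    coefW (0 :: w) (toAssoc (k + 1) (lieSum k N ts)) =
      (weightedSum ts (delta (w.map Fin.val)) : ℝ) / N := by
  induction ts with
  | nil => simp [lieSum, weightedSum]
  | cons t ts ih =>
    have e : lieSum k N (t :: ts) =
        (((t.pos : ℝ) - t.neg) / N) • bracket (forestWord k t.forest) + lieSum k N ts := rfl
    obtain ⟨F, p, n⟩ := t
    rw [e, map_add, map_add, ih fun u hu => h u (List.mem_cons_of_mem _ hu), map_smul, map_smul,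
      coefW_forestWord (h _ List.mem_cons_self), weightedSum_cons]
    push_cast
    rw [smul_eq_mul]
    ring

theorem lieSum_mem_multilinear {k N : ℕ} {ts : List WeightedForest}
    (h : ∀ t ∈ ts, (t.forest.flatMap leaves).Perm (List.range' 1 k)) :
    lieSum k N ts ∈ multilinear (k + 1) := by
  refine list_sum_mem fun P hP => ?_
  obtain ⟨t, ht, rfl⟩ := List.mem_map.1 hP
  exact Submodule.smul_mem _ _ (bracket_mem_multilinear (letters_forestWord (h t ht)))

theorem cost_add_le {k : ℕ} (θ η : lieMonomials k →₀ ℝ) : cost (θ + η) ≤ cost θ + cost η := by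
  classical
  unfold cost
  rw [Finsupp.sum_of_support_subset (θ + η) Finsupp.support_add _ (by simp),
    Finsupp.sum_of_support_subset θ Finset.subset_union_left _ (by simp),
    Finsupp.sum_of_support_subset η Finset.subset_union_right _ (by simp),
    ← Finset.sum_add_distrib]
  exact Finset.sum_le_sum fun γ _ => abs_add_le _ _

theorem exists_presentation {k N : ℕ} {ts : List WeightedForest}
    (h : ∀ t ∈ ts, (t.forest.flatMap leaves).Perm (List.range' 1 k)) :
    ∃ θ : lieMonomials (k + 1) →₀ ℝ,
      (θ.sum fun γ c => c • (γ : FreeLieAlgebra ℝ (Fin (k + 1)))) = lieSum k N ts ∧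
      cost θ ≤ ((ts.map fun t => t.pos + t.neg).sum : ℕ) / (N : ℝ) ∧
      ∀ γ, ∃ q : ℚ, θ γ = (q : ℝ) := by
  induction ts with
  | nil => exact ⟨0, by simp [lieSum], by simp [cost], fun γ => ⟨0, by simp⟩⟩
  | cons t ts ih =>
    obtain ⟨θ, h₁, h₂, h₃⟩ := ih fun u hu => h u (List.mem_cons_of_mem _ hu)
    let γ₀ : lieMonomials (k + 1) :=
      ⟨bracket (forestWord k t.forest), _, letters_forestWord (h t List.mem_cons_self), Or.inl rfl⟩
    refine ⟨Finsupp.single γ₀ (((t.pos : ℝ) - t.neg) / N) + θ, ?_, ?_, fun γ => ?_⟩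
    · rw [Finsupp.sum_add_index' (by simp) (by simp [add_smul]), h₁,
        Finsupp.sum_single_index (by simp)]
      rfl
    · refine (cost_add_le _ _).trans ?_
      rw [List.map_cons, List.sum_cons, Nat.cast_add, add_div]
      refine add_le_add ?_ h₂
      rw [cost, Finsupp.sum_single_index (by simp), abs_div, Nat.abs_cast]
      refine div_le_div_of_nonneg_right ?_ (Nat.cast_nonneg N)
      push_cast
      exact (abs_sub _ _).trans (by simp)
    · classical
      obtain ⟨q, hq⟩ := h₃ γ
      refine ⟨(if γ₀ = γ then ((t.pos : ℚ) - t.neg) / N else 0) + q, ?_⟩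
      rw [Finsupp.add_apply, Finsupp.single_apply, hq]
      split_ifs <;> push_cast <;> ring

theorem ascents_map_val {k : ℕ} (w : List (Fin k)) : ascents (w.map Fin.val) = ascents w := by
  induction w with
  | nil => rfl
  | cons a w ih =>
    cases w with
    | nil => rfl
    | cons b w =>
      rw [ascents, ← ih]
      rfl

theorem descents_map_val {k : ℕ} (w : List (Fin k)) : descents (w.map Fin.val) = descents w := by
  induction w with
  | nil => rfl
  | cons a w ih =>
    cases w with
    | nil => rfl
    | cons b w =>
      rw [descents, ← ih]
      rfl

theorem coe_zero_cons_eq_univ_iff {k : ℕ} (w : List (Fin (k + 1))) :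
    ((0 :: w : List (Fin (k + 1))) : Multiset (Fin (k + 1))) =
      (Finset.univ : Finset (Fin (k + 1))).val ↔ (w.map Fin.val).Perm (List.range' 1 k) := by
  have h : (Finset.univ : Finset (Fin (k + 1))).val =
    (List.finRange (k + 1) : Multiset (Fin (k + 1))) := rfl
  rw [h, Multiset.coe_eq_coe, ← List.map_perm_map_iff Fin.val_injective,
    List.map_coe_finRange_eq_range, List.range_eq_range', List.range'_succ]
  exact List.perm_cons 0

/-- A multilinear Lie polynomial given by forests is the one of the Magnus commutator if this is so
for the coefficients at the words which start with the first variable. -/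
theorem toAssoc_lieSum {k E : ℕ} (hE : E ≠ 0) {ts : List WeightedForest}
    (h : ∀ t ∈ ts, (t.forest.flatMap leaves).Perm (List.range' 1 k))
    (hc : ∀ w : List ℕ, w.Perm (List.range' 1 k) → weightedSum ts (delta w) =
      (-1) ^ descents (0 :: w) * (E * ((ascents (0 :: w))! * (descents (0 :: w))!) : ℕ)) :
    toAssoc (k + 1) (lieSum k ((k + 1)! * E) ts) = magnus (k + 1) := by
  obtain ⟨P, hP, e⟩ := exists_multilinear_toAssoc_eq_magnus (k + 1)
  rw [← e]
  congr 1
  refine eq_of_coefW_cons 0 (lieSum_mem_multilinear h) hP fun w hw => ?_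
  rw [e, coefW_lieSum h, coefW_magnus hw (List.cons_ne_nil _ _),
    hc _ ((coe_zero_cons_eq_univ_iff w).1 hw), ← ascents_map_val, ← descents_map_val]
  have hE' : (E : ℝ) ≠ 0 := Nat.cast_ne_zero.2 hE
  have hk : ((k + 1)! : ℝ) ≠ 0 := Nat.cast_ne_zero.2 (Nat.factorial_ne_zero _)
  rw [List.map_cons, Fin.val_zero]
  push_cast
  field_simp

/-! ### Certificates -/

theorem existsUnique_toAssoc_eq_magnus (k : ℕ) [NeZero k] :
    ∃! L : FreeLieAlgebra ℝ (Fin k), toAssoc k L = magnus k := by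
  obtain ⟨P, _, h⟩ := exists_multilinear_toAssoc_eq_magnus k
  exact ⟨P, h, fun Q hQ => toAssoc_injective k (hQ.trans h.symm)⟩

theorem toAssoc_magnusLie (k : ℕ) [NeZero k] : toAssoc k (magnusLie k) = magnus k := by
  have h := (existsUnique_toAssoc_eq_magnus k).exists
  rw [magnusLie, dif_pos h]
  exact h.choose_spec

/-- The value on the Magnus commutator of the functional given by a function `g - c` of the words
following the first variable. The second sum in the hypothesis compensates the offset `c`. -/
theorem wordEval_magnus {k c : ℕ} (g : List ℕ → ℕ) (V : ℕ) (hg : ∀ w, g w ≤ 2 * c)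
    (h : signedSum c k (List.range' 1 k) 0 0 0 g =
      V + signedSum c k (List.range' 1 k) 0 0 0 fun _ => c) :
    wordEval (fun w : List (Fin (k + 1)) =>
      ((prepend 0 (fun v => (g v : ℤ) - c) (w.map Fin.val) : ℤ) : ℝ)) (magnus (k + 1)) =
        V / (k + 1)! := by
  have hnd : (List.range' 1 k).Nodup := List.nodup_range'
  have hmap : ∀ w ∈ rearrangements (List.range' 1 k),
      (w.map (Fin.ofNat (k + 1))).map Fin.val = w := by
    intro w hw
    rw [List.map_map]
    refine (List.map_congr_left fun a ha => Nat.mod_eq_of_lt ?_).trans (List.map_id w)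
    have := (mem_rearrangements.1 hw).subset ha
    rw [List.mem_range'_1] at this
    omega
  have h' := congrArg (Nat.cast : ℕ → ℤ) h
  rw [Nat.cast_add, signedSum_eq hnd List.length_range' _ _ _ _ hg,
    signedSum_eq hnd List.length_range' _ _ _ _ fun _ => by omega, ← sub_eq_iff_eq_add,
    ← Finset.sum_sub_distrib] at h'
  have h'' := congrArg (Int.cast : ℤ → ℝ) h'
  rw [Int.cast_sum] at h''
  rw [Int.cast_natCast] at h''
  rw [← h'', Finset.sum_div,
    eq_sum_coefW _ _ (rearrangements (List.finRange (k + 1))) fun w hw => ?_]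
  · symm
    refine Finset.sum_of_injOn (fun w => 0 :: w.map (Fin.ofNat (k + 1))) ?_ ?_ ?_ ?_
    · intro w hw v hv e
      have := congrArg (List.map Fin.val) (List.cons_injective e)
      rwa [hmap w hw, hmap v hv] at this
    · intro w hw
      exact mem_rearrangements.2 (Multiset.coe_eq_coe.1 ((coe_zero_cons_eq_univ_iff _).2
        (by rw [hmap w hw]; exact mem_rearrangements.1 hw)))
    · intro w hw hw'
      rw [wordEval_word]
      cases w with
      | nil => simp [prepend]
      | cons a w =>
        rw [List.map_cons, prepend_cons, if_neg, Int.cast_zero, smul_zero]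
        intro ha
        obtain rfl : a = 0 := Fin.ext ha
        have hp := (coe_zero_cons_eq_univ_iff w).1
          (Multiset.coe_eq_coe.2 (mem_rearrangements.1 hw))
        refine hw' ⟨w.map Fin.val, mem_rearrangements.2 hp, ?_⟩
        change 0 :: (w.map Fin.val).map (Fin.ofNat (k + 1)) = 0 :: w
        rw [List.map_map]
        refine congrArg (List.cons 0) ((List.map_congr_left fun a _ => ?_).trans (List.map_id w))
        exact Fin.ext (Nat.mod_eq_of_lt a.2)
    · intro w hw
      have hp := (coe_zero_cons_eq_univ_iff (w.map (Fin.ofNat (k + 1)))).2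
        (by rw [hmap w hw]; exact mem_rearrangements.1 hw)
      rw [wordEval_word, coefW_magnus hp (List.cons_ne_nil _ _), ← ascents_map_val,
        ← descents_map_val, List.map_cons, hmap w hw, prepend_cons, Fin.val_zero, if_pos rfl]
      push_cast
      rw [smul_eq_mul, add_zero, add_zero]
      ring
  · refine coefW_magnus_eq_zero fun h => hw ?_
    exact mem_rearrangements.2 (Multiset.coe_eq_coe.1 h)

/-- Weak duality: a functional bounded by `1` on the Lie monomials bounds the cost from below. -/
theorem le_cost {k : ℕ} {θ : lieMonomials k →₀ ℝ} (hθ : IsPresentation k θ)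
    (α : FreeLieAlgebra ℝ (Fin k) →ₗ[ℝ] ℝ) (hα : ∀ M ∈ lieMonomials k, |α M| ≤ 1) :
    α (magnusLie k) ≤ cost θ := by
  rw [hθ, map_finsuppSum, cost]
  refine Finset.sum_le_sum fun γ _ => ?_
  change α (θ γ • (γ : FreeLieAlgebra ℝ (Fin k))) ≤ |θ γ|
  rw [map_smul, smul_eq_mul]
  refine (le_abs_self _).trans ?_
  rw [abs_mul]
  exact mul_le_of_le_one_right (abs_nonneg _) (hα _ γ.2)

/-- A primal and a dual solution of the same value determine the minimal cost. The forests in `bs`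
present `(k + 1)! E` times the Magnus commutator with cost `C`. The function `g - c` of the words
following the first variable defines a functional whose values on the Lie monomials are bounded by
`D`, and whose value on the Magnus commutator is `V / (k + 1)!`. -/
theorem isCertified_of_certificate {k E C : ℕ} (hE : E ≠ 0) {bs : List (List WeightedForest)}
    (hbs : allHaveLeaves (List.range' 1 k) bs = true) (hC : totalCost bs = C)
    (hc : ∀ w : List ℕ, w.Perm (List.range' 1 k) → weightedSum bs.flatten (delta w) =
      (-1) ^ descents (0 :: w) * (E * ((ascents (0 :: w))! * (descents (0 :: w))!) : ℕ))
    {g : List ℕ → ℕ} {c D M V : ℕ} (hD : D ≠ 0) (hM : M * 2 ^ (k + 1) ≤ c)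
    (hg : ∀ w, |(g w : ℤ) - c| ≤ M) (hb : boundedOn g c D (List.range' 1 k) (.of 0) = true)
    (hV : signedSum c k (List.range' 1 k) 0 0 0 g =
      V + signedSum c k (List.range' 1 k) 0 0 0 fun _ => c) (hVC : V * E = C * D) :
    IsCertified (k + 1) (C / ((k + 1)! * E : ℕ)) ∧
      ((k + 1)! : ℝ) * lieTheta (k + 1) = C / ((k + 1)! * E : ℕ) := by
  have hE' : (E : ℝ) ≠ 0 := Nat.cast_ne_zero.2 hE
  have hD' : (D : ℝ) ≠ 0 := Nat.cast_ne_zero.2 hD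
  have hk : ((k + 1)! : ℝ) ≠ 0 := Nat.cast_ne_zero.2 (Nat.factorial_ne_zero _)
  have hF := of_allHaveLeaves hbs
  have hL : magnusLie (k + 1) = lieSum k ((k + 1)! * E) bs.flatten :=
    toAssoc_injective _ ((toAssoc_magnusLie _).trans (toAssoc_lieSum hE hF hc).symm)
  obtain ⟨θ, hθ, hcost, hq⟩ := exists_presentation (N := (k + 1)! * E) hF
  rw [← totalCost_eq, hC] at hcost
  have hθ' : IsPresentation (k + 1) θ := by rw [IsPresentation, hθ, hL]
  set G : List (Fin (k + 1)) → ℤ := fun w => prepend 0 (fun v => (g v : ℤ) - c) (w.map Fin.val)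
    with hG
  set α : FreeLieAlgebra ℝ (Fin (k + 1)) →ₗ[ℝ] ℝ :=
    (D : ℝ)⁻¹ • (wordEval fun w => (G w : ℝ)) ∘ₗ (toAssoc (k + 1) : _ →ₗ[ℝ] _) with hα
  have hαb : ∀ T, α (bracket T) = (D : ℝ)⁻¹ * (act T G [] : ℤ) := fun T => by
    have := act_comp_hom (Int.castAddHom ℝ) T G []
    simp only [Int.coe_castAddHom] at this
    rw [← this, ← wordEval_toAssoc]
    rfl
  have hle : ∀ T, letters T = (Finset.univ : Finset (Fin (k + 1))).val → |α (bracket T)| ≤ 1 := by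
    intro T hT
    rw [hαb, abs_mul, abs_inv, Nat.abs_cast, inv_mul_le_one₀ (by positivity), ← Int.cast_abs]
    have := abs_act_le g c D M hM hg hb T hT
    rw [← Int.cast_natCast]
    exact Int.cast_le.2 this
  have hα₁ : ∀ M ∈ lieMonomials (k + 1), |α M| ≤ 1 ∧ ∃ q : ℚ, α M = (q : ℝ) := by
    rintro _ ⟨T, hT, rfl | rfl⟩
    · exact ⟨hle T hT, (D : ℚ)⁻¹ * (act T G [] : ℤ), by rw [hαb]; push_cast; ring⟩
    · exact ⟨by rw [map_neg, abs_neg]; exact hle T hT, -((D : ℚ)⁻¹ * (act T G [] : ℤ)), by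
        rw [map_neg, hαb]; push_cast; ring⟩
  have hα₂ : α (magnusLie (k + 1)) = C / ((k + 1)! * E : ℕ) := by
    have h₁ : α (magnusLie (k + 1)) =
        (D : ℝ)⁻¹ * wordEval (fun w => (G w : ℝ)) (toAssoc (k + 1) (magnusLie (k + 1))) := rfl
    have hg' : ∀ w, g w ≤ 2 * c := fun w => by
      have h₁ := abs_le.1 (hg w)
      have h₂ : M ≤ c := (Nat.le_mul_of_pos_right M (by positivity)).trans hM
      omega
    rw [h₁, toAssoc_magnusLie, wordEval_magnus g V hg' hV]
    have : (V : ℝ) * E = C * D := by exact_mod_cast hVC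
    push_cast
    field_simp
    linarith
  have hmin : ∀ η, IsPresentation (k + 1) η → (C / ((k + 1)! * E : ℕ) : ℝ) ≤ cost η :=
    fun η hη => hα₂ ▸ le_cost hη α fun M hM => (hα₁ M hM).1
  have hcost' : cost θ = C / ((k + 1)! * E : ℕ) := le_antisymm hcost (hmin θ hθ')
  refine ⟨⟨⟨θ, hθ', hcost', hq⟩, α, hα₁, hα₂⟩, ?_⟩
  have hleast : IsLeast {x : ℝ | ∃ θ : lieMonomials (k + 1) →₀ ℝ,
      IsPresentation (k + 1) θ ∧ x = cost θ} (C / ((k + 1)! * E : ℕ)) := by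
    refine ⟨⟨θ, hθ', hcost'.symm⟩, ?_⟩
    rintro _ ⟨η, hη, rfl⟩
    exact hmin η hη
  rw [lieTheta, hleast.csInf_eq]
  field_simp

theorem hasMagnusCoeffsFrom_append {E k : ℕ} {bs : List (List WeightedForest)} {l l' : List ℕ}
    (h : hasMagnusCoeffsFrom E k bs l = true) (h' : hasMagnusCoeffsFrom E k bs l' = true) :
    hasMagnusCoeffsFrom E k bs (l ++ l') = true := by
  induction l with
  | nil => exact h'
  | cons a l ih =>
    obtain ⟨h₁, h₂⟩ := boolRec_eq_true h
    change Bool.rec false (hasMagnusCoeffsFrom E k bs (l ++ l')) (hasMagnusCoeffs E (Nat.pred k)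
      ((List.range' 1 k).erase a) a 1 0 (stripBlocks a bs)) = true
    rw [h₁]
    exact ih h₂

theorem weightedSum_delta_of_perm {E k : ℕ} {bs : List (List WeightedForest)} (hk : k ≠ 0)
    (h : hasMagnusCoeffsFrom E k bs (List.range' 1 k) = true) (w : List ℕ)
    (hw : w.Perm (List.range' 1 k)) : weightedSum bs.flatten (delta w) =
      (-1) ^ descents (0 :: w) * (E * ((ascents (0 :: w))! * (descents (0 :: w))!) : ℕ) := by
  cases w with
  | nil =>
    have := hw.length_eq
    rw [List.length_range'] at this
    exact absurd this.symm hk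
  | cons a w =>
    exact weightedSum_delta_of_hasMagnusCoeffsFrom h (hw.subset List.mem_cons_self) hw

/-! ### Dihedral orbits of Lie monomials

A bracketed word in the letters `0, …, s - 1`, each occurring once, is a planar binary tree. If
its root is labelled by `s`, then it becomes a trivalent tree with leaves labelled by `0, …, s`,
and the dihedral group of the cyclically ordered set `0, …, s` acts on such trees by change of
labels. The Magnus commutator is invariant under this action, up to the sign `(-1) ^ (s - 1)`
for reflections, so there are optimal presentations consisting of whole orbits. Nothing of this is
needed for the correctness of the presentations, as they are checked after expansion. -/

/-- Passes the entry of `l` at position `d` to `p`. -/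
def withEntry {R : Type} (r : R) (d : ℕ) (l : List ℕ) (p : ℕ → R) : R :=
  List.rec (fun _ => r) (fun a _ ih d => Nat.rec (p a) (fun d _ => ih d) d) l d

/-- Reads a bracketed word in postfix notation, where `0` stands for the bracket operation and
`d + 1` for the letter at position `d` of `σ`. -/
def parse (σ : List ℕ) (p : FreeMagma ℕ → List WeightedForest) (ds : List ℕ) :
    List (FreeMagma ℕ) → List WeightedForest :=
  List.rec (fun st => List.rec [] (fun A _ _ => p A) st)
    (fun d _ ih st => Nat.rec
      (List.rec [] (fun B st _ => List.rec [] (fun A st _ => ih (.mul A B :: st)) st) st)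
      (fun d _ => withEntry [] d σ fun a => ih (.of a :: st)) d) ds

/-- Makes the leaf `s` of the tree `A` the new root, where `up` is what is seen from the root of `A`
in the direction opposite to `A`. -/
def reroot (s : ℕ) (A : FreeMagma ℕ) (p : FreeMagma ℕ → List WeightedForest) :
    FreeMagma ℕ → List WeightedForest → List WeightedForest :=
  FreeMagma.rec (fun b up ts => Bool.rec ts (p up) (Nat.beq s b))
    (fun B C rB rC up ts => rB (.mul C up) (rC (.mul up B) ts)) A

/-- The image of a bracketed word under the change of labels `σ`, brought into the form
`[…[[0, A₁], A₂], …, Aₘ]`, with coefficient `p - n`, in front of `ts`. -/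
def image (s : ℕ) (σ ds : List ℕ) (p n : ℕ) (ts : List WeightedForest) : List WeightedForest :=
  parse σ (fun A => withEntry [] s σ fun r => Bool.rec
    (reroot s A (fun A => stripTree 0 A [] p n ts) (.of r) [])
    (stripTree 0 A [] p n ts) (Nat.beq r s)) ds []

/-- The images of all bracketed words in the list `reps` under the change of labels `σ`, with a
change of sign if `sg` is true. -/
def images (s : ℕ) (σ : List ℕ) (sg : Bool) (reps : List (List ℕ × ℕ × ℕ)) :
    List WeightedForest :=
  List.rec [] (fun x _ ih => Prod.rec (fun ds pn => Prod.rec (fun p n =>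
    Bool.rec (image s σ ds p n ih) (image s σ ds n p ih) sg) pn) x) reps

/-- Passes `l` with `a` appended to `p`. -/
def withConcat {R : Type} (a : ℕ) (l : List ℕ) : (List ℕ → R) → R :=
  List.rec (fun p => p [a]) (fun b _ ih p => ih (fun r => p (b :: r))) l

/-- The lists `images` for `σ` and its first `n - 1` rotations, in front of `ts`. -/
def rotations (s : ℕ) (reps : List (List ℕ × ℕ × ℕ)) (sg : Bool) (ts : List (List WeightedForest))
    (n : ℕ) : List ℕ → List (List WeightedForest) :=
  Nat.rec (fun _ => ts) (fun _ ih σ => images s σ sg reps ::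
    List.rec [] (fun a l _ => withConcat a l ih) σ) n

/-- The dihedral orbits of the bracketed words in `reps`, as lists of images. -/
def orbits (s : ℕ) (reps : List (List ℕ × ℕ × ℕ)) : List (List WeightedForest) :=
  rotations s reps false
    (rotations s reps (isEven s) [] (s + 1)
      (List.rec [s] (fun a _ r => a :: r) (List.range s).reverse))
    (s + 1) (List.range (s + 1))

/-! ### Tables of values on words -/

/-- The number of entries of `l` which are at most `a`. -/
def countLe (a : ℕ) (l : List ℕ) : ℕ :=
  List.rec 0 (fun b _ ih => Bool.rec ih (Nat.add ih 1) (Nat.ble b a)) l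

/-- The position of a word in the lexicographic order of its rearrangements. -/
def rank (w : List ℕ) : ℕ :=
  List.rec 0 (fun a l ih => Nat.add (Nat.mul (countLe a l) (fact (List.length l))) ih) w

/-- The value at a word which is given by a table, with the numbers in the table shifted by `r`.
Each entry of the table consists of `120` numbers with `b` binary digits each, by
increasing rank from the lowest digits on. -/
def lookup (b r : ℕ) (table w : List ℕ) : ℕ :=
  Nat.add (withEntry 0 (Nat.div (rank w) 120) table fun x =>
    Nat.mod (Nat.shiftRight x (Nat.mul b (Nat.mod (rank w) 120))) (Nat.pow 2 b)) r

theorem withEntry_lt {d m : ℕ} {l : List ℕ} {p : ℕ → ℕ} (hm : 0 < m) (hp : ∀ a, p a < m) :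
    withEntry 0 d l p < m := by
  induction l generalizing d with
  | nil => exact hm
  | cons a l ih =>
    cases d with
    | zero => exact hp a
    | succ d => exact ih

theorem abs_lookup_sub_le (b c D : ℕ) (hD : D ≤ 2 ^ b) (hc : D ≤ c) (table w : List ℕ) :
    |(lookup b (c - D) table w : ℤ) - c| ≤ (2 ^ b : ℕ) := by
  have h : lookup b (c - D) table w < 2 ^ b + (c - D) :=
    Nat.add_lt_add_right (withEntry_lt (Nat.two_pow_pos b) fun _ =>
      Nat.mod_lt _ (Nat.two_pow_pos b)) _
  have h' : c - D ≤ lookup b (c - D) table w := Nat.le_add_left _ _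
  rw [abs_le]
  generalize 2 ^ b = N at *
  omega

/-! ### Optimal presentations and functionals -/

/-- A primal and a dual solution given by orbits and a table determine the minimal cost. The values
in the table are below `2 ^ b`, so they stay below the offset `2 ^ (b + k + 1)` in all evaluations
on bracketed words with `k + 1` letters. -/
theorem isCertified_of_tables {k E C b D V : ℕ} (hk : k ≠ 0) (hE : E ≠ 0)
    (reps : List (List ℕ × ℕ × ℕ)) (table : List ℕ) (hD : D ≠ 0) (hDb : D ≤ 2 ^ b)
    (hVC : V * E = C * D)
    (hbs : allHaveLeaves (List.range' 1 k) (orbits (k + 1) reps) = true)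
    (hC : totalCost (orbits (k + 1) reps) = C)
    (hc : hasMagnusCoeffsFrom E k (orbits (k + 1) reps) (List.range' 1 k) = true)
    (hb : boundedOn (lookup b (2 ^ (b + k + 1) - D) table) (2 ^ (b + k + 1)) D
      (List.range' 1 k) (.of 0) = true)
    (hV : signedSum (2 ^ (b + k + 1)) k (List.range' 1 k) 0 0 0
        (lookup b (2 ^ (b + k + 1) - D) table) =
      V + signedSum (2 ^ (b + k + 1)) k (List.range' 1 k) 0 0 0 fun _ => 2 ^ (b + k + 1))
    {v : ℝ} (hv : (C / ((k + 1)! * E : ℕ) : ℝ) = v) :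
    IsCertified (k + 1) v ∧ ((k + 1)! : ℝ) * lieTheta (k + 1) = v := by
  subst hv
  exact isCertified_of_certificate hE hbs hC (weightedSum_delta_of_perm hk hc) hD
    (M := 2 ^ b) (by rw [← pow_add, add_assoc])
    (abs_lookup_sub_le b _ D hDb (hDb.trans (Nat.pow_le_pow_right two_pos (by omega))) table)
    hb hV hVC

theorem isCertified_one : IsCertified 1 1 ∧ (1 ! : ℝ) * lieTheta 1 = 1 := by
  have h := isCertified_of_certificate (k := 0) (E := 1) (C := 1) (bs := [[⟨[], 1, 0⟩]])
    (g := fun _ => 3) (c := 2) (D := 1) (M := 1) (V := 1) (by decide) rfl rfl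
    (fun w hw => by
      obtain rfl : w = [] := List.perm_nil.1 hw
      decide)
    (by decide) (by decide) (fun _ => by decide) rfl rfl rfl
  have e : ((1 : ℕ) / ((0 + 1)! * 1 : ℕ) : ℝ) = 1 := by norm_num
  rwa [e] at h

/-- An optimal presentation for two variables: orbit representatives in postfix notation with
the positive and the negative part of their coefficients, multiplied by `2! * 6`. -/
def repsTwo : List (List ℕ × ℕ × ℕ) := [
  ([1,2,0], 1, 0)]

/-- An optimal functional for two variables: its values on the words which start with the first
variable, increased by `1`. -/
def tableTwo : List ℕ := [
  0x2]

theorem isCertified_two : IsCertified 2 (1 / 2) ∧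
    (2 ! : ℝ) * lieTheta 2 = 1 / 2 := by
  have h := isCertified_of_tables (k := 1) (E := 6)
    (C := 6) (b := 4) (D := 1)
    (V := 1) (by decide) (by decide)
    repsTwo tableTwo (by decide) (by decide) (by decide) (by decide +kernel) (by decide +kernel)
    (by decide +kernel) (by decide +kernel) (by decide +kernel)
    (v := 1 / 2) (by norm_num [Nat.factorial])
  exact h

/-- An optimal presentation for three variables: orbit representatives in postfix notation with
the positive and the negative part of their coefficients, multiplied by `3! * 4`. -/
def repsThree : List (List ℕ × ℕ × ℕ) := [
  ([1,2,3,0,0], 1, 0)]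

/-- An optimal functional for three variables: its values on the words which start with the first
variable, increased by `1`. -/
def tableThree : List ℕ := [
  0x12]

theorem isCertified_three : IsCertified 3 (1 / 3) ∧
    (3 ! : ℝ) * lieTheta 3 = 1 / 3 := by
  have h := isCertified_of_tables (k := 2) (E := 4)
    (C := 8) (b := 4) (D := 1)
    (V := 2) (by decide) (by decide)
    repsThree tableThree (by decide) (by decide) (by decide) (by decide +kernel) (by decide +kernel)
    (by decide +kernel) (by decide +kernel) (by decide +kernel)
    (v := 1 / 3) (by norm_num [Nat.factorial])
  exact h

/-- An optimal presentation for four variables: orbit representatives in postfix notation with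
the positive and the negative part of their coefficients, multiplied by `4! * 5`. -/
def repsFour : List (List ℕ × ℕ × ℕ) := [
  ([1,2,3,0,4,0,0], 3, 0), ([1,2,4,0,0,3,0], 1, 0)]

/-- An optimal functional for four variables: its values on the words which start with the first
variable, increased by `1`. -/
def tableFour : List ℕ := [
  0x112]

theorem isCertified_four : IsCertified 4 (1 / 3) ∧
    (4 ! : ℝ) * lieTheta 4 = 1 / 3 := by
  have h := isCertified_of_tables (k := 3) (E := 5)
    (C := 40) (b := 4) (D := 1)
    (V := 8) (by decide) (by decide)
    repsFour tableFour (by decide) (by decide) (by decide) (by decide +kernel) (by decide +kernel)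
    (by decide +kernel) (by decide +kernel) (by decide +kernel)
    (v := 1 / 3) (by norm_num [Nat.factorial])
  exact h

/-- An optimal presentation for five variables: orbit representatives in postfix notation with
the positive and the negative part of their coefficients, multiplied by `5! * 1`. -/
def repsFive : List (List ℕ × ℕ × ℕ) := [
  ([1,2,3,4,0,0,5,0,0], 1, 0), ([1,2,3,5,0,0,0,4,0], 1, 0), ([1,2,3,0,4,0,5,0,0], 1, 0),
  ([1,2,5,0,4,0,3,0,0], 0, 1)]

/-- An optimal functional for five variables: its values on the words which start with the first
variable, increased by `1`. -/
def tableFive : List ℕ := [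
  0x211110101000110011000112]

theorem isCertified_five : IsCertified 5 (2 / 5) ∧
    (5 ! : ℝ) * lieTheta 5 = 2 / 5 := by
  have h := isCertified_of_tables (k := 4) (E := 1)
    (C := 48) (b := 4) (D := 1)
    (V := 48) (by decide) (by decide)
    repsFive tableFive (by decide) (by decide) (by decide) (by decide +kernel) (by decide +kernel)
    (by decide +kernel) (by decide +kernel) (by decide +kernel)
    (v := 2 / 5) (by norm_num [Nat.factorial])
  exact h

/-- An optimal presentation for six variables: orbit representatives in postfix notation with
the positive and the negative part of their coefficients, multiplied by `6! * 7`. -/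
def repsSix : List (List ℕ × ℕ × ℕ) := [
  ([1,2,4,0,5,0,6,0,3,0,0], 0, 18), ([1,2,3,5,0,0,4,6,0,0,0], 30, 0),
  ([1,2,5,0,3,0,4,0,6,0,0], 0, 36), ([1,2,5,0,6,0,3,0,0,4,0], 0, 6),
  ([1,2,6,0,5,0,4,0,3,0,0], 30, 0), ([1,2,3,0,4,5,0,0,6,0,0], 12, 0),
  ([1,2,3,5,0,6,0,0,0,4,0], 24, 0), ([1,4,6,0,0,3,5,0,0,2,0], 0, 12),
  ([1,2,3,4,0,0,5,0,6,0,0], 48, 0), ([1,2,4,6,0,0,5,0,0,3,0], 6, 0)]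

/-- An optimal functional for six variables: its values on the words which start with the first
variable, increased by `1`. -/
def tableSix : List ℕ := [
  0x11222112222222211222110111221222221222121212110222121212110101110221010212100211121100010111111211110101000110011000112]

theorem isCertified_six : IsCertified 6 (37 / 60) ∧
    (6 ! : ℝ) * lieTheta 6 = 37 / 60 := by
  have h := isCertified_of_tables (k := 5) (E := 7)
    (C := 3108) (b := 4) (D := 1)
    (V := 444) (by decide) (by decide)
    repsSix tableSix (by decide) (by decide) (by decide) (by decide +kernel) (by decide +kernel)
    (by decide +kernel) (by decide +kernel) (by decide +kernel)
    (v := 37 / 60) (by norm_num [Nat.factorial])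
  exact h

/-- An optimal presentation for seven variables: orbit representatives in postfix notation with
the positive and the negative part of their coefficients, multiplied by `7! * 44`. -/
def repsSeven : List (List ℕ × ℕ × ℕ) := [
  ([1,4,6,0,7,0,0,5,0,3,0,2,0], 320, 0), ([1,2,3,4,0,0,5,6,0,0,7,0,0], 444, 0),
  ([1,2,3,4,0,0,5,0,6,0,7,0,0], 356, 0), ([1,2,3,4,0,5,6,0,0,0,7,0,0], 552, 0),
  ([1,2,6,0,5,0,3,0,7,0,4,0,0], 324, 0), ([1,2,3,4,6,0,0,7,0,0,0,5,0], 656, 0),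
  ([1,2,4,0,5,0,6,0,3,0,7,0,0], 0, 600), ([1,2,6,7,0,0,5,0,4,0,3,0,0], 312, 0),
  ([1,2,6,0,3,0,4,0,5,0,7,0,0], 0, 648), ([1,5,0,3,7,0,0,2,6,0,0,4,0], 37, 0),
  ([1,2,6,0,5,0,4,0,7,0,3,0,0], 296, 0), ([1,2,5,6,7,0,0,0,4,0,3,0,0], 0, 232),
  ([1,2,3,4,0,5,0,0,6,0,7,0,0], 44, 0), ([1,2,7,0,6,0,4,5,0,0,3,0,0], 312, 0),
  ([1,3,5,0,6,0,7,0,0,2,0,4,0], 0, 64), ([1,2,3,6,0,0,5,0,7,0,4,0,0], 0, 116),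
  ([1,2,7,0,5,6,0,0,4,0,3,0,0], 316, 0), ([1,2,4,0,3,5,0,7,0,0,0,6,0], 132, 0),
  ([1,2,7,0,5,0,4,0,0,6,0,3,0], 116, 0), ([1,2,7,0,6,0,5,0,3,4,0,0,0], 480, 0),
  ([1,2,6,0,5,0,4,0,3,0,7,0,0], 576, 0), ([1,2,6,0,4,7,0,5,0,0,0,3,0], 184, 0),
  ([1,2,5,0,4,0,3,0,6,0,7,0,0], 0, 312), ([1,2,3,5,0,0,4,6,0,7,0,0,0], 348, 0),
  ([1,4,6,0,7,0,0,2,0,3,0,5,0], 0, 384), ([1,2,4,5,0,0,6,0,7,0,3,0,0], 0, 140),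
  ([1,2,3,0,4,5,0,0,6,7,0,0,0], 124, 0), ([1,2,3,0,4,5,0,6,0,0,7,0,0], 44, 0),
  ([1,2,4,0,5,0,6,7,0,0,3,0,0], 0, 120), ([1,2,3,4,5,0,0,6,0,0,7,0,0], 336, 0),
  ([1,2,5,0,4,0,3,0,6,7,0,0,0], 0, 140), ([1,2,3,7,0,6,0,0,5,0,0,4,0], 0, 52),
  ([1,2,3,4,6,0,0,5,0,0,7,0,0], 472, 0), ([1,2,4,5,7,0,0,6,0,0,0,3,0], 80, 0),
  ([1,2,4,0,5,6,0,0,7,0,3,0,0], 0, 120), ([1,2,5,0,6,0,7,0,3,0,0,4,0], 0, 124),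
  ([1,3,6,0,4,7,0,0,0,5,0,2,0], 0, 14), ([1,2,3,4,5,0,6,0,0,0,7,0,0], 64, 0),
  ([1,4,7,0,0,3,6,0,0,2,5,0,0], 0, 16), ([1,2,3,4,6,0,7,0,0,0,0,5,0], 236, 0),
  ([1,2,3,5,0,7,0,0,0,4,6,0,0], 652, 0), ([1,2,4,0,6,0,7,0,0,5,0,3,0], 0, 392),
  ([1,2,7,0,4,0,5,0,6,0,3,0,0], 460, 0), ([1,2,4,0,7,0,6,0,5,0,3,0,0], 352, 0),
  ([1,2,3,5,7,0,0,6,0,0,0,4,0], 20, 0), ([1,2,3,7,0,6,0,5,0,0,0,4,0], 0, 92),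
  ([1,2,5,0,7,0,6,0,4,0,3,0,0], 16, 0), ([1,2,3,5,0,0,4,6,0,0,7,0,0], 16, 0),
  ([1,2,6,0,3,0,4,0,5,7,0,0,0], 0, 276), ([1,2,4,0,3,5,0,0,6,7,0,0,0], 100, 0),
  ([1,2,3,4,6,0,0,0,5,7,0,0,0], 708, 0), ([1,2,4,0,6,0,7,0,3,0,0,5,0], 0, 436),
  ([1,2,3,0,4,0,5,6,0,0,7,0,0], 16, 0), ([1,7,0,2,5,0,3,6,0,0,0,4,0], 0, 22),
  ([1,3,5,0,7,0,0,4,6,0,0,2,0], 0, 4), ([1,2,3,4,6,0,0,0,7,0,0,5,0], 148, 0),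
  ([1,2,7,0,6,0,4,0,3,0,0,5,0], 332, 0), ([1,2,6,0,3,0,7,0,5,0,4,0,0], 76, 0),
  ([1,2,3,5,0,0,4,7,0,0,0,6,0], 128, 0), ([1,2,3,6,0,7,0,0,5,0,4,0,0], 0, 100)]

/-- An optimal functional for seven variables: its values on the words which start with the first
variable, multiplied by `176` and increased by `176`. -/
def tableSeven : List ℕ := [
  0x1b0cb0cb1601461600cb10f13d16015812315213d1601460f40b016013d13d0b00b00000cb0e50e514612c0b013712914512a1600be14313112209411306c1600e41460960a700012213e1430c212009a1450cb1370be1020520e504f0cb0960960001230fb0b00280960001600ca1520c508102f13d08d0cb06c0d602f0cb01b01b0000960000b00c50b00730730731600ca0d309608d0000d303d0a200003d00008d050000000073073000015000073073123,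
  0x1c0cc0a515514a16006d0da11d14a10613310f1551601120f10bc1601151100b709900c0a510414314f11b10910f10415516011b0c21310f71491460e80c50df1400df04f09001b11d0da1341331060831600cc15512314a09a0d10b70bc0b00d30961101091600fb08d0501551261550bc11a0731490990bc0b00df02f0bc00c00c0000b00001601231600c50c50150b00ca0b00d30b00b00c50df0c50960df0960b008d0b00960730730b00c50b0073073073,
  0xb00761260ed13408110e0f615510814f0bc1141601551031260ed0e11600f70b30990811230f71341601260df0fa0f61601521460a40e110213d0b30ca10811413713110308d0ca0e514c1601371091600cb1601601600b00d811516013d0ca0ca1521401600e40df03d0a51030e20f114011a0b30b30bc0f40b00810bc0990bc0b00b008d1601601600b00b00000b00b31230e80b00df10e1030e51131400d60fa0900cb0a70df03d1601601600b00b0000,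
  0x8d0960f60ed1600170bf0620cc0a51040af1050dd0da0ad0da0c413410f10411a0cc0000b00b016016016008d1230a70cb0cb0e509a13413d10f10013e10e16013f1291340cb0230820c614a0b611b0b90d40d314612c12c0b01601601600b01600bc0df1601600c50d30830ad0b11061051060fe11a1491581341200ca11016013d0b00d30f61101601230b008d07210011511b13414a11913414a1601601020d30df1601460c50a21601601600b00b0000,
  0xa40a40a408d08d0b00a40e80ad0b00eb12307e0bf0bb10e0820e50b012311a0fa0d40cb00008d0880ed0d81600000b000001b01b0cb0140c40960cb07212205e10e09d13711914505e0eb0bc0ed11916006a11a0810cb0c20e50690ed0df1520b01600691080de14310e13d0000a50a41080b613706a10f0df13d1151430ea1601601601231520bc1520d30e50fa0cb01b0cb0c215212c16009d13f0dc14514a1370de1371601220e50cb1601601600cb0cb01b,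
  0x1540a40a40000000000a40a401700005e08100b01700b0810230ca00008d06a0df0b91600a40a408f0960880b000b07e00001c0000a502c0af04306d08311d01409a06a10f0fe1600170ad02f0760bc0f700b0bb0510a50a414301d0bc0bb10f0a51550690a40ea1310b31490000620510f60c614c0430dd0f311d0b11340bb1601441600e21550b00d80ca0d10bc0bc0000a70810f60d316009613d0df1551491550df1021601490bc0bc1601601600bc0bc00c]

theorem isCertified_seven : IsCertified 7 (1621 / 1540) ∧
    (7 ! : ℝ) * lieTheta 7 = 1621 / 1540 := by
  have h := isCertified_of_tables (k := 6) (E := 44)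
    (C := 233424) (b := 12) (D := 176)
    (V := 933696) (by decide) (by decide)
    repsSeven tableSeven (by decide) (by decide) (by decide) (by decide +kernel) (by decide +kernel)
    (by decide +kernel) (by decide +kernel) (by decide +kernel)
    (v := 1621 / 1540) (by norm_num [Nat.factorial])
  exact h

/-- An optimal presentation for eight variables: orbit representatives in postfix notation with
the positive and the negative part of their coefficients, multiplied by `8! * 483868586692099843325`. -/
def repsEight : List (List ℕ × ℕ × ℕ) := [
  ([1,2,3,4,0,5,7,0,0,0,6,8,0,0,0], 17611870943605507816360, 0),
  ([1,2,5,0,7,0,8,0,0,3,0,4,0,6,0], 0, 17476131151118979630016),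
  ([1,2,6,0,7,0,8,0,3,4,5,0,0,0,0], 0, 27361660671067533669704),
  ([1,2,8,0,6,0,5,0,4,0,7,0,3,0,0], 0, 25162997005652861987488),
  ([1,2,3,4,7,0,0,0,5,0,6,8,0,0,0], 25079906322726227803048, 0),
  ([1,2,3,7,0,6,0,5,0,4,0,0,8,0,0], 21586572421336202135704, 0),
  ([1,2,6,0,8,0,4,0,0,7,0,3,0,5,0], 12244062399961974151552, 0),
  ([1,2,4,0,5,0,6,0,3,0,7,8,0,0,0], 0, 23479814702862098958536),
  ([1,2,7,0,6,0,5,0,4,0,3,0,8,0,0], 0, 23498553433942396881320),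
  ([1,2,4,5,0,0,6,7,0,0,8,0,3,0,0], 0, 21957390036061113889480),
  ([1,2,7,0,5,0,4,0,3,0,6,0,8,0,0], 21612982879527380423920, 0),
  ([1,2,3,5,0,6,0,7,0,4,0,0,8,0,0], 0, 20333043085832880580496),
  ([1,2,3,4,5,0,0,6,0,7,0,0,8,0,0], 19042880218322717955160, 0),
  ([1,2,7,0,3,0,4,0,5,0,6,8,0,0,0], 0, 21240890463945447814640),
  ([1,3,5,0,7,0,8,0,0,2,0,4,0,6,0], 0, 20925901801993151570560),
  ([1,3,6,0,7,0,8,0,0,5,0,4,0,2,0], 20798577386700881062424, 0),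
  ([1,5,7,0,8,0,0,2,0,3,0,4,6,0,0], 0, 20582876579374624888704),
  ([1,2,3,4,6,8,0,0,0,0,5,0,0,7,0], 16254045962922131977032, 0),
  ([1,2,6,0,4,0,5,0,7,0,8,0,3,0,0], 19806848421417265423784, 0),
  ([1,2,8,0,4,0,7,0,6,0,5,0,3,0,0], 0, 19217265021509950911320),
  ([1,2,4,5,7,0,0,6,8,0,0,0,0,3,0], 13973443188110899044032, 0),
  ([1,2,3,5,0,6,8,0,0,0,0,4,7,0,0], 18409675261441862478528, 0),
  ([1,2,3,4,5,7,0,0,8,0,0,0,0,6,0], 18221946488999337974568, 0),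
  ([1,2,3,6,0,7,0,8,0,4,0,0,0,5,0], 0, 18194451810959622032280),
  ([1,2,7,0,5,0,4,0,3,0,6,8,0,0,0], 18053783173258304364160, 0),
  ([1,2,3,4,5,0,6,7,0,0,0,0,8,0,0], 15052898426592449085240, 0),
  ([1,2,8,0,7,0,6,0,5,0,3,0,0,4,0], 0, 17942738261410369709040),
  ([1,2,4,0,8,0,5,0,6,0,7,0,3,0,0], 17664721083859861770152, 0),
  ([1,2,3,4,6,8,0,0,0,7,0,0,0,5,0], 17658815146280791590776, 0),
  ([1,2,8,0,7,0,5,6,0,0,3,4,0,0,0], 16859497822168583696056, 0),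
  ([1,2,3,4,6,0,7,0,8,0,0,0,0,5,0], 17526099075719850161392, 0),
  ([1,2,3,0,4,5,0,0,6,0,7,8,0,0,0], 8727375950783863631032, 0),
  ([1,2,7,0,6,0,5,0,8,0,4,0,3,0,0], 0, 17237090789800423239176),
  ([1,2,6,0,3,0,4,0,5,7,0,0,8,0,0], 0, 17005065363217814670520),
  ([1,2,3,6,0,0,8,0,7,0,5,0,4,0,0], 16761094950133176524528, 0),
  ([1,2,3,4,5,0,6,0,0,7,0,0,8,0,0], 4826645232327008734848, 0),
  ([1,2,6,0,5,0,4,0,3,0,7,8,0,0,0], 12256413844349983365768, 0),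
  ([1,2,7,0,6,0,4,0,3,0,5,8,0,0,0], 16418059379464958270880, 0),
  ([1,2,4,6,0,8,0,0,0,3,5,0,7,0,0], 15584537831234266509032, 0),
  ([1,2,5,0,7,0,8,0,4,0,3,0,0,6,0], 17868064681513310754480, 0),
  ([1,2,3,0,4,5,7,0,0,0,6,8,0,0,0], 10762268575006640439424, 0),
  ([1,2,5,7,0,8,0,0,6,0,4,0,3,0,0], 15163911583147681948488, 0),
  ([1,2,7,8,0,0,4,0,5,0,6,0,3,0,0], 15049110000155027219456, 0),
  ([1,2,4,5,8,0,0,0,6,0,7,0,3,0,0], 0, 14239843976043826349168),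
  ([1,2,5,0,6,0,7,0,4,0,8,0,3,0,0], 14937046762918312082264, 0),
  ([1,2,8,0,7,0,6,0,0,5,0,4,0,3,0], 0, 7438313084667944327936),
  ([1,2,7,0,6,0,4,0,8,0,3,5,0,0,0], 14683929047622905684248, 0),
  ([1,2,5,0,6,0,8,0,3,4,7,0,0,0,0], 0, 14683158369837770803248),
  ([1,2,6,7,8,0,0,0,5,0,4,0,3,0,0], 14381900362218389095904, 0),
  ([1,2,8,0,5,7,0,0,4,0,3,0,0,6,0], 14348903659738440951712, 0),
  ([1,2,3,0,8,0,5,0,6,0,7,0,4,0,0], 7140092950109604462200, 0),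
  ([1,2,5,0,7,0,8,0,3,4,6,0,0,0,0], 0, 14029754943046327300880),
  ([1,2,3,5,7,0,0,8,0,0,0,4,6,0,0], 13902672388465458093160, 0),
  ([1,2,4,5,7,0,8,0,0,0,0,3,6,0,0], 16742593939959498052792, 0),
  ([1,2,4,0,5,6,0,0,7,0,8,0,3,0,0], 0, 13786503882580316430112),
  ([1,2,7,0,4,0,5,0,6,0,3,0,8,0,0], 13647368022655856227856, 0),
  ([1,2,8,0,7,0,6,0,4,0,3,0,0,5,0], 0, 13611883766559093504200),
  ([1,2,8,0,4,0,6,0,0,3,5,0,7,0,0], 0, 13602221384582443340160),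
  ([1,2,3,7,0,0,8,0,6,0,5,0,4,0,0], 15696233267394769069248, 0),
  ([1,2,4,5,7,0,0,0,6,0,8,0,3,0,0], 0, 13548174152807916509464),
  ([1,4,6,0,7,0,8,0,0,2,0,3,0,5,0], 0, 13351257966066426309512),
  ([1,2,5,0,7,0,4,0,3,6,0,8,0,0,0], 0, 13347505632807619835456),
  ([1,2,4,0,5,7,0,0,8,0,3,0,0,6,0], 0, 12977633705916053892200),
  ([1,2,3,0,4,5,6,0,7,0,0,0,8,0,0], 13362121626061364264096, 0),
  ([1,2,3,4,0,0,6,0,7,0,8,0,5,0,0], 0, 13254677542373092163136),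
  ([1,2,6,0,5,0,4,0,3,0,7,0,8,0,0], 15578933843664645067064, 0),
  ([1,2,3,4,6,0,0,0,5,7,0,0,8,0,0], 12971014022093691021200, 0),
  ([1,2,3,4,0,0,5,6,0,0,7,0,8,0,0], 12684255560172120835248, 0),
  ([1,2,3,8,0,6,0,0,4,0,7,0,0,5,0], 0, 12620102195416966344344),
  ([1,2,3,4,0,0,5,0,6,7,0,0,8,0,0], 21165474917214200964392, 0),
  ([1,2,3,7,0,4,0,5,0,6,0,0,8,0,0], 0, 17406616310712911654672),
  ([1,2,7,0,6,0,8,0,3,0,5,0,0,4,0], 12248696953449035479000, 0),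
  ([1,2,3,4,6,0,8,0,0,0,0,5,7,0,0], 15980029859723141379792, 0),
  ([1,2,4,0,6,0,7,0,8,0,3,5,0,0,0], 0, 9662698315237789957096),
  ([1,2,4,5,7,0,0,8,0,0,0,3,6,0,0], 8872846993129570584672, 0),
  ([1,2,3,8,0,7,0,6,0,4,0,0,0,5,0], 5793970324001903671336, 0),
  ([1,4,6,0,7,0,8,0,0,5,0,3,0,2,0], 11559023656620744300488, 0),
  ([1,8,0,5,0,3,7,0,0,2,6,0,0,4,0], 0, 11468591739638693085896),
  ([1,2,3,4,7,0,6,0,5,0,0,0,8,0,0], 0, 17382213266401337467064),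
  ([1,2,3,4,5,7,0,0,0,6,0,0,8,0,0], 12498250588532685553640, 0),
  ([1,2,8,0,7,0,3,0,6,0,5,0,4,0,0], 0, 9079371751944421320144),
  ([1,6,8,0,0,3,5,0,7,0,0,4,0,2,0], 3688644519893921599448, 0),
  ([1,2,4,6,0,8,0,0,0,3,5,7,0,0,0], 5513377374660042409504, 0),
  ([1,2,4,0,5,0,7,0,3,0,6,8,0,0,0], 0, 10939111580932831503072),
  ([1,2,3,6,0,5,7,0,8,0,0,0,0,4,0], 10915603052835455705840, 0),
  ([1,2,4,0,6,0,8,0,0,3,0,5,0,7,0], 0, 5431816258104236784984),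
  ([1,2,8,0,7,0,4,6,0,0,3,0,0,5,0], 10806598140429896568000, 0),
  ([1,2,6,0,4,8,0,0,3,7,0,0,5,0,0], 5397818820408033898272, 0),
  ([1,3,5,7,0,0,8,0,0,2,0,4,0,6,0], 0, 10601411617543354891528),
  ([1,2,4,0,5,0,6,7,0,0,8,0,3,0,0], 0, 2434304000134240728504),
  ([1,2,3,0,4,5,0,6,7,0,0,0,8,0,0], 10693890795951998343944, 0),
  ([1,2,8,0,4,0,5,0,7,0,3,0,0,6,0], 10435097620876060622440, 0),
  ([1,2,3,4,0,5,0,0,6,7,0,0,8,0,0], 1804546935239559152176, 0),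
  ([1,2,7,0,3,0,4,8,0,5,0,6,0,0,0], 10325106418286378627088, 0),
  ([1,2,5,8,0,0,3,0,7,0,6,0,4,0,0], 10113887005497834768032, 0),
  ([1,2,8,0,7,0,5,6,0,0,4,0,3,0,0], 0, 10752039782041524126112),
  ([1,2,3,5,0,0,6,0,7,0,4,0,8,0,0], 0, 9926196105399431148720),
  ([1,2,3,5,0,0,7,0,8,0,0,6,0,4,0], 0, 9856076962694768431928),
  ([1,2,4,7,0,8,0,0,6,0,5,0,3,0,0], 9810733342066757079528, 0),
  ([1,2,6,0,7,0,8,0,5,0,3,4,0,0,0], 9782458313208289049592, 0),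
  ([1,2,8,0,7,0,6,0,4,5,0,0,3,0,0], 0, 4599402878829214996280),
  ([1,2,4,0,5,0,6,7,0,0,3,0,8,0,0], 0, 17268259725087546854832),
  ([1,2,4,0,5,0,7,0,8,0,3,6,0,0,0], 0, 8931698043587484050616),
  ([1,2,4,5,6,0,0,0,7,0,8,0,3,0,0], 0, 8903808675256429165584),
  ([1,2,8,0,7,0,3,0,4,0,5,0,0,6,0], 4389363230872152391608, 0),
  ([1,2,5,0,3,0,4,0,6,7,0,0,8,0,0], 0, 17289646160227059623032),
  ([1,2,7,0,3,0,6,0,5,0,4,0,8,0,0], 8661956173105443435376, 0),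
  ([1,3,5,0,7,0,8,0,0,6,0,4,0,2,0], 8637635343733044584232, 0),
  ([1,2,7,0,6,0,4,5,0,0,3,0,8,0,0], 5119958177373653026400, 0),
  ([1,2,3,5,8,0,0,0,6,0,0,4,7,0,0], 4288499219306125774272, 0),
  ([1,2,7,0,4,0,5,0,6,0,8,0,3,0,0], 8561024131115835210488, 0),
  ([1,2,5,0,8,0,7,0,6,0,4,0,3,0,0], 0, 711803892564823169472),
  ([1,2,3,5,7,0,0,0,4,8,0,0,0,6,0], 8543706978323948837216, 0),
  ([1,2,4,0,8,0,5,0,6,0,0,3,7,0,0], 0, 8405309870546013942520),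
  ([1,2,3,5,0,0,6,0,7,0,8,0,4,0,0], 0, 7080756975834907458848),
  ([1,2,8,0,6,7,0,0,5,0,3,4,0,0,0], 7733953466122469156544, 0),
  ([1,2,4,0,3,5,0,7,0,0,6,8,0,0,0], 8101123658149324283248, 0),
  ([1,2,6,0,3,0,7,0,4,0,8,0,5,0,0], 8087354631760781995696, 0),
  ([1,2,7,0,6,0,4,0,8,0,3,0,0,5,0], 4027914149503333369720, 0),
  ([1,2,5,0,8,0,4,0,6,0,7,0,3,0,0], 7989179847681535038240, 0),
  ([1,2,4,0,8,0,7,0,5,0,3,0,0,6,0], 7972332899638380239496, 0),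
  ([1,2,3,0,4,0,6,0,7,0,5,0,8,0,0], 0, 7958322082764538683824),
  ([1,2,3,7,0,4,0,5,0,0,6,0,8,0,0], 0, 5996459589381930691240),
  ([1,2,7,0,6,0,3,0,4,0,5,0,8,0,0], 7803339240177566826072, 0),
  ([1,2,3,4,6,0,8,0,0,0,0,5,0,7,0], 3896287411213141270632, 0),
  ([1,2,8,0,3,0,7,0,5,0,4,0,0,6,0], 7777928271796659334472, 0),
  ([1,2,5,7,0,0,3,0,4,0,6,0,8,0,0], 0, 7756639560098251551184),
  ([1,2,4,0,5,6,8,0,0,0,7,0,3,0,0], 0, 7755165298683034905952),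
  ([1,2,6,7,0,8,0,0,5,0,4,0,3,0,0], 7655757047817450397640, 0),
  ([1,2,4,0,8,0,7,0,6,0,3,5,0,0,0], 7489413386873080536176, 0),
  ([1,2,3,4,6,0,0,0,5,7,0,8,0,0,0], 11919467277236883122464, 0),
  ([1,2,3,4,5,6,0,7,0,0,0,0,8,0,0], 9599765119533682202632, 0),
  ([1,2,3,4,0,5,6,0,0,7,0,0,8,0,0], 11277052273673407729272, 0),
  ([1,2,5,7,0,0,8,0,3,0,0,4,6,0,0], 0, 7329702272467709845120),
  ([1,2,3,5,7,0,0,6,8,0,0,0,0,4,0], 7225336361330862464912, 0),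
  ([1,2,3,5,0,4,6,0,7,0,0,0,8,0,0], 12432466408461454283728, 0),
  ([1,2,7,0,5,0,8,0,3,0,6,0,0,4,0], 7208194221407207868656, 0),
  ([1,2,8,0,4,0,7,0,6,0,0,3,0,5,0], 7179624474676983478280, 0),
  ([1,2,7,0,5,6,0,0,4,0,3,0,8,0,0], 7145910698045998907688, 0),
  ([1,2,6,0,5,0,4,0,7,0,3,0,8,0,0], 8958643639257512417616, 0),
  ([1,2,8,0,4,6,0,7,0,0,5,0,3,0,0], 7022178393827430594536, 0),
  ([1,2,6,0,5,0,3,0,7,0,4,0,8,0,0], 6905962145918774958848, 0),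
  ([1,4,7,0,0,3,8,0,0,2,6,0,0,5,0], 3426652669169759216104, 0),
  ([1,2,4,7,0,0,6,0,8,0,3,5,0,0,0], 0, 6770389717595172508000),
  ([1,2,4,6,0,0,5,7,0,0,8,0,3,0,0], 0, 6689306446618025880624),
  ([1,2,6,0,5,8,0,7,0,0,3,0,4,0,0], 0, 6648350297586869022976),
  ([1,2,4,0,5,6,0,0,7,0,3,0,8,0,0], 0, 6647013891267061577304),
  ([1,2,8,0,7,0,3,5,0,6,0,0,4,0,0], 6642712991298926606544, 0),
  ([1,2,6,0,3,0,7,0,5,0,4,0,8,0,0], 6613706630488645721320, 0),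
  ([1,2,3,0,4,0,6,0,7,0,8,0,5,0,0], 0, 6590116807755454544584),
  ([1,2,4,0,6,0,5,7,0,8,0,0,3,0,0], 0, 4566372534522292682384),
  ([1,2,4,6,0,5,7,0,8,0,0,0,0,3,0], 11598975582200498948232, 0),
  ([1,2,8,0,6,0,3,0,7,0,5,0,4,0,0], 0, 6367463916870262927480),
  ([1,2,3,0,4,7,0,5,0,6,0,0,8,0,0], 0, 6300181734887240085848),
  ([1,2,4,0,5,0,6,0,7,0,3,0,8,0,0], 0, 6266257723626438906512),
  ([1,2,5,0,6,7,0,0,3,0,4,8,0,0,0], 0, 6188055265513833451264),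
  ([1,2,7,0,3,0,4,5,0,0,6,0,8,0,0], 0, 9329389835297093660936),
  ([1,2,3,7,0,0,4,6,0,8,0,5,0,0,0], 0, 9274581513721383111064),
  ([1,2,5,0,6,0,7,0,4,0,3,0,8,0,0], 5808357760229088864552, 0),
  ([1,2,8,0,6,0,4,5,7,0,0,0,3,0,0], 5806946909808329026912, 0),
  ([1,2,7,0,3,0,5,0,6,0,8,0,4,0,0], 5671397309488169030440, 0),
  ([1,2,4,6,0,0,7,0,8,0,0,5,0,3,0], 0, 5561805951609714817408),
  ([1,2,3,5,0,7,0,0,6,0,4,0,8,0,0], 0, 5527617028289094247744),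
  ([1,2,3,4,0,0,5,6,7,0,0,0,8,0,0], 1842216033506741255792, 0),
  ([1,2,4,0,6,0,7,0,8,0,5,0,3,0,0], 6978518515069806432144, 0),
  ([1,2,3,4,6,0,0,0,5,8,0,0,0,7,0], 5455641865962210356032, 0),
  ([1,2,8,0,7,0,6,0,3,4,5,0,0,0,0], 5407317669771207494936, 0),
  ([1,2,3,0,4,5,0,0,6,7,0,0,8,0,0], 5404081184408841977168, 0),
  ([1,2,8,0,4,0,6,0,7,0,0,5,0,3,0], 5374885655611144308008, 0),
  ([1,2,6,8,0,0,4,0,0,3,0,5,0,7,0], 0, 5336963798015746381352),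
  ([1,2,3,4,6,0,7,0,0,0,5,8,0,0,0], 3949974381327800972592, 0),
  ([1,2,8,0,3,0,7,0,4,0,6,0,0,5,0], 5204026859766795667648, 0),
  ([1,2,4,8,0,5,0,6,0,7,0,0,0,3,0], 0, 12768366980813726826216),
  ([1,2,6,0,7,0,8,0,3,4,0,5,0,0,0], 0, 5047726021447439641656),
  ([1,2,3,4,6,0,8,0,0,0,5,0,0,7,0], 6986439931284635937072, 0),
  ([1,3,7,0,4,6,0,8,0,0,0,5,0,2,0], 0, 4980247417684856707032),
  ([1,2,4,0,5,0,6,7,8,0,0,0,3,0,0], 0, 4968553171704848730808),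
  ([1,2,6,0,5,8,0,7,0,0,4,0,0,3,0], 0, 4964495783023527216824),
  ([1,2,8,0,7,0,4,5,0,6,0,0,3,0,0], 10080320334326766843352, 0),
  ([1,2,7,0,6,0,5,0,4,0,8,0,3,0,0], 0, 4909682674011423126024),
  ([1,2,5,0,3,0,4,0,6,0,7,0,8,0,0], 0, 4900106059961814698584),
  ([1,2,7,8,0,0,6,0,4,5,0,0,3,0,0], 4826792479824860409272, 0),
  ([1,2,6,0,7,0,8,0,4,0,3,0,0,5,0], 4689122154521151009448, 0),
  ([1,2,6,0,3,0,4,0,5,7,0,8,0,0,0], 0, 12811835468204967281912),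
  ([1,2,5,0,8,0,7,0,6,0,3,4,0,0,0], 12483758097855838684256, 0),
  ([1,2,3,0,4,0,7,0,6,0,5,0,8,0,0], 0, 2293901791012650140800),
  ([1,2,8,0,7,0,4,0,5,0,6,0,3,0,0], 0, 9727294822141842861568),
  ([1,2,3,5,0,7,0,8,0,0,6,0,4,0,0], 0, 4527445210937538600648),
  ([1,2,4,7,0,8,0,0,5,0,3,0,0,6,0], 0, 4523808729288054638048),
  ([1,2,3,5,0,0,4,6,0,7,0,0,8,0,0], 4491812251287245163568, 0),
  ([1,2,8,0,7,0,6,0,5,0,3,4,0,0,0], 0, 4477203220615802561472),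
  ([1,2,5,0,7,0,3,0,4,6,0,8,0,0,0], 0, 4458259461841718989632),
  ([1,2,5,0,4,0,3,0,6,0,7,8,0,0,0], 0, 8380752451633298947856),
  ([1,2,8,0,7,0,5,0,3,4,6,0,0,0,0], 4359531050006001844752, 0),
  ([1,2,6,8,0,0,3,0,4,7,0,0,0,5,0], 0, 4350213783923571228080),
  ([1,2,5,0,7,0,8,0,6,0,3,0,0,4,0], 1590864947327058958360, 0),
  ([1,2,4,7,0,0,5,0,8,0,3,6,0,0,0], 0, 4302491562624573782304),
  ([1,2,3,5,0,6,0,0,4,7,0,8,0,0,0], 2539228923234802477024, 0),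
  ([1,2,3,7,0,5,8,0,6,0,0,0,4,0,0], 4030827555001731892032, 0),
  ([1,2,4,0,5,7,0,0,8,0,0,6,0,3,0], 0, 3974631367943113865152),
  ([1,2,3,7,0,0,5,6,0,0,8,0,4,0,0], 0, 3970720219509913412208),
  ([1,2,3,5,6,8,0,0,0,7,0,0,0,4,0], 3924190852824963527352, 0),
  ([1,2,3,6,0,7,8,0,0,0,5,0,4,0,0], 0, 3902755830563608455960),
  ([1,2,3,0,5,6,0,0,7,0,8,0,4,0,0], 0, 3874360365977336637440),
  ([1,2,3,5,0,6,0,0,7,0,8,0,4,0,0], 0, 4933762398222708826776),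
  ([1,2,3,4,5,7,0,0,0,0,6,0,8,0,0], 3788729920439555441280, 0),
  ([1,2,3,6,0,0,7,0,4,0,5,0,8,0,0], 0, 3726256096296414788856),
  ([1,2,3,6,0,4,0,5,0,7,0,0,8,0,0], 0, 7239134419756966864648),
  ([1,2,3,4,7,0,0,0,5,8,0,0,0,6,0], 3656066359278695284712, 0),
  ([1,2,7,0,3,0,8,0,6,0,4,0,0,5,0], 3625827638393504833832, 0),
  ([1,2,6,7,8,0,0,0,3,0,4,0,5,0,0], 0, 3604589978290032148704),
  ([1,2,3,5,7,0,8,0,0,0,0,4,0,6,0], 3561754565702797852840, 0),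
  ([1,2,3,5,0,0,6,0,4,7,0,8,0,0,0], 5106786655021608890184, 0),
  ([1,2,3,4,7,0,0,0,5,6,8,0,0,0,0], 3532768448285275666880, 0),
  ([1,2,7,0,5,0,4,0,8,0,3,0,0,6,0], 4238774231838951902616, 0),
  ([1,2,8,0,5,0,6,0,7,0,0,4,0,3,0], 11256944134327984655064, 0),
  ([1,2,6,8,0,0,7,0,3,0,4,0,5,0,0], 3370285407773606631032, 0),
  ([1,2,8,0,5,7,0,0,4,0,0,6,0,3,0], 3341340188563047281776, 0),
  ([1,2,8,0,5,6,7,0,0,0,4,0,3,0,0], 3333003446409682207184, 0),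
  ([1,2,4,0,5,0,6,0,3,0,7,0,8,0,0], 0, 4023166934085104156000),
  ([1,2,8,0,4,0,3,5,0,6,0,0,0,7,0], 0, 3328688657468687910216),
  ([1,2,4,0,6,0,7,0,3,5,0,0,8,0,0], 0, 3978896362942210446224),
  ([1,2,4,0,5,0,7,0,8,0,3,0,0,6,0], 0, 3607559941753586332240),
  ([1,2,3,0,7,0,6,0,5,0,8,0,4,0,0], 3254026546987418573768, 0),
  ([1,3,7,0,5,0,8,0,6,0,0,2,0,4,0], 3143571017933533459464, 0),
  ([1,2,5,0,8,0,7,0,4,0,3,0,0,6,0], 453150766322944399296, 0),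
  ([1,2,8,0,3,0,7,0,6,0,5,0,4,0,0], 0, 5139083080914538895848),
  ([1,2,4,0,6,0,7,0,8,0,0,3,0,5,0], 0, 7073095932784760529864),
  ([1,2,4,7,0,6,0,0,5,0,3,8,0,0,0], 0, 2821399154539428218616),
  ([1,2,3,7,0,4,0,6,0,0,5,8,0,0,0], 0, 4175282470583713627544),
  ([1,2,5,0,6,0,3,7,0,4,0,0,8,0,0], 2815531282840630101128, 0),
  ([1,2,3,4,6,0,7,0,0,8,0,0,0,5,0], 2745986806254224247752, 0),
  ([1,2,5,7,0,8,0,0,3,0,4,0,0,6,0], 0, 2714293333092253703152),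
  ([1,2,7,0,4,0,8,0,6,0,5,0,3,0,0], 0, 2620004745600034183120),
  ([1,5,7,0,8,0,0,3,0,4,0,6,0,2,0], 2607848000729055190592, 0),
  ([1,2,3,5,0,4,6,0,8,0,0,0,0,7,0], 2597861290425723901336, 0),
  ([1,2,6,8,0,0,4,0,5,0,0,3,7,0,0], 0, 2549193032518076485800),
  ([1,2,3,5,0,0,7,0,4,0,6,0,8,0,0], 0, 2510527767858851315512),
  ([1,2,4,0,5,0,3,0,6,0,7,0,8,0,0], 0, 2488556813844129446296),
  ([1,2,3,4,5,7,0,0,6,0,0,0,8,0,0], 3413476038921902359848, 0),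
  ([1,2,3,7,0,0,4,8,0,6,0,5,0,0,0], 0, 2428821095284773836120),
  ([1,2,5,6,0,7,0,0,3,0,4,0,8,0,0], 0, 1182611701517234863056),
  ([1,2,5,0,6,7,0,0,3,8,0,4,0,0,0], 2363425378860665200960, 0),
  ([1,2,4,7,0,8,0,0,6,0,0,3,0,5,0], 0, 2279193351815745522848),
  ([1,2,7,0,3,0,4,0,5,6,8,0,0,0,0], 0, 2171030807522060422760),
  ([1,3,7,0,5,0,6,0,8,0,0,4,0,2,0], 2152770478284693938752, 0),
  ([1,2,5,7,0,0,6,0,3,8,0,0,0,4,0], 3999763847080991562488, 0),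
  ([1,2,4,0,7,0,6,0,5,0,3,0,8,0,0], 2123810379878913616568, 0),
  ([1,2,3,5,0,7,0,0,4,6,0,8,0,0,0], 2086433437022936621640, 0),
  ([1,2,8,0,4,0,6,0,0,3,5,7,0,0,0], 0, 1991623089141360523808),
  ([1,5,7,0,8,0,0,4,6,0,0,3,0,2,0], 1950147915013629580208, 0),
  ([1,2,3,4,6,0,0,7,0,0,5,8,0,0,0], 3301832030542355325416, 0),
  ([1,2,6,0,3,0,5,0,4,7,0,0,8,0,0], 0, 4646945849860921728264),
  ([1,2,6,0,5,0,3,0,7,0,8,0,4,0,0], 2993957309629023552456, 0),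
  ([1,2,4,7,0,8,0,6,0,0,0,3,5,0,0], 0, 1858566154437266553328),
  ([1,5,7,0,8,0,0,3,0,6,0,2,0,4,0], 1730916476603245677776, 0),
  ([1,2,8,0,6,7,0,0,5,0,4,0,3,0,0], 0, 2176754443917666434184),
  ([1,2,3,5,0,7,0,0,8,0,0,6,0,4,0], 0, 1590219071190069106048),
  ([1,2,6,0,4,7,0,5,0,0,3,8,0,0,0], 1581402898149657923152, 0),
  ([1,5,7,0,8,0,0,4,0,3,0,2,0,6,0], 1571504269948435168016, 0),
  ([1,2,4,5,7,0,0,0,3,6,0,8,0,0,0], 1504672173228550344264, 0),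
  ([1,2,4,5,6,8,0,0,0,7,0,0,0,3,0], 3369543691287554722624, 0),
  ([1,2,3,6,0,0,7,0,8,0,4,0,0,5,0], 0, 1463293472745066813032),
  ([1,2,5,0,7,0,8,0,3,0,6,0,4,0,0], 1441245670696410080896, 0),
  ([1,2,7,0,6,0,3,4,0,0,8,0,5,0,0], 1425285453985205554216, 0),
  ([1,2,6,0,4,0,3,0,7,0,8,0,5,0,0], 1296583047513504001760, 0),
  ([1,2,7,0,6,0,8,0,3,0,4,0,5,0,0], 1290608466048245082584, 0),
  ([1,2,3,5,0,7,0,8,0,0,0,4,6,0,0], 1925140706521954023784, 0),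
  ([1,2,7,0,4,0,8,0,5,0,3,0,0,6,0], 1194422824601075487384, 0),
  ([1,2,8,0,6,7,0,0,4,5,0,0,3,0,0], 1173181775065635501776, 0),
  ([1,2,3,6,0,0,5,0,7,0,4,0,8,0,0], 0, 1161569761235005578648),
  ([1,2,8,0,7,0,3,6,0,0,4,0,0,5,0], 1093452027253478778032, 0),
  ([1,2,7,0,3,0,5,0,4,6,0,8,0,0,0], 0, 1093370625887361740024),
  ([1,2,5,0,3,6,0,8,0,0,0,4,7,0,0], 1080698764194304946752, 0),
  ([1,2,8,0,5,7,0,0,0,3,0,4,6,0,0], 0, 922458613101502301752),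
  ([1,2,5,0,6,0,7,0,8,0,4,0,3,0,0], 913350395512978708584, 0),
  ([1,2,8,0,4,0,7,0,3,0,5,0,0,6,0], 912804965847258594752, 0),
  ([1,3,7,0,5,8,0,0,0,2,0,4,6,0,0], 0, 838046203101892203576),
  ([1,2,4,0,8,0,7,0,6,0,5,0,3,0,0], 0, 827626505860432137288),
  ([1,2,8,0,4,6,0,7,0,0,0,3,0,5,0], 0, 750136319792897279192),
  ([1,2,7,0,5,6,0,0,3,0,8,0,4,0,0], 720957208300648385656, 0),
  ([1,2,4,5,0,6,0,0,7,0,8,0,3,0,0], 0, 668593955198874111104),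
  ([1,2,5,0,6,0,8,0,4,0,7,0,3,0,0], 1352570283777842676928, 0),
  ([1,2,5,0,7,0,8,0,4,0,0,6,0,3,0], 602920547696755309736, 0),
  ([1,2,6,0,8,0,7,0,3,0,5,0,0,4,0], 595041601475494165232, 0),
  ([1,2,6,0,5,7,0,8,0,0,0,4,0,3,0], 0, 567722502060828588896),
  ([1,2,3,5,7,0,8,0,0,0,0,4,6,0,0], 548543167737381099304, 0),
  ([1,2,4,6,0,0,7,0,3,0,8,0,0,5,0], 0, 526863284808653638840),
  ([1,2,7,0,6,0,3,0,8,0,4,0,0,5,0], 245121055143293912768, 0),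
  ([1,2,3,8,0,7,0,0,6,0,5,0,4,0,0], 455357943457380700296, 0),
  ([1,2,3,7,0,5,0,6,0,0,4,8,0,0,0], 0, 452412918292785024856),
  ([1,6,8,0,0,2,7,0,4,0,0,3,0,5,0], 437793936078748189888, 0),
  ([1,4,8,0,0,3,7,0,0,2,6,0,0,5,0], 408658798256204730576, 0),
  ([1,2,7,0,5,0,4,0,8,0,0,6,0,3,0], 326992320553149645160, 0),
  ([1,3,5,0,8,0,7,0,6,0,0,2,0,4,0], 298282170858740398776, 0),
  ([1,2,7,0,3,0,8,0,6,0,4,5,0,0,0], 272563685566838223320, 0),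
  ([1,2,3,7,0,0,6,0,8,0,5,0,4,0,0], 186838206526137764136, 0),
  ([1,2,3,5,0,0,4,6,0,0,7,8,0,0,0], 171986457140448351264, 0),
  ([1,2,6,0,7,0,8,0,5,0,3,0,0,4,0], 167460431760794908352, 0),
  ([1,2,8,0,4,0,6,0,0,5,0,3,0,7,0], 145958245891454880304, 0),
  ([1,2,3,0,4,6,0,7,0,5,0,0,8,0,0], 0, 326369892902122767160),
  ([1,2,3,5,0,0,4,7,0,0,6,8,0,0,0], 108760160158913108464, 0),
  ([1,2,4,0,6,0,8,0,3,5,0,0,0,7,0], 0, 99426171851613235232),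
  ([1,2,6,0,3,0,4,0,5,0,7,0,8,0,0], 0, 132338126480342638824),
  ([1,2,7,0,3,0,4,5,6,8,0,0,0,0,0], 0, 24178716157570944144),
  ([1,2,3,0,4,6,0,0,7,0,8,0,5,0,0], 0, 22540323477238606384)]

/-- An optimal functional for eight variables: its values on the words which start with the first
variable, multiplied by `138248167626314240950` and increased by `138248167626314240950`. -/
def tableEight : List ℕ := [
  0x77e9427fc671e53b677e9427fc671e53b6eb07f5484d284379adb71c2df5c0ece84aefd284ff8ce3ca76c77e9427fc671e53b69d56f8481f9ffd824d846557eb4eac2a7befd284ff8ce3ca76cedf6137ea0f392439de342eb9feecbfb2ee0ffb6dfb54259d9fedf6137ea0f392439efd284ff8ce3ca76cdb71c2df5c0ece84a9d56f8481f9ffd82477e9427fc671e53b6efd284ff8ce3ca76cd846557eb4eac2a7bef2720c42c42acf5877e9427fc671e53b677e9427fc671e53b60000000000000000077e9427fc671e53b68d06aa20da6c214b5aa207ab486c471a9bdcca5053f1c0d3eb9c47b0f7785240a8a57ec9052c7f04b1bd4db9bc0f778ed52490cff366c9ca7a2678eefd284ff8ce3ca76cefd284ff8ce3ca76cefd284f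f8ce3ca76c9324058b7df627041d5662a0e8249c3a2dc3a53db856dd043c1e67df1dcd786aa5a7a1dbd405b36af7d19d7e0bc45b0f79de89710f41943fc29f64defd284ff8ce3ca76cbdbcf519f2ddb0f18da40b599d0bfb3d2b6257731a0a4dce97577e9427fc671e53b600000000000000000dab51d5e78e98e66dd47ae072b110e6bc3e11f58b0efcb1f3c287bfec31b7d7c3eadcfffa8ab5218f99f3664aec3a387ada778efd284ff8ce3ca76c86cc6d35129379a0be0ffb6dfb54259d9f908a99c150cd48dd0abc55ccd08518aa5b33dc1a4d41dfa56a5a0d96c5d18b12eafd50e6c6a86e8d43d0b7a8ffd8c0908335f658d8e1df38122ab6a731eb2c886b65e3e400000000000000000c9a122bb40174ab7c9b90586d4ca55470077e9427fc671e53b637b1b7e218bb1e266731eb2c886b65e3e400000000000000000efd284ff8ce3ca76c95db8989a3dee4452de5050a4b85a416cd738b63d0dad78637b5134810e50dc374631304a257f4bcc9036ddd241faf42c9863265e8ff7b2dbab327c7a8ffd8c0908335f65f47eb3e3c168199ca7194417e146c3e132f3001981ad4dea5d6fd9cba6ad4e289c300d6c55174ca8338502a6bb0c42964e2400000000000000000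05ebdf0a855e1624c2000000000000000007b09698e61a38ffc16d07119a67d88d29f77e9427fc671e53b6554de5f0a554ecdc04e155964f655ef0b8414192d6a81a6b44cefd284ff8ce3ca76c9f5102ec6251dca099bb2ae43a531e39234a7786ed27226f111624740a05eb23a002000000000000000009546690cf10d75af545fc7e781b6b0e33d6257731a0a4dce9751461b287a537704e330c7782dcfb0da0760ae3214cd2fbcc6d86225293b7c4d558e526a19dd46441c1a3d000000000000000000e7cc9521efd41d284e155964f655ef0b8414192d6a81a6b44c0320270e9b31aac0b000000000000000000000000000000000040ed23d0747ff0e9e39b49744c580f3196a4ca13363db7548e0,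
  0x17c2a05073f75ae879656c84cdb15ae9e6a18a3b0b2c8a0b78e201e630793a85f2edc84b4ab91d785469efd284ff8ce3ca76c5fd6f036d4dea7b099bfb314cb665b71f49ff83441e44bf569bd4fbd5c782e6cb748bce8417e7f1759367b66bdae5636bef5d6990a985a687e3c1f8ccc9aa749a52c6239efd284ff8ce3ca76cd14fdc6723b97fb659bc71eb4b653853208d25ac018f1c247f0edf6a100b9d341965d507c0fdd95907229c6ac6b910c30b2a476c5b283b0543e7fa370c722d9a71c57193153c6981c8aa3f43a5c250ef79de448ebb97a94bb8a963aa5eab0b535894c32f25d7de5906a74f181a49bc874eb3785e943fa6ac7ba565cc36c5caa9e544fce39b2e1b129ddf4def211996e8befd284ff8ce3ca76cefd284ff8ce3ca76ca7d92cfeca957a98189945a4f5615f1f6aba841d44444943c86a3994b3ada60bfd4defd284ff8ce3ca76cd547001c924f0a415925212f800f2024da7bb842d786a381f7b9ccf22290832d4627ca3a737f2b9fdc891937e4eb5dad1c585c4fbd6d84bec7532615d8093021a22e4dbe19f725960cae5127fb6de852710fbb8c8e9ddcde8543c954489da712904f2e178cdbc531b72731a1c07a2b4d179aecd65f67eb6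a14daf9b4a797e3cefd284ff8ce3ca76c77e9427fc671e53b6ef968f700209c71fbd52c37de057e66f8ed5682d6d90586a4ff5d7eeaedc9e6851499b3ff0ce1d7da1e9293ee642b2044ebe429b3ff0ce1d7da1e92790c32fec8a7000408c4a049ff746e12d8710f41943fc29f64dc7e8cf2a21a18ed04ab0895251eb3ea8f3e59f3edced426b3c6a31ce2f10116581fc663c0da601fa01b092f3001981ad4dea5dda8c447c281d704f0ace8735e25384862cd8b03e8ad55a03c0898d47052d9ba23cb5bc913159ebad6d729595f98151627634ddda8c447c281d704f062a301fc61ab8b13a9b3ff0ce1d7da1e92752c3fa93f76d164991e06815d3203663519f725960cae5127f9b3ff0ce1d7da1e92241a0dee10d261a102356ae4e570bbcadc0122f07f02351ac8a77e9427fc671e53b600000000000000000e9e84754a12659066c651728fb7faa088ae22ec03547918d1db74454f6bbf8e488617085e706dc703ef310ae3214cd2fbcc6d877e9427fc671e53b690c9ee8b8872737dc866ec3ab5307dba046d0aee67fe3c59cb2778b2b38b0dc41f2177e9427fc671e53b6813a15f2f3d2f41819b52597d0ac308b527663c6340788502e97dc3e0a691c9ec66c861d5332bf08d488b74454f6bb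f8e48861776913d3ce775d8045e78efe78d85b44fd77e9427fc671e53b677def7710b8fbdeb16221ac7ef39070a2c554de5f0a554ecdc07b09698e61a38ffc176b1ab0171825ee0b77e9427fc671e53b654f976ea71ba728124dc0ea5ec2bb74b0a40ed23d0747ff0e9e,
  0x77e9427fc671e53b64b5c0c086d3801891be85d4585fdc36e15a38f99f66cb559d45d911593b5a70f716c587a2a564d19081f6b7d23dfe8285717439fbb1d5c0b9d8dee0c790944e47a1c30eda20132658e82ec384d50091451518b68e68d1048563377d331aca5aa383f0696fb3ee176a6a7b7b689dd0cda27dc5da1b7f9dda890291c16e824cfdc4896eedd09aa2ff98750f5f393f1f2a6a9535687e6548d2205d96c84f7e4829c80b9f4c254848fb8b741852c7bc54645a2d2971deab714b395da264356df99c0ad04ac2a2aef341f6196e00fb1d0c67049d2165dbefd284ff8ce3ca76cd8b9f4121ab71c69ed7415627fbde4e903889fc3b772990c8c7ab1687f82891558869d987ab0801531655d7312dbe028866d52c85e5f9e2ae6f6385c5c20b7dfdbe5d70f6ebac58deec7a7878a667092bdce823a8ecfd253b4234282786c9d159312e675b10a7af147edfa3b7750d89945a4f5615f1f6ab4a01c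c69318203b3cc7d02a649a116a9ac0e6d9d26ef25cad1bd8b478dd9cf73e18a188609fa9d3ed7735d7eeaedc9e68514994c6aa07053e7b7deb73d6e47bb36c479defd284ff8ce3ca76ce9ea9b99f6957a06bc9f6dc23af43d7ab6ad19749c70774168eefd284ff8ce3ca76c9e6db67f25f2bc724efd284ff8ce3ca76cea8bbff16df48c619efd284ff8ce3ca76c77e9427fc671e53b6a7f9deac72c82b657d00e3019773400cc0e0ef5a4a40c236117d333a6695255c055486cc6d35129379a0b9324058b7df627041bb242c478dc67c5979ebeab1421bb96479dc863d14b40a74a57abc55ccd08518aa5b84e23f93a25a1d0ce33dc1a4d41dfa56a562a301fc61ab8b13a97cb0bbd113e0c52d7fd75cab9d47d909e9369c7c32b5c0b1f0e42c1bba3dadfbf39b6c0ca641a40f3ccf77c0699d75a5c723977c0699d75a5c72399b3ff0ce1d7da1e928be226f7633018ddf6a457db5811fa7e254fbd6d84bec7532619b3ff0ce1d7da1e92867181081b20303859b3ff0ce1d7da1e92790c32fec8a7000407774dabb1e480aa746257731a0a4dce975e9e84754a12659066cfd003ca8a3644695e22ec03547918d1db7dc3e0a691c9ec66c7a047841ae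abe2d3c1461b287a537704e377e9427fc671e53b68443b0910895a176dac6187a35c3223922857ef0a9c30b885ae71ff04d4dab473cb08aede4d7bb2eae3ecadf6ac82bb3637802abcb1cddbdf56a05f7f0d0afac5e0db0fcc5c20b7dfdbe5d70fead14f261bfb2ef30a31ce2f10116581fc840e8f15fe077986e4cbd40a2de3ef24967a8ffd8c0908335f677e9427fc671e53b686c1ae8a016bff4a137b1b7e218bb1e266e9e84754a12659066d1079b48df25cac40e22ec03547918d1db77def7710b8fbdeb1741f8f0c2871b45810e7cc9521efd41d28,
  0x15c2ed6204b460e736fd5b9cd3ba8b5a6658ab61ff4d13ea080aeb20e8e24f1fca87a22411c1ee665d5b4ded249736eed3ed172cf30c77b05e757aba0013a81abbeb9e7c59b7ea6042654222d77e9427fc671e53b6724924f126b8ad6cea5556b7bae749b025696bffd83e33474b49bf9a801a37f52f5f914cfeb4b1bf22c697e7b0c07a50df406f600506c1c046605848d11024b55c3a5ac48adb9148eb6046854c4aa36e0a97222a15b0c495be9f13ae0109cff6bac08dc96615985c05972e308c10b77e9427fc671e53b60ee32ab54c219465586cc6d35129379a0b66e906f3a87b59961ded249736eed3ed17efd284f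f8ce3ca76cded249736eed3ed175f63f22be63716e87bb889a793cad8c1426d74cd5ac452dada29926f17107037e5d19926f17107037e5d1aa9613b10bcd87c1459687a40c7185942eb9fab11af271e4aa0b47455394ebda83bcabcf29008134379b8a741433efe64d1787c5c20b7dfdbe5d70fc7c2ce9553fb2d1cfe3dcf465206e1ef1ac29ec88d181e5102ec29ec88d181e5102ece05f6526f25f409377e9427fc671e53b63b5e2fc63e26223b06f441646f8e8749b2966a0abec5cb7133ed87b7959f1cb70a2881fd8422ecf587ccbbe8896dc75414acd1825db7a4c890ef9caa39b6696092288be5906e92d3a6acb38e5d40deacd1ce85a671c5fd0f9e3ecc96756c29ec88d181e5102e88e97e0be46870e0befd284ff8ce3ca76ce0ef5a4a40c236117efd284ff8ce3ca76c86cc6d35129379a0befd284ff8ce3ca76c7c4f76c0e9b6f829f7efa562e0c0bcc9cdddc1286be45a89c72e9637ba088df7393a84e23f93a25a1d0ce908a99c150cd48dd05e85864adb24a7b0365174fd2b9c0b67bc866685274eb0832b8aa76eaa92bbdf0e61a10bf1129cf9a91979be0f4657b083f40c961a9a9f4a7e8853f961a9a9f4a7e8853fc2df7887dc8554fc1ea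f77089c1d229a87c3d2b02fcf8494cedbd8b478dd9cf73e18972723003fcfe06eccdefef0e9e4ff7dbdda0f979d882f698f9d1fc0eeafd6639fa99ba19719eb925026fa1dbd405b36af7d19b77b862a1ef99ebe5a80e0d3e40a598200e59f3edced426b3c6c5c20b7dfdbe5d70f84b5a106954499e0a5f47eb3e3c168199c62cbdadeb277a92b79f7a129032fe8aa1aab16885c9bd51e5e48c1abdced4277112fb5d8a2a41503d9b78ad8e32749d2a10c07dab51d5e78e98e66dc9b4e1d25af302c18d355d96558d8ec52be9637ba088df7393aefd284ff8ce3ca76cabc55ccd08518aa5b8c2154bd2d919fdc376a4565e6673c7fbdddc1286be45a89c72c9d9a18a599701c086df649804c0c66c6958d8e1df38122ab6aefd284ff8ce3ca76cca78dc64eced12c3ee0be9b934012d1f2477e9427fc671e53b677e9427fc671e53b600000000000000000,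
  0x549294316f66288da55b584b0719b43564549294316f66288da631ad2b9c414738a964b22afd6e7368e7579cf929e826da4f74549294316f66288da688b78a90c245c30378121b62173e0353377e9427fc671e53b67606649100aa7b717b40dfbf26adaaaf346ffb2853ef9bf16ce8b7bad975486175088d2f83032b383f632ad114c407604667a93f1a9d9a281627afc89ba499f871f7dcca77e9427fc671e53b6a557c5211c6f9a91e9e1244446d77f19ee934696d80c599a71d83d5d0a0b971f25d277e9427fc671e53b60ee32ab54c21946556a2d8e9ed8056f7f347d8a6531a1b9f1159ffd93eccaddbaa1fb36f51833ca5f6aa8e00d34ca9f3d53f320000000000000000072a27d71a782a726300000000000000000268473ff5f80d736e213daef140919921b9926f17107037e5d1000000000000000007201591a302394cb55b0bdaf887a54ef8e9a6006c07c6a2e3755f47eb3e3c168199cd7312dbe028866d525337d326b4378d541ba077f03d256eaf045c24a84d5676752bbd40deacd1ce85a671d333a6695255c0554ea8bbff16df48c6192000314b69a147fe671e847fcd196bdd3a8117bf719e1c22ef4af95861db492615cc9d5e093ab4436a2bbefd284ff8ce3ca76c523a0a4f0cce99117b181f58d48e51aab36732c1481a4abdea59a6006c07c6a2e375943a1de7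468f79fb4abcf29008134379b83e01be8f4311b4191b5eb010f098399547ac7ba565cc36c5caad7415627fbde4e9037fe0003ee4e5eaeb8efd284ff8ce3ca76c5bfc5a492a4ecd4d1b24ffe63ac5182829b4eb8ba376feee6cceaf77089c1d229a87b7e63b3099486a761d52c37de057e66f8e0e5bde57d52d4099c6415199de8d6dafc362c23ca9596bf7452b5339dad836381bda85df9405c25825e04be4cac858ce45e5be501767a381463c88c9fbeb97202761a5c397585aa93fcac2576d7415627fbde4e903b58fc50af6789f982c9d159312e675b10aa47678f71fabc8edbeb130acfb9161a93aefd284ff8ce3ca76cefd284ff8ce3ca76cbf6cb35912d2a5fabd547001c924f0a4157f71fb9bdd9743ee8ca11a7a13ca09a0b6937e4eb5dad1c585c8be226f7633018ddf92d156345036577ea752c3fa93f76d164902ffa04b83e48d21869bcdb9b4ea7b31c67ae8e2cb4a56725cec445000011860598aabf5bf23a4e93c376de2cf758653bc8a5b6c9c4f14b6ac026b1c265a69202dc6838295bfb89455ef75b79efd284ff8ce3ca76cdfc2840d8af98a027d333a6695255c05548f7aa512ce509b726add597bdc52feae50efd284ff8ce3ca76cd1fc0eeafd6639fa98bfb0c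9c07fe11e95790c32fec8a700040efd284ff8ce3ca76ce3e5f6de99e3bd550efd284ff8ce3ca76c790c32fec8a700040790c32fec8a7000400122f07f02351ac8a,
  0xcc7bd6b135d80dc9055b584b0719b43564549294316f66288da00c35f9fb9c6a4f3401e6501ebbfbbfbbe01e6501ebbfbbfbbe549294316f66288da51d5915ae86b14b6d1546408364c65a27c0000000000000000022982b4176f6696725b351a1332c8803ca17224674b789c6b64380d7447cad2054631546408364c65a27c4a457161c38cbd4f22864b64c045ce036689ba499f871f7dcca00000000000000000428bea4269f7f16673bbad12a632a23079934696d80c599a71d83d5d0a0b971f25d2efd284ff8ce3ca76c549294316f66288da55b584b0719b43564549294316f66288da7097b5dcc9392f3665d59e43b9a994e0ce7894a747521d8fd59003bf58f8ada035715d7eeaedc9e68514900000000000000000000000000000000000000000000000000077ad4cf03b97e1e4515615bfa9a0251a9162a9d0a205322ce7d38f3ffd87be811ade5ee79bddf93f80bb14bb535787b958ab1bba04780b7639a951712f24ec924ee6149e71d71d8d256aee8be489819b6930a5d621acbc3223c3452afdc99501ee63ba9be5c1efd284ff8ce3ca76c000000000000000005d5dbd9ccbdd2505f354e67bb489a86a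e660fe70765c896147d6ea4f5dfa54be28d2ba8d2dbb6834e99170000000000000000077e9427fc671e53b6517e35315330e8c5a777440a0add89a72f6def63701cf6018c0ddb26b50e4a672f313f1d4f7640b0d8195a58d139dc9570d27a93ad7607eeff818b1b36d7f40d1f146ae574c1741eecd1738bee54ae08254d29b2d639054dc17e198f45d7566aff39beb9ae369cf569cc55cdd5d1adabe4c9c80b8aa00694794499612e5d04fe9c7edf111ab42ddc00000000000000000596699e75d479a7af56c7eca524658e574aba85499f8466f3f78a6925a74146db6c8efd284ff8ce3ca76c4fda50bda897d50d1acece405650cbb4638ffb94c8b80522c63b40d8395a7f8f4aa18bffd3d39c5b192f0d29d7e77c773d0c1385b9e14eda1b29bf4efd284ff8ce3ca76cee565afa85a454c84efd284ff8ce3ca76c8cb33cd8c8bda01a1e201e630793a85f2e7aee01caa090f5a51967766eb55d6f9881a2379b91cccf96cc699cce3cda4935e24886ccba93ff32f3ee388a89e92d2437ccea0000000000000000068d5591379a0ecb6e5970266d495c3f160a863fe792053d681ca1ac46b548ef82d95efd284ff8ce3ca76c73089f3619424bf14c69a0db140b930b639e312dae779b3262aeda6f55a8fa2fcfc9d7397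e933ba9a3070ec75e8150453e24aa926be7a8db6129c0caff71f4ba882e3f4cefd284ff8ce3ca76ce783b6de886c4f8668b49c802bc0b9b9e98d25ac018f1c247f0edf6a100b9d341965edf6a100b9d341965efd284ff8ce3ca76c8d25ac018f1c247f08b49c802bc0b9b9e9153c6981c8aa3f43a,
  0x7542877383db971767542877383db971767ff8b958df95a1da97c04eef314a49e15c7ae3dc7c3861a14cd80cf7eaa54602512e7542877383db97176820ee5fa52ae4bbca725d560387300f7ff77e9427fc671e53b6917dbc942075cfc489662d5e059bc7d6b77a98a8bac359fda88833126aac370d70e777e9427fc671e53b6817ac7697309e8530773913ef951fef4c17e790882c387bc3e177e9427fc671e53b67eba560cb494eb9cf8eca0dc53dc9cf8937ff613dba7d0ece7a77e9427fc671e53b677e9427fc671e53b67542877383db971766b4f8e74097618a29813050d73485283548cd7aa9f479ce90c7808c07aa9c04e774087af41570cf2f194c72854c978a1cddaa77f7e49ab6605157bf77e9427fc671e53b686cc6d35129379a0b7a64784932b0a874d86cc6d35129379a0b6c3013dd58f089a216a45d1391ee9a8eac83b216fe250f012f09ba19719eb925026f82fc878dd7fc2fb448c4a049ff746e12d8808c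07aa9c04e774097424ebe9de4387bb77e028f6728df15bb7774dabb1e480aa747fb38d3bfc641a79c77e9427fc671e53b66c206e0167d4c947c8fd8c29b8cf53433583a2712233f340d4b75feffdb8c6b0484177220c46d3e2ad69d8556925580b6737d877e9427fc671e53b686cc6d35129379a0b7d4d386802c6eccc584e23f93a25a1d0ce8be63e9745e7e6a7d84e23f93a25a1d0ce6ea23428585ea241883909c47d989a61297a8ffd8c0908335f66df649804c0c66c696e54231146fad7412731eb2c886b65e3e47c3bdda907371a70f6d95c9cc2e04ed92f82c295aa1dc6a6c5486c1ae8a016bff4a16e54231146fad74125ebdf0a855e1624c277e9427fc671e53b6817ac7697309e85307539dc44c989ccce48081c06fc688bea158d72da24a15ad015683837f56760aeab647d752efc05b3baf6d7d752efc05b3baf6d7a8ffd8c0908335f684b5a106954499e0a6e06586237ec36eef663c0da601fa01b096fd9cba6ad4e289c373f57819fb80e17697a8ffd8c0908335f677e9427fc671e53b66e54231146fad7412731eb2c886b65e3e47b09698e61a38ffc17b2e7b7eded8e045877e9427fc671e53b66221ac7ef39070a2c5ae91ff3449172d244e155964f655ef0b877e9427fc671e53b68550ff074bbf9e02193e3d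f27711e3c9056e2b2a51f0be86b5a6a160fbc92c5e102077e9427fc671e53b6868dd21b23dbbfe46952d2620fe18ff05c6a2642363e61759937a047841aeabe2d3c899677598ae9c8c637085e706dc703ef3173924fda88ebfa7d1572907c77c195d0f277e9427fc671e53b6741f8f0c2871b45815ae91ff3449172d244e155964f655ef0b87b09698e61a38ffc177e9427fc671e53b677e9427fc671e53b64dc0ea5ec2bb74b0a46885dd313bc76e0239b49744c580f3196,
  0x77e9427fc671e53b6614f725f4c2364e57d938b4df12954a20da3296ab174e17c496e732e06354cee4ac0673862b8fe901e539c7e2bf2c7b7dbe31d9f9ada6e95fd4c48fefd284ff8ce3ca76cc3a7d8ab40e76b9d7db25ae6f228265235889a22468e53ac233e781d979338202d81efd284ff8ce3ca76cefd284ff8ce3ca76cc41c44c36923f18a2e4f8dfef4c42018ca77e9427fc671e53b6bf9daeb4e156bc0ead21c154cc142ee0aa9e7d2b364cb5cbc4e843479e236d7648a86e4854eba128bd5cc558f3b34177e2e438c23cbdb2cc69a7352b6dead9363a19328fe2d9379bd3b44fbaee64089fc1e085e16fd79d779ac22de3712889a22468e53ac2339e36b8acfcdfcf42aebf9700ec9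9cc7bf6e54ae08254d29b2d6c4896eedd09aa2ff9c4896eedd09aa2ff9b8e2edd026563dfa6b785b6fb098987cc2ebf9700ec99cc7bf6e201e630793a85f2e8d25ac018f1c247f08d25ac018f1c247f0d150f85e38eeb16f8ebd9088efb47062bce1555a7dfeaeb7a06b6c0ca641a40f3ccfb7a59996e331e03f6595f98151627634dda4e54f7d066698a6bba81e5e374f2bbc62bc632540e801922c9deaf22050b35d7d9defd284ff8ce3ca76c8f671843a80cdec14efd284ff8ce3ca76c8d85d8e634fe085adebf9700ec99cc7bf6e9c7edf111ab42ddce9c7edf111ab42ddc71deab714b395da268b324f7297db1cb508bc6eda77f44f393a8b8e0352e4c5dc09e8d25ac018f1c247f07e790882c387bc3e177e9427fc671e53b6e8681f7e47c006ee4e8681f7e47c006ee4efd284ff8ce3ca76c8aede4d7bb2eae3ec83837f56760aeab641304a257f4bcc9036d52fe4258a9ac96fdbc2e58d869573ae95d52fe4258a9ac96fd8bc6eda77f44f393ac554fc3f847c9295a6e4854eba128bd5ccc5cedb952a76408364de5991564045b4808b8e0352e4c5dc09e88a89e92d2437ccea8d25ac018f1c247f0153c6981c8aa3f43a8b324f7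297db1cb5013ddab27b8d30e58413a4c0d31e53f6ce8153c6981c8aa3f43a77e9427fc671e53b600000000000000000efd284ff8ce3ca76ce631976b679aa2982efd284ff8ce3ca76c77e9427fc671e53b677e9427fc671e53b600000000000000000000000000000000006a4fc8c43c01cf32a61279b683e839003c9e7d2b364cb5cbc4e91ddc2917752965b2e631976b679aa29826e38c2ecba0b127c3d2a3a27b6fd2b3332827b5164a83223016cfd003ca8a3644695c70cf3b3fca37cf39c651728fb7faa088aa64e9399bb86a709aba374c6b0aab4eaafefd284ff8ce3ca76cd1079b48df25cac407b2e7b7eded8e04586d07119a67d88d29fd7ac3c307df9caf61c3009bfc79b160d91d4f7ac833e8cdbd2476b1ab0171825ee0b77e9427fc671e53b600000000000000000,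
  0x77e9427fc671e53b661b944ffb02dda7d7d1f27ae665a23cc21b58d2f0e57d8add65efd284ff8ce3ca76c1de00a1927418db4b92cc5b8655c75779f5c7c441d5ba0c58569ae78633bff50b6b273263e4022480c3e2ada4875c19423628989c74a0f96af9ddd8e91010b52b4af9ef2cf58ec178d7c929fcc612fddb119ca594190690fba09c406886db25ae6f2282652357e17216f64ed8b751ac6c988721768b9c2cb3132acabb1ace05c7d780b13047d138a88eab1aa8c6174e838f671843a80cdec141f638a2b8e4e53d47944fdb98bcd41d99b9116d3c9ad4158c3befd284ff8ce3ca76cecfb593568c236bb2ecd593ecf4f7af00a77e9427fc671e53b6944fdb98bcd41d99b9f9ada6e95fd4c48fba04780b7639a95178d11024b55c3a5ac48d11024b55c3a5ac4514c7238b902caa7daaa5b9d65ff9d3cc1bc632540e801922c9d29d7e77c773d0c1356006e297e9503a7eb66bdae5636bef5d68f6d5ec893d9a6f4dd58a87dc93eae4d33dd47d0d081d55c8c89be0f4657b083f40c8192b0bd96429169a6a14daf9b4a797e3c7c5ba16cfb043ed4398c23a85f16677328cf58ec178d7c929fcefd284ff8ce3ca76cb93bd36df0cdaf098944fdb98bc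d41d99befd284ff8ce3ca76c9991b96a0dbeba315efd284ff8ce3ca76cefd284ff8ce3ca76cefd284ff8ce3ca76c77e9427fc671e53b66ce4f263e6034f516d460ebe3a9cd447add52fe4258a9ac96fdec75e8150453e24aa9662d5e059bc7d6b7de342eb9feecbfb2e97935c83a980da139c83958c90b4389060efd284ff8ce3ca76cad8e32749d2a10c078556925580b6737d8664aec3a387ada7785f72314ac169b1aea764c3b75d91c840b26ce4f263e6034f51687a3210b3502f9686819cf13149c82783d9e7d2b364cb5cbc4e5f7d720dff4d9e1655f7d720dff4d9e1658b324f7297db1cb5099cce3cda4935e2486c5b283b0543e7fa36c5b283b0543e7fa38ad69b924af05d60287a3210b3502f96868b324f7297db1cb508d25ac018f1c247f07ff613dba7d0ece7a77e9427fc671e53b6858d074a0bc4229479e7d2b364cb5cbc4e80f3a7394d61016c76d0aee67fe3c59cb26e2b2a51f0be86b5a4a7786ed27226f11109c7be2897b89050553f67224136a593735bae49ba76692252bb21716aa84e14c5fa8e16dc2840d33c440e8681f7e47c006ee43ffcc6f0bb78117dc9f6ef83b7ce1c32c672e846929bee57de9a80e0d3e40a5982007769ab0eaa26c8497ab0895251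eb3ea8f377b50e706c78957a6b684cb86ba194fed4ead1891262603d19fca78dc64eced12c3e6d95c9cc2e04ed92f9b90586d4ca554700a0d37727b5dfccd5dba374c6b0aab4eaaf9bce7fb59bb7f010f5e78efe78d85b44fd572907c77c195d0f226a19dd46441c1a3d,
  0x5ae6f0fb85107ee261f937029abce734be8f2bebce6cefbaeecd2d0337b4b82641dcd961fd032a1e72e9515b9f23af139463398da334bab7ab2b6ef61b944ffb02dda7d777c37d3752a75d80e3b8be7aeec1c341b59c1bbe37fe0fbf45224584100ab6861c4497b7726b8f9f7b4c69116d3c9ad4158c3bb22e9870fb7d01dbd551ecf07e11ea4c1aada4875c19423628974036eb26ebafb983a69116dbd4070742e9f5967746f136042eaf0aa816c2b7ed2dc89de84c8724ded5e8944fdb98bcd41d99b0000000000000000077e9427fc671e53b677e9427fc671e53b6ee7f64a43e18aef94ee7f64a43e18aef94ee7f64a43e18aef9414a6fe10db4d8037a80c5dad719a3f81cb614f725f4c2364e5777ad4cf03b97e1e453aba97862ec13f84ca5556b7bae749b02553ed19aef7792e24ca6c2e0eeccc4935bfb6dead9363a19328fddb26b50e4a672f31806dfd13a5b28e00cd5009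1451518b68e67696222477a6c9bded72858fea30055250936dc2147d0a57208be8896dc75414acd1b9e08158a0aab4751ad19749c70774168e3b185a6395dd658878472693cacb5a18bf89c74a0f96af9ddd8be066b93c6832319c7febfc0e528088fb6af0aa816c2b7ed2dc78dd5bced3eb1786c9a85d2b91b37ec7cb889a22468e53ac233acbc3223c3452afdc9cff6bac08dc966159cff6bac08dc966155f72314ac169b1aead75b73ca87db96ea0d52fe4258a9ac96fdeda6f55a8fa2fcfc977e9427fc671e53b6efd284ff8ce3ca76c597903d24dc80ca188e37cde58d387d0e58994e2d370141b7ae8c1abdced4277112f75feffdb8c6b0484187bfec31b7d7c3ead39ce9c74d767d121f87db9b48ce2ee6b8c514c7238b902caa7da63eb99782fae5627bd2c3a64e61ff5696c7d780b13047d138a8149db6cb1e02225796e671d3206c4544eb8e2edd026563dfa6dabe4c9c80b8aa0069f4c254848fb8b7419f4c254848fb8b7415f7d720dff4d9e165c217f67b4223ae224c5cedb952a7640836e783b6de886c4f866817ac7697309e8530db71c2df5c0ece84a86623945ec53cdc0fb21716aa84e14c5fa96f71449cdc44f8b5857ef0a9c30b885ae8081c06fc688bea15738b63d0dad78637b0954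9322b55d201c55f5b3fb18d3b32bcc53d2faa7a2cb631b48e37cde58d387d0e554ed39c9083b6a3b3c83958c90b4389060176eed163f587117b8f582f9605ca565312a14779de3c4983ac7efa562e0c0bcc9cd7da3a253b4a01d3a59ebeab1421bb9647978eeb2d5d942d036a910230d1bb904047d8fa0fa6b35760130876a4565e6673c7fbd83909c47d989a612950e6c6a86e8d43d0bbb21ef067d83165ddb684cb86ba194fed496f71449cdc44f8b54cbd40a2de3ef249673f57819fb80e176900d6c55174ca83385,
  0x5640cb957f2510457554cb24671abddfa14684051dc4bc7ba90682c7c080c09509ef52d3195384073415777e9427fc671e53b62e8f33a6af99a937e6b601bc2e02e28ead1f937029abce734be5858fedc35d71118b6fe688f13a63417b6a707ee8836a9496dc39728444faf82674599ba5248ce2f3cf9777e9427fc671e53b69d9e93b01e84903fa58960c489ba432926aee9b0631da6e7c7e663da22c1ccfaefbe7a6f1d7b2a853ad379659812d3f1bbdd54aca80c9305e255a8392a7eb852b52b35dbb102de30223202d050bca65b9881b6d5656f0caa28733fd25a139728444faf82674595dba226d54f5c0b2b517ed795e228af20e2841675462540b8f0000000000000000077e9427fc671e53b6000000000000000000000000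00000000000153205b4ecb1b7d877e9427fc671e53b6000000000000000006b66f6176650e11dc558f3b34177e2e438777440a0add89a72f4fa751ce812fddd37c790944e47a1c30ed5c64c2eb0fd973564a3041747bea8d8e7f793c62db153d00b8ed87b7959f1cb70a28c04beeedc0fe7997ee9ea9b99f6957a06b00000000000000000622f5044d5389f07d24584100ab6861c448c79c6441970dc1b5b4469d50a0c7965b7d8791908d865706531d02518441616659094eb940407d34b946673862b8fe901e5395ee79bddf93f80bb11d0251844161665907e7b0c07a50df406f39ce9c74d767d121fb1b7def49dd9b65d5a4e54f7d066698a6bb40d8395a7f8f4aa15d129347bc74e6392d4fbd5c782e6cb74850791d8b1dd06a33e879a83221a16722647bcf164d1e28cede9aa76eaa92bbdf0e61a44d15357bcf8c0aac531b72731a1c07a2000000000000000006d6cf019cf771d86f53ed19aef7792e24cbd51f62218c89f5f5989ea235b23290c41eb131dfa8ad2f10f210b0dfc6c7e1c6e7d710d45c0c046f94f7889a22468e53ac233b36d7f40d1f146ae570a940264be6cf399cda27dc5da1b7f9dd8149db6cb1e022257dab075540f27bca06efd284ff8ce3ca76cefd284ff8ce3ca76c74ad9a77a12a61579d14fdc6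723b97fb6570c311fb15418437baecaa95c7f71b3b987f116146afe9b9fb49369c7c32b5c0b1f093cf409f64807486a98d47052d9ba23cb560318a94576dc94645eec9e72f76fac06b76e3d229b3a0fa4028ffcc07ba8bf554c96c5e32fcd976463bfb5ba5031a0a5d977bc5be0d61a91f323c0cccf210feeb9199d7d86397e94d8b595f1efd284ff8ce3ca76cde83ae523fe352b63d00e3019773400cc09bff8a57ea18675b8b24e15bdb0deff2e7e67df1dcd786aa5a7cdefef0e9e4ff7dbdbcbc1ba635dec7b0093ee642b2044ebe42e447757c9fe82b775d97bc8103ec9d44a4da40b599d0bfb3d2b867181081b2030385907840eaea48a7dcf241a0dee10d261a10,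
  0xce2a0e154596f580d5640cb957f25104575640cb957f25104570000000000000000000000000000000000000000000000000005b82a966d00facdd157104a799b7d5344400000000000000000000000000000000003696b1919c161b6d452fd4aaa927853cb90bca65b9881b6d56527712d57a7768f8c90000000000000000043e6a94fdc1f4e1cd1613bcb4b9cbfdbf38232997af82275a440000000000000000035a4eff4d6b82b851583f287be362f0633a88f3ec52834942dd7887b6686145410d9efd284ff8ce3ca76c5b82a966d00facdd15b82a966d00facdd12e8f33a6af99a937e5037aa90f6e67e2dd62c182b4372024ca877e9427fc671e53b602fcf11297ec1b7625b82a966d00facdd1000000000000000000610339933b45891a02d72bca242193bba77c37d3752a75d80e000000000000000005f02b686c7a4daecb1f638a2b8e4e53d47507553714b4f275e622fe43b3f983262fc9ae78633bff50b6b2128ab42f0b0e6dea436826614bfa4c7efa60652636f90a2381fbe066b93c6832319c8a7a3d33bd4d1b593efd284ff8ce3ca76c02fcf11297ec1b7625d062979371c72fcd15b9f23af1394633973cb5197890cd75527cac46bf6a9bbe38ab2678b9bbd6c0f25d0000000000000000077e9427fc671e53b61de00a1927418db4b507553714b4f275e63a4555f1350b1ca07b22e9870fb7d01dbd3b185a6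395dd65887ae6ace42e3caab3627c5ba16cfb043ed43b41133862531b3feb8183426c923fabd70efd284ff8ce3ca76c24a15252e1321d967748f90844b080993b71bb639027f63f01ba63eb99782fae562798117760e01d2047adeaf22050b35d7d9d0000000000000000057c4f2d5ad3d5be1d14a6fe10db4d8037a8c904090a1bf657307e6caef726d8086d4cebce1b4e29fad41c1d02518441616659094eb940407d34b94677e9427fc671e53b6b41133862531b3feb60bab60f4205f6768c612fddb119ca594178dd5bced3eb1786cefd284ff8ce3ca76cefd284ff8ce3ca76cefd284ff8ce3ca76c99501ee63ba9be5c1efd284ff8ce3ca76c63583d395e68c37907c2307e683f83ddbe88568b7fc919d54d587a3210b3502f9686768a8425b69ab45008bc6eda77f44f393a0500fbed2a838d5cd579095d250febae55781d768f206b34fc6b6b8ff9614129fae4a07f978cdd131d3fae5a1838db45a5e0227cea3e6cf0f572983ad0f092b6b29257cdafd5be0ed16bb8f90d75b73ca87db96ea0d51456583de4205fcd460ebe3a9cd447ad94243b45167aa8241ce520f6fd4ea0f485e60ac6d6f52b3a267c217f67b4223ae2249431a56ba7812c3b88bc6eda77f44f393adb417fb924daa8b46cfe5ee307882a2bcdef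d284ff8ce3ca76c87a3210b3502f9686768a8425b69ab450013ddab27b8d30e584,
  0x63c8d61e5f2537ca763c8d61e5f2537ca7547c0d4a443c7d9816df1b8a1760fa36ee6aa6093a469e27a4377e9427fc671e53b64a3a59d066528491259628de907e4e09483b13941a1296d931b5d129347bc74e639244fefefeb8a573fb156006e297e9503a7e2f1b815ee445f16f56ab5e8afdcec1b91677e9427fc671e53b674ad9a77a12a615796e6f5dd729741271d8d25ac018f1c247f0760d5e80f3615c5af702320d607a3eaea9562d8e928ae290f196c5b283b0543e7fa370c722d9a71c571938d25ac018f1c247f0468878912f5825cc4715bd58b72f5c05767a572d8e596ed71037af9b8df13cefead87bd4bec97bc086363ac7ba565cc36c5caa31a6cd4f84c768bf8538bd2bc1b21d4eef77e9427fc671e53b67fe0003ee4e5eaeb83981e58272ff01bc87af147edfa3b7750d4e6a67b2ebe9007104919ebc9ed02023648aede4d7bb2eae3ecbf6cb35912d2a5fab3a95e44abc04f39bd925212f800f2024da33630a2acff601fd79fa5e365473218b5a3a1698d76854f951a6a457db5811fa7e25671f71e04dca46f4d91e06815d32036635563428b3940e18eaa4de361d88ebd7b5226519f6010b92739c0a4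4d15357bcf8c0aa6912e38352f0701ca8192b0bd96429169a77e9427fc671e53b677e9427fc671e53b685a778747dd17c6f8b7e63b3099486a761aa28053be1e8d341fa188609fa9d3ed77373cab42faab4c4424bcbc1ba635dec7b0093548e45d9fd361568bfb0c9c07fe11e9582fc878dd7fc2fb44d7e0bc45b0f79de896db5fc5d26d0860107769ab0eaa26c8497e59f3edced426b3c6ead14f261bfb2ef306e06586237ec36eefa7194417e146c3e1362a301fc61ab8b13a984a6213a10a8f5da694e2c5ee1019bab193cf409f64807486ae09e98e2d8a4658ceb7a59996e331e03f66d9f9dea774107d7b6d9f9dea774107d7b93548e45d9fd3615692d156345036577ea671f71e04dca46f4d5d8093021a22e4dbe93548e45d9fd36156907840eaea48a7dcf93548e45d9fd36156790c32fec8a7000407fb38d3bfc641a79c77e9427fc671e53b6e3a21470d29f4d583c70cf3b3fca37cf39df08b460143c2c303861d5332bf08d488b899677598ae9c8c6330c7782dcfb0da0760000000000000000071ff04d4dab473cb0580972915df319d2080f3a7394d61016c797c9126e2ef0b0a4cefd284ff8ce3ca76c76a8070e1212b6521e8a70be2ecc72a1d1801445c713ef22edce22ec03547918d1dbdf08b4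60143c2c303e22ec03547918d1db8e2abaeb5665b2b7e9bce7fb59bb7f010fefd284ff8ce3ca76ce22ec03547918d1db77e9427fc671e53b677e9427fc671e53b6ecac792a598e69894d4f7ac833e8cdbd24ecac792a598e6989477e9427fc671e53b677e9427fc671e53b600000000000000000,
  0x77e9427fc671e53b677e9427fc671e53b6618b67eed6fd683c8618b67eed6fd683c845aa7fc3aafaf734d6f499de38e5cff70a803a095acbc282d3ea1ef2326fe264f24a5d7fa4e2e6358832e8183426c923fabd7086bfa17c39f35a5a290690fba09c40688653c732a291806660d835dc10c0347353c677e9427fc671e53b699501ee63ba9be5c187712daf4f27f3beac41c44c36923f18a20a3346229fa15f3a67d1b52c8f52aa8f20821c88a266134475c819cf13149c82783d867ea57567653a4c8c554fc3f847c9295a56043d133017790bf9c46b24371c1f587d511584c2456d0571473162fbb0c03de53db6509f7d19e4c8ba4b958a4eb4dae5acfb4d15e58582d44ab047e76af7419ee0a1f67e97d20c3b3c11cd674c1741eecd1738be73fdc636112344409a890291c16e824cfd560de3b36c0f7935679bcd42ade9eb39d67a1ac49d7e636a1d08cb33cd8c8bda01a16e6f5dd729741271d9bc71eb4b65385320b5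bbec28248ed1252a818275ddf3c93cc1bc6f7ad4bcedc8795e42c1bba3dadfbf39e09e98e2d8a4658cebc913159ebad6d72968c10e6724df89380966ff71684fee9e2461aee948e6ffa6a6c98117760e01d2047aaad38600d43e567bb88eab1aa8c6174e8377e9427fc671e53b68c09aee12dbe92ac581e0cc5e16d42707e94794499612e5d04f852c7bc54645a2d29852c7bc54645a2d29694eae24b9b9a3cbe9431a56ba7812c3b87acea73fd8f44476a8b49c802bc0b9b9e9773913ef951fef4c19d56f8481f9ffd82499a4f66d0201398538e16dc2840d33c44079c5267e99826e1bd71ff04d4dab473cb08d72da24a15ad01565134810e50dc374635f72314ac169b1aea6cb8912c514f704f660a33e904cb8cc609768a8425b69ab4500867ea57567653a4c8843479e236d7648a856346736687bd638656346736687bd6386765199d11c1b9cc6486ccba93ff32f3ee370c722d9a71c5719370c722d9a71c5719375f5e5f0cf30dd716768a8425b69ab4500765199d11c1b9cc648b49c802bc0b9b9e977e9427fc671e53b677e9427fc671e53b68e2abaeb5665b2b7e91ddc2917752965b297c9126e2ef0b0a4c778b2b38b0dc41f216a160fbc92c5e1020624740a05eb23a002000000000000000006a457db5811fa7e2561a7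ca14367e17bee858d074a0bc4229478e2abaeb5665b2b7eefd284ff8ce3ca76c6fbe3f3878f4a7890da03bcedfa144f6b5792a7df17ad11424be9e84754a12659066e3a21470d29f4d583e9e84754a1265906697c9126e2ef0b0a4ca0d37727b5dfccd5defd284ff8ce3ca76ce9e84754a126590667b09698e61a38ffc17b09698e61a38ffc1ecac792a598e69894d7ac3c307df9caf61ecac792a598e698947b09698e61a38ffc17b09698e61a38ffc10320270e9b31aac0b,
  0x77e9427fc671e53b6383d7a3e6905196448ae70deb0ca2fb6e9aaef657ba45f94769e361384159bc038df0dfa2b8442399a8b385a778747dd17c6f86250f0ce5a14d12858232997af82275a445a92eb1905cbb12acaee9b0631da6e7c7e28ec912ef25d263e8a0d5d3aeb8cf0b79e9a8e6b0cc319ea8c9cebce1b4e29fad41c6f499de38e5cff70ae732e06354cee4ac066183b6005c44caa2ca8bd780039124478989ea235b23290c41eb131dfa8ad2f10f2b958a4eb4dae5acfbd79d779ac22de37121304a257f4bcc90368aede4d7bb2eae3ec8aede4d7bb2eae3ecefd284ff8ce3ca76cef9e2c78408c74c3aefd284ff8ce3ca76c6ffddff782f17967a93548e45d9fd3615677e9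427fc671e53b689ba499f871f7dcca81cee717439f11f8e89ba499f871f7dcca54c6ecb8bbbd7e40cccb02f38822f637c2ccb02f38822f637c2efd284ff8ce3ca76c77e9427fc671e53b6efd284ff8ce3ca76c8985f1183ac828198ef9e2c78408c74c3ae67f2eb7c8fcd87dcbe4cac858ce45e5beac7ba565cc36c5caaac7ba565cc36c5caa6ffddff782f17967a93548e45d9fd36156d85e527b541e99a0defd284ff8ce3ca76cc08bae2c1776c7d28b102de30223202d05e7e7227749635ea3093548e45d9fd36156efd284ff8ce3ca76cefd284ff8ce3ca76ce7e7227749635ea3077e9427fc671e53b6773678d585f91fc3ee5a1838db45a5e022ef1fbb554c6b04ff4efd284ff8ce3ca76c80cf7eaa54602512eefd284ff8ce3ca76c9d34ffddc06b0b24cb5ba5031a0a5d977befd284ff8ce3ca76cde2cf758653bc8a5b87af41570cf2f194c7ec9052c7f04b1bd4000000000000000004abec7ecda216819d22a5288cfca8055137c2307e683f83ddbe7d1b52c8f52aa8f20bf9daeb4e156bc0ea1597382499621069283b8bc7bc81b655436903b4ac605e6570b967766eb55d6f9881702320d607a3eaea9d507c0fdd959072296e48d8c141fed0f0acfe5ee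307882a2bcdda5d312929ba73a96edf6a100b9d3419657eba560cb494eb9cfd846557eb4eac2a7b6a457db5811fa7e256a4fc8c43c01cf32a71ff04d4dab473cb090c9ee8b8872737dc8550ff074bbf9e0219f5102ec6251dca090000000000000000060650d80d2e10f2003c24b972a468c5b7eaecaa95c7f71b3b98a818275ddf3c93cc1ebd9088efb47062bc42e1f080e3befd01ba584f27d456a8815581cee717439f11f8eca11a7a13ca09a0b69fa5e365473218b5aca3a737f2b9fdc8918b5b344fc8d92e9e1d97bc8103ec9d44a4e7e7227749635ea30e3e5f6de99e3bd55097424ebe9de4387bbbdbcf519f2ddb0f18da03bcedfa144f6b5d2a3a27b6fd2b3332e8a70be2ecc72a1d19b52597d0ac308b52952d2620fe18ff05c45fc7e781b6b0e33d,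
  0x1304a257f4bcc90363b13941a1296d931b4b750ac57cf7bb7ac9ca5da51722c32d8f5e957af6a7abefe5aaca279ca9e73057c702920f7bdf22e009b6519f6010b92739c01201ca54ec6af195652fd4aaa927853cb93aa5427247804eb90a707ee8836a9496dc00000000000000000768e33d88635c9af66358bebb7372ee5b7b2678b9bbd6c0f25d77e9427fc671e53b6efd284ff8ce3ca76c3ec6080b0fb3d6dcfb2253975f3eaf06519ced3159ec493c49ed8791908d8657065392cc5b8655c75779fecd593ecf4f7af00a0000000000000000077e9427fc671e53b677e9427fc671e53b6ea9f29d7d56a8291fd67ebd766e1dd5210ec1b53dcdca9f840708873053d2197d25f694e2c5ee1019bab125e456e0fcb50d99e5b351a1332c8803ca3c24b972a468c5b7eb40dfbf26adaaaf34395df24381056c691b14734c3477751a4792c30943553b441f2ba8d2dbb6834e9917612816bb93ff11db6d911593b5a70f716c5e957af6a7abefe5ab16b42367cf7551cd989ea235b23290c41efd284ff8ce3ca76cc4438abcb5ad385d0d7415627fbde4e903507405e153a90794873cab42faab4c442476f40639b25a43703a88f3ec52834942dd86280c3aa73119cc8aca80c9305e255a836ffddff782f17967a93548e45d9fd3615677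e9427fc671e53b6934696d80c599a71d8b5b344fc8d92e9e1934696d80c599a71d6e7f5722327de12f0b6b8ff9614129fae4a6310f044b38ff556a863fe792053d681c7c04eef314a49e15ceb07f5484d284379a62bf5887dd64f82608ffcc07ba8bf554c99d34ffddc06b0b24cc445000011860598a8cd7aa9f479ce90c7dcca5053f1c0d3eb9141bc2ba437ab913d654c924638af307200d099d9c059ad6829748f90844b080993b79b0213087ee9d0b7ac6c988721768b9c211e667a3587489f29849c4efb676d274925780c1649c66c3bac7566aff39beb9ae36406e7bc5a98b53df99535687e6548d2205762c6451bfafedafcce520f6fd4ea0f485ba0eba2c040c0dadaaff71f4ba882e3f4c833126aac370d70e7edf6137ea0f3924396c624295da8ea05c453f67224136a593737874369506ec215e08443b0910895a176d817ac7697309e853095db8989a3dee4452000000000000000006f987ba4c12147a2e3aa5427247804eb90879a83221a16722646463b9a72f11d01f7d58a87dc93eae4d3325b551305812ab0449c4b7354cfb974c225a92eb1905cbb12acb24ffe63ac5182829a39071775743f06b2cc7d02a649a116a9a86280c3aa73119cc8b24e15bdb0deff2e7c08bae2c1776c7d28add597bdc52feae506a45d1391ee9a8eacc3a53db856dd043c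1a10bff456a37245ca9f6ef83b7ce1c32c6d8f59770aa45e7278abcb1cddbdf56a05f7d752efc05b3baf6d65e8ff7b2dbab327c,
  0x624cac1957e5c21bf547c0d4a443c7d98126da84c52028a38fa402e4c4e3eee98e56250213b280d67f21c537f0359cd51ab45a418b3a84d3adc9ee27a572d8e596ed710331c1db0ad636ebc344dc9309fc8b70851f456d4d99b33094eb09bbc297fbb7e036a41c61a1342198c39f8727911be8179600635c9ea015f9ea2cb989f1aced6ba88ffb886b77f5c1934a1e529e361384159bc038df1e842b7ff23c0d8557375f4530cd5f01987c0b8f61f58ee31edac7b124cdd4b6d9b6a935f326f37978d0defd284ff8ce3ca76c0dfa2b8442399a8b32f1b815ee445f16f5496c52d879f6b91789c5381a5bf921f3125e957af6a7abefe5aafa438b14df5319160000000000000000062a301fc61ab8b13a00000000000000000000000000000000000000000000000000077e9427fc671e53b622f779acabd802a737c5c90ac800dda5d4664eec5f5b705f82960fe70765c896147d469c91d8996a51a5fbe85d4585fdc36e1521d1d1f5669148d4b7d5973410b6a6a70966183b6005c44caa2af95861db492615cc845a8f3df999ac243efd284ff8ce3ca76c0bcf8cee6e11a1e404e6a67b2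ebe90071040615cbb84eb2a440966d6dffb8adf2c0b77b4e9f87a1a8f884ac7b124cdd4b6d9b60afc9bee15957cc416d9f9dea774107d7b149e114a842db90524a457161c38cbd4f242e1f080e3befd01bad114c407604667a93396d21d70eb7e6e58715d5773e3d29b3f700ded48ffa0451d6aba85499f8466f3f76df1b8a1760fa36eee201e630793a85f2e4116a83037bc41547976584164009afd3b8985f1183ac828198b5339dad836381bda7af9b8df13cefead8de5906a74f181a49b3a4498ca4af675c1a671a8b90f81134eff2ac0a0e71e5b001616aafc1bd7888b5de09c0e10d3ed1ae5da0ca8bd7800391244784cb1dfeb0e74209a6a3fb64b748c7d3770a4ea884d0ef6e58a5a58d139dc9570d27a52a5b98b764ee02baca5aa383f0696fb3e5e739728949ebf649b353ff1d687fa04ccd65cd9a85b10a49ffefd284ff8ce3ca76c6ab5e8afdcec1b916ccc9aa749a52c6239608de66323ad2d37d60650d80d2e10f2006a2f5bbf92456978e97cb0bbd113e0c52d984a6213a10a8f5daace8735e25384862c209fbdb38c1e325ec4bd72048441bf6ffc456d4d99b33094eb0976584164009afd3b9d2ccb741694ea4b2ef9e2c78408c74c3a4b134fb91957260d188b7f9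6e94d29586daaef657ba45f94769b5eb010f09839954753c4742b9fc8e49cca667092bdce823a8e77b4e9f87a1a8f884a8246ce361d71a04def9e2c78408c74c3aeb130acfb9161a93a4919ebc9ed0202364a3994b3ada60bfd4d85a3293ffa9e60fdea584f27d456a881558f449e9c69369d3ef77c0699d75a5c72396d9f9dea774107d7b62a301fc61ab8b13a,
  0xda35ee991e57a757563c8d61e5f2537ca7624cac1957e5c21bf03b73122b039d236505335b27b77947e4d05335b27b77947e4d624cac1957e5c21bf468878912f5825cc4178cdc85ce0cb2d3c00000000000000000209fbdb38c1e325ec4dc9309fc8b70851f25137b3ff126800433e6742c90fec7559f0c824c686021041da50dde6ac021c5a9022b8efa42d7369219c8ae70deb0ca2fb6e9000000000000000003e8b503c456c78d251e842b7ff23c0d855966d6dffb8adf2c0b8eaa6e43f8e4b89b6efd284ff8ce3ca76c624cac1957e5c21bf4a3a59d066528491229dc43abcfaacfa4943300b34ee70c4fa526b872f3d13d6ddd3532caaae1ab7979dd173ee60c4984455d2563428b3940e18eaa0000000000000000000000000000000000000000000000000005858fedc35d71118b048a1114e23acbb343dad4b8998f8da11b18e68bf8fecd0a4eb73cb5197890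cd75525d062979371c72fcdd1f27ae665a23cc21015b0ea7403c1b8c07944512706ae00c763ec6080b0fb3d6dcf8c79c6441970dc1b577e9427fc671e53b6efd284ff8ce3ca76c0b3bc00111866c49c31a6cd4f84c768bf80a7c5265f6fac7b4750dde6ac021c5a9024b134fb91957260d19f1aced6ba88ffb880000000000000000077e9427fc671e53b620244faa19348959943e6a94fdc1f4e1cd25b551305812ab0449d9e93b01e84903fa17a1747bf33aceb646bf839c60b16055365c427ae1a716c30528c904090a1bf65730618b67eed6fd683c8d938b4df12954a20d21d1d1f5669148d4b6aafc1bd7888b5de05e957af6a7abefe5abd51f62218c89f5f573162fbb0c03de53de2d9379bd3b44fbae0153205b4ecb1b7d8538711aabd2a55b4a1b80249dec1aafa496bf839c60b16055364c421388359fda0baa0d5d3aeb8cf0b79e0850c6db05509d988803a095acbc282d3e5640cb957f2510457ae6ace42e3caab3628b6ecb585dd1fa575e91010b52b4af9ef25640cb957f2510457b8a595a1190c9a912ce2a0e154596f580defd284ff8ce3ca76c835dc10c0347353c6e781d979338202d8116dced8ee29de34f44abec7ecda216819d4ec685ba22aca61a2764c3b75d91c840b26cb8912c514f704f6bc2e5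8d869573ae9505335b27b77947e4d6b3636042576a32da250213b280d67f21c8715d5773e3d29b3faf640939e35876973ccb02f38822f637c226b872f3d13d6ddd38a85f2b954349a04c5e957af6a7abefe5ab1b7def49dd9b65d5762263cf04f52d6b5aaa5b9d65ff9d3cc15e957af6a7abefe5ab353ff1d687fa04ccd67ebd766e1dd5210dab075540f27bca0679bcd42ade9eb39d6b785b6fb098987cc2775e4e6a85f7a918c83b8bc7bc81b6554383704269b2552a1a85f7d720dff4d9e16556346736687bd63864de5991564045b480,
  0x77b4e9f87a1a8f88477b4e9f87a1a8f8844b27b38120e0abd5f469c91d8996a51a5f3eaaf9ce9b003d9c5612816bb93ff11db65845d1cf00c1b26c4830b829130693b31d4af430a34fe00fad44fa751ce812fddd372a17efe5c81106fce806dfd13a5b28e00c26f80cf62db38687852a5b98b764ee02ba698d6427f144a4a1a70a940264be6cf39973fdc636112344409c4896eedd09aa2ff90f67b373cd800d6b4406e7bc5a98b53df9618342781e10b74559f4c254848fb8b741852c7bc54645a2d29e9c7edf111ab42ddc432287127455aef90830b829130693b31d795ef3aa9475a7465845a8f3df999ac2438610606577193a5f9c4438abcb5ad385d0286b7c96731f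719dd67bfa85e67e450dc425af3830b9a34c29f5f47eb3e3c168199c5de587ac082b18091a741433efe64d17870a47296df0facfea253c4742b9fc8e49cc57e911345cd09d3d0b58fc50af6789f9823981e58272ff01bc8a7d92cfeca957a9813cb6da46cca63affda39071775743f06b2617396011aafaedbfc3d2b02fcf8494cedaa28053be1e8d341fd5682d6d90586a4ff349262e605c4e08f467bfa85e67e450dc477e9427fc671e53b6c04beeedc0fe7997e7689a1bedffdafc8fb9e08158a0aab475177e9427fc671e53b69e6db67f25f2bc72487de65a0b40ef4ec3d333a6695255c0554ce05f6526f25f4093ce05f6526f25f4093669a6bd279716d7adde83ae523fe352b63cbf87796d1ba4f087dfc2840d8af98a0277a64784932b0a874defd284ff8ce3ca76c78917d2c04ca44b687da3a253b4a01d3a5d5268a51760b1ba94efd284ff8ce3ca76c8be63e9745e7e6a7dabc55ccd08518aa5b000000000000000006a2f5bbf92456978e1d5d268d2a9b9073f7f116146afe9b9fb4bc6f7ad4bcedc8795e1555a7dfeaeb7a06175b5c1ca2c4b80398f449e9c69369d3ef77e9427fc671e53b6937e4eb5dad1c585c3a1698d76854f951a937e4eb5dad1c585c77e9427fc671e53b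6da40b599d0bfb3d2befd284ff8ce3ca76cefd284ff8ce3ca76c77e028f6728df15bbda40b599d0bfb3d2b792a7df17ad11424b827b5164a83223016801445c713ef22edc7663c6340788502e96a2642363e61759936257731a0a4dce97509c7be2897b8905057874369506ec215e07cd05d5eb0fadc41996f71449cdc44f8b579c5267e99826e1bdefd284ff8ce3ca76c6337e495e114cf665d8f59770aa45e727877c8e9dc491df128be59f3edced426b3c6e59f3edced426b3c6e59f3edced426b3c6916162a51903fe03f96f71449cdc44f8b5ead1891262603d19fe0be9b934012d1f2482c295aa1dc6a6c5477e9427fc671e53b6efd284ff8ce3ca76cefd284ff8ce3ca76cefd284ff8ce3ca76c77e9427fc671e53b677e9427fc671e53b600000000000000000,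
  0x71d90ee692bd8ca9c71d90ee692bd8ca9c61df0a4823f86237f5d062979371c72fcd56d17dd878363c23477e9427fc671e53b64553f927a2644b91b61ba924098c683f00397e0069621d9f55a22fe43b3f983262fc06100227972583f74551ecf07e11ea4c1a43aa20fb969e5fff28b6ecb585dd1fa575576fa997c70aad64660bab60f4205f676886bfa17c39f35a5a2c3a7d8ab40e76b9d724bdd9d1bdf68250d79b0213087ee9d0b755a6477ca0b2c2584bd2c3a64e61ff5696aad38600d43e567bbefd284ff8ce3ca76c46d7793a097111b1761ba924098c683f0056d17dd878363c23477e9427fc671e53b67cc2234eb34dd476892cc5b8655c75779f3bc1517967b2167815c9a497f92a6a86f327b197eecf8b670d94bb535787b958ab1b2873e45bda0b3122a600506c1c0466058422f6fb20fc79ca80c762263cf04f52d6b5559d45bba33d9f8e28bffd3d39c5b192f044fefefeb8a573fb1bce8417e7f175936730249822ff3e4ae336463b9a72f11d01f79311babefe1fc00a2a10bf1129cf9a91976912e38352f0701cab4d179aecd65f67eb4033b0669c447010e5c9a497f92a6a86f3812f30bc4251d24718a7a3d33bd4d1b59348e30472cc408b28589de84c8724ded5e877e9427fc671e53b69991b9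6a0dbeba31577e9427fc671e53b699501ee63ba9be5c199501ee63ba9be5c1985c05972e308c10b5d2b13d877723b246d51456583de4205fcc15238fdd1c7bb179d7397e933ba9a3070917dbc942075cfc48edf6137ea0f3924392352013d9261197d954ed39c9083b6a3b38033b2af3e4bae327b5d8a2a41503d9b7877220c46d3e2ad69dcfffa8ab5218f99f3000000000000000004ec685ba22aca61a2106d490002a7f011f88568b7fc919d54d5821c88a266134475cd21c154cc142ee0aa154ebe12839bd52f783704269b2552a1a87754a44adf080e5cca2379b91cccf96cc6562d8e928ae290f19c6ac6b910c30b2a477b1cbd06dc5f49332efd284ff8ce3ca76cef3de6caa579f3982efd284ff8ce3ca76c8eca0dc53dc9cf893ef2720c42c42acf5861a7ca14367e17bee61279b683e839003c580972915df319d20866ec3ab5307dba0493e3df27711e3c9059bb2ae43a531e392309c7be2897b8905056c624295da8ea05c42e3c8e27d719ac28686623945ec53cdc0f99a4f66d020139853e8681f7e47c006ee42922bcc5a3c53f214a10bff456a37245ca72e846929bee57de9b77b862a1ef99ebe56db5fc5d26d086010c7e8cf2a21a18ed0472e846929bee57de9bb21ef067d83165ddead1891262603d19fefd284ff8ce3c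a76c7c3bdda907371a70fc9a122bb40174ab7c97c9126e2ef0b0a4ca64e9399bb86a709a8e2abaeb5665b2b7e776913d3ce775d80473924fda88ebfa7d16225293b7c4d558e5,
  0x6ff284c0a7fddf8b46ff284c0a7fddf8b439b6182887dde73df2b8efa42d7369219c6ceda6ec614de05d86b77f5c1934a1e5292b402831ae6f970e045aa7fc3aafaf734d26a7bc21799aac8b71613bcb4b9cbfdbf3202c2f351fec13e3958960c489ba432926110fab4f3bd42fd014c421388359fda0ba22a5288cfca8055137e6caef726d8086d445aa7fc3aafaf734da3296ab174e17c4962e6bf7c217a3d088c9c0e10d3ed1ae5da020b55fb5ebc0ab88b989ea235b23290c41b6509f7d19e4c8ba4e64089fc1e085e16f28deef1b74392d4a0436a73fe6ecded7f7556c2592cd7310fc58eaa6e43f8e4b89b67c7464284de83f6b6a935f326f37978d0d5258c96c7231f34d9786c7a915038c3d224637d8dab877dd8a12864b64c045ce03662fa681f5cd705d28e3f1a9d9a281627afc46e27a2dea669ec71af640939e35876973915e42d6b3165630c8a6925a74146db6c86aa6093a469e27a43dc84b4ab91d7854694c3b95ea7dd68b9749d2ccb741694ea4b2a01bc4b2028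a5f5d485df9405c25825e047bd4bec97bc086363c874eb3785e943fa65d0f065a439a678257f42c429987109677651798f1563458b727887b6686145410d98a9f58ee18b8c228e92a7eb852b52b35db6ffddff782f17967a92319dc6d7c81b4cc77e9427fc671e53b683d5d0a0b971f25d27bea6e1875f18689683d5d0a0b971f25d25c988a423c4393f5fa07f978cdd131d3fa807b47b1fa2d66091a1ac46b548ef82d957ae3dc7c3861a14cddb71c2df5c0ece84a50d9425d7556eac786c5e32fcd976463bf898ed026ee19e70c7abf5bf23a4e93c376808c07aa9c04e7740c47b0f7785240a8a5022b8fa4fd40cd7a316dced8ee29de34f4022b8fa4fd40cd7a363583d395e68c37900a3346229fa15f3a677e9427fc671e53b6093cca13573e542db775e4e6a85f7a918c62183ac9165dcf1927aee01caa090f5a51760d5e80f3615c5afedf6a100b9d34196565e0538513b509ef8db417fb924daa8b46da017d48dccfb4548edf6a100b9d34196577e9427fc671e53b6efd284ff8ce3ca76c00000000000000000000000000000000000000000000000000077e9427fc671e53b677e9427fc671e53b6efd284ff8ce3ca76c00000000000000000608de66323ad2d37d0000000000000000070c311fb15418437bb5bbec28248ed1252d150f85e38eeb16f80db9e6c0342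c7bc2885a3293ffa9e60fde6ffddff782f17967a7f71fb9bdd9743ee833630a2acff601fd79ccf22290832d46276ffddff782f17967ae447757c9fe82b775e7e7227749635ea30efd284ff8ce3ca76c808c07aa9c04e7740efd284ff8ce3ca76c6fbe3f3878f4a78906e38c2ecba0b127c376a8070e1212b6521813a15f2f3d2f4181868dd21b23dbbfe469546690cf10d75af5,
  0x736c351109993d8b0784cd85ab6c8d6d5277e9427fc671e53b672e846929bee57de970a5216149aefb54577c8e9dc491df128b0e27e63ce0a1c59c6731ed9f38225498de00f4194f0d79324b6000000000000000000d33ccedd3289351077e9427fc671e53b62db32c6e42bc48b909311babefe1fc00a240582019e036b605c77e9427fc671e53b669ca181aaac31c738d961fd032a1e72e951875feae722f376a4617396011aafaedbf703af1841f6c934c1e2841675462540b8f96ba71ce90db53177ee7f64a43e18aef940000000000000000077e9427fc671e53b677e9427fc671e53b6ead1891262603d19fe82ace061fc9eef5fead1891262603d19f0000000000000000077e9427fc671e53b6039facfaa97b332bb01e6501ebbfbbfbbe01e6501ebbfbbfbbe79cf929e826da4f74084a702f77d9c8f718033b2af3e4bae3277b88ef7a6fed186717894a747521d8fd5966e906f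3a87b59961ded249736eed3ed1770898fbc88728c3f3d5268a51760b1ba947833f33cdab5af2c1e00d34ca9f3d53f32dbd2a927eb08b1affded249736eed3ed172af3d1cd0eb5da3d3458330113a8e716bb0000000000000000035a4eff4d6b82b8514297146986c36be537a6f1d7b2a853ad370b69f7b6df6d686a1816cea17e9e38de9914b03b6dc89f55ca2428bea4269f7f166739b0f4c6d50beabada557c5211c6f9a91e528f99e5267b2d888579095d250febae55528f99e5267b2d88868d5591379a0ecb6e7542877383db9717677e9427fc671e53b64db42c8114347e8765eec9e72f76fac06b5b83c14c5a66ff29869bcdb9b4ea7b31c66b4f8e74097618a298d06aa20da6c214b5134c24904ab970b1c2873e45bda0b3122a28882fc120cadee0536826614bfa4c7efa3b20e2f769e78029ba69116dbd4070742e2166dc667537d920b99501ee63ba9be5c15483adc9fc13d3ed771d71d8d256aee8be5fb3432a07ee9eafdc4aa36e0a97222a15687bc993e81dde9d1ad0f092b6b29257cdca78dc64eced12c3ec69a0db140b930b63820ee5fa52ae4bbca9d56f8481f9ffd824401d5f3113dd378965f5b3fb18d3b32bcc66e906f3a87b599619f7a129032fe8aa1a8fd8c29b8cf534335d47ae072b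110e6bc30d706a8da3b6070c25de587ac082b1809150c74a2764630bb84a3041747bea8d8e7f6caf810c804476f5cd72858fea30055250561cb3d2a8b40ecddce05f6526f25f409359d7a2d77f037d75dba077f03d256eaf04bbcd3dfae7858197de3dcf465206e1ef1a5e143e20d7914c9c5cccf210feeb9199d7c496fd7a6c0ce4da3c265a69202dc683827f7e49ab6605157bfcff366c9ca7a2678e81bfdcbcb4145cf0c8f582f9605ca56531dbd2a927eb08b1affc9b4e1d25af302c1886cc6d35129379a0b86cc6d35129379a0b,
  0x7c664fee834a8cebc61e3aac56e5b486664a7786ed27226f1112e3c8e27d719ac2864858183b1b3a9dead7cd05d5eb0fadc419246a3f25f92039f5c634e33e441788feb50000000000000000005335b27b77947e4d00000000000000000537f0359cd51ab45a025e574fbb72fab3555a6477ca0b2c258420ee5231daedd6ca7532caaae1ab7979dd34b9374ad80120411aca279ca9e73057c700000000000000000618342781e10b74555ac3d0bc7a1450a93afa438b14df53191692b4b9f57f625dc58ec1b53dcdca9f84075ee7b732a52e56b4e7d60d3452243fcda4731c7aa1f5e7a79f972e846929bee57de9853c160ee16e69b87916162a51903fe03f1591cf65bc2416a4151c040bb1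f6bd8d7e039facfaa97b332bb00c35f9fb9c6a4f3400c35f9fb9c6a4f34631ad2b9c414738a903a7e739af5224a562352013d9261197d927a64e663e0f2bc8a7097b5dcc9392f366401d5f3113dd37896aeb20e8e24f1fca87355693643d75ad98778917d2c04ca44b682814516d046bd56699ffd93eccaddbaa1f81bfdcbcb4145cf0cded249736eed3ed172ba21fdf1caadc36c34e66c7f3dd0dee501cc990fb7eb8887b73e8b503c456c78d251d69e30ed913279cd7375f4530cd5f01981c9b3748d746871b071ec4e8726c202ef40d8c600747532c6aa380d7447cad20546329c772ddcf37edc938b7bad975486175086602dadc6dfd5b48d6b3636042576a32da5ca241ef828f1e5ec596699e75d479a7af63c8d61e5f2537ca779656c84cdb15ae9e2fcfcab3519bda7114bd72048441bf6ffc5cf93d9f8e34b06446415199de8d6dafc3715bd58b72f5c057697a94bb8a963aa5ea0ad306673b4f5cf4806100227972583f741438da74c9b5659887944512706ae00c764a03b43285e2760e0b2253975f3eaf065107907384a1e4c15a348e30472cc408b2852376b16d94f51479362a9d0a205322ce7d3b20e2f769e78029b9bf9a801a37f52f5f58479a3d146ad93168a85f2b954349a04c8aede4d7bb2eae3ecac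ece405650cbb46359628de907e4e09489bfb314cb665b71f436d2ecf23718a9d616f987ba4c12147a2e69ca181aaac31c73865174fd2b9c0b67bc4de361d88ebd7b5229ddcde8543c954489000000000000000002a17efe5c81106fce3d6a526ab13cb4a8a7d5973410b6a6a709480665c35ba7e3e24b16b42367cf7551cd247c081af72bbd58f7689a1bedffdafc8f299eacac3597006ed7201591a302394cb56caf810c804476f5cb9fab11af271e4aa0463bcaadd433c287d88b7f96e94d29586d9b0b9846d1264c3609fbeb97202761a5c3538bd2bc1b21d4eef9ddf4def211996e8b7696222477a6c9bde9c4b7354cfb974c2296ba71ce90db53177961a9a9f4a7e8853f77e9427fc671e53b677e9427fc671e53b6,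
  0xefd284ff8ce3ca76c77e9427fc671e53b677e9427fc671e53b609c7be2897b89050509c7be2897b89050509c7be2897b89050579467954e33e9b69a543a520853e2aad361e82a898692a4ac0703b73122b039d23652308da8af29104533402e4c4e3eee98e561e8ffae21f7adc17224bdd9d1bdf68250d0000000000000000043300b34ee70c4fa545aaea0386a8246809ca5da51722c32d8f000000000000000000f67b373cd800d6b4246a3f25f92039f5c9c5381a5bf921f31272b5e7580ef89d569ea9f29d7d56a8291f90eacdcce7b573c1e6aa2e29e368c269aa610f3854aebf12dee2922bcc5a3c53f2142d2a7a92ec507d2196337e495e114cf66519018b4d21438e8684852b41654ab165fd00f4194f0d79324b600000000000000000158478742c8a5aefb682c7c080c09509ef18a07bda31d68929c30249822ff3e4ae330496cea078849f8db5037aa90f6e67e2dd36d2ecf23718a9d618f2bebce6cefbaeec000000000000000003cb6da46cca63affd23927d35ae96ae9e495dba226d54f5c0b27696222477a6c9bdeee7f64a43e18aef944beeb877565f28a9755e89786ffdb0c58d0e84660ca5227400d3e6742c90fec7559f37fa21a96c442f737727911be8179600630000000000000000077e9427fc671e53b60000000000000000027712d57a7768f8c927712d57a7768f8c999ba5248c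e2f3cf975233f14f6e5f3a372538711aabd2a55b4a3402992fea52971e957c4f2d5ad3d5be1d77e9427fc671e53b677e9427fc671e53b6356d13bf05d3123c6671a8b90f81134eff338da83c24768ec8e6d6cf019cf771d86f9c46b24371c1f587dc23cbdb2cc69a7352192d9149e6cf7388556d17dd878363c2340fc7bd3c58696ae453dad4b8998f8da11b12ddcbcd89794a0c8768e33d88635c9af607b00c9910fd82f6c7cc2234eb34dd476819d7e3232e9e5419d5f02b686c7a4daecb4a03b43285e2760e097b7726b8f9f7b4c63f23b3cd3c69476e9803a095acbc282d3e77e9427fc671e53b694eb940407d34b946a1ef2326fe264f24ac7e2bf2c7b7dbe31d45aaea0386a824680654c924638af3072034b9374ad8012041187db9b48ce2ee6b8c966ff71684fee9e24ba81e5e374f2bbc621304a257f4bcc90363eaaf9ce9b003d9c521dd313b92af1cbeb7c5c90ac800dda5d45627833effbdf4e48b14734c3477751a47253faed322d4033118610606577193a5f93187ae39bb50525fb6b66f6176650e11dc480665c35ba7e3e24a6c2e0eeccc4935bf5be1ecead3f1c8acba3fb64b748c7d37708f761f05947e980f2710d45c0c046f94f77e76af7419ee0a1f69e36b8acfcdf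cf42a72b5e7580ef89d569849c4efb676d2749292b4b9f57f625dc5896e671d3206c4544e8c09aee12dbe92ac58d85d8e634fe085ad,
  0x8dac2fe1cb26462296fd5b9cd3ba8b5a6658ab61ff4d13ea080401d5f3113dd378963f5836e33beeb42fd66e906f3a87b599612cf30c77b05e757ab62fef15dfb31b0b6601f2f78a9527e64100153205b4ecb1b7d8000000000000000003aba97862ec13f84c0c790e9b5c525e2233b20e2f769e78029b21b519cc3263cc50c1d0251844161665902873e45bda0b3122a8d11024b55c3a5ac412f24ec924ee6149e5fb3432a07ee9eafd460f202cabca5c16a9cff6bac08dc9661599501ee63ba9be5c1efd284ff8ce3ca76c27687b092c5c62b84817b47746350b77776a50efa674bbebd9181bfdcbcb4145cf0c8a0709d556879429ddbd2a927eb08b1aff0000000000000000077e9427fc671e53b60580adfbeb7e054f9213daef140919921b213daef140919921b9926f17107037e5d10d706a8da3b6070c26caf810c804476f5c50c74a2764630bb84943a1de7468f79fb45de587ac082b18091c85e5f9e2ae6f63854fd98c158d8947e19bbcd3dfae7858197d53947b1a63d8b6899c5fd0f9e3ecc96756ce05f6526f25f4093efd284ff8ce3ca76c143c376ddc1748b7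e2bd1428716bc065822bf132cca30f9304a793c62db153d00b8e2fc0b70292afba9d0936dc2147d0a572080ff52320ed9d0fb0d87de65a0b40ef4ec318855053e03ace52f5c24a84d5676752bb53947b1a63d8b6899c29ec88d181e5102e7b512b3292b2777e6d86397e94d8b595f1906e92d3a6acb38e595bfb89455ef75b7977e9427fc671e53b6efd284ff8ce3ca76c0d9493d1d28f2b28d2a14779de3c4983ac7c9405b494d07b06cd355d96558d8ec52b7d4d386802c6eccc5e0ffb6dfb54259d9f08515d9747168ec5969ca181aaac31c7381af65142e490fc1257bcf164d1e28cede99311babefe1fc00a2dd47d0d081d55c8c820244faa19348959996ba71ce90db5317777e9427fc671e53b6b4eb8ba376feee6cc617396011aafaedbfc0e6d9d26ef25cad177e9427fc671e53b6e67df1dcd786aa5a7efd284ff8ce3ca76cefd284ff8ce3ca76c83b216fe250f012f0e67df1dcd786aa5a772e846929bee57de972e846929bee57de977c8e9dc491df128b7f0d0afac5e0db0fc7a8ffd8c0908335f67a8ffd8c0908335f60000000000000000066e906f3a87b59961733e7f4af8134f7008994e2d370141b7ae8033b2af3e4bae327efd284ff8ce3ca76c74e9a234428d5819edbd2a927eb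08b1aff7c9405b494d07b06cddc1286be45a89c72d5268a51760b1ba94dc863d14b40a74a577ae8e2cb4a56725ce8fa0fa6b357601308efd284ff8ce3ca76cddc1286be45a89c727a8ffd8c0908335f67a8ffd8c0908335f6ead1891262603d19fead1891262603d19fead1891262603d19f7a8ffd8c0908335f67a8ffd8c0908335f602a6bb0c42964e240,
  0x77e9427fc671e53b65ae6f0fb85107ee263f23b3cd3c69476e936d2ecf23718a9d617c9c0ac7b7744b33269ca181aaac31c73819d7e3232e9e5419d32be6f1c2d6b5e68807b00c9910fd82f6c02d72bca242193bba000000000000000003b8be7aeec1c341b50fc7bd3c58696ae454a03b43285e2760e0192d9149e6cf738853a4555f1350b1ca0706100227972583f7473263e4022480c3e217107d758cda126f23b20e2f769e78029b32f6bb5e7fea658e27febfc0e528088fb648e30472cc408b285b93bd36df0cdaf0983402992fea52971e95426e8da0387207825233f14f6e5f3a3727696222477a6c9bde788919af0cceaffee96ba71ce90db5317700000000000000000507815281efb55aed000000000000000000000000000000000000000000000000000724924f126b8ad6ce0e84660ca5227400d480665c35ba7e3e244beeb877565f28a976def63701cf6018c02a17efe5c81106fcea20132658e82ec3842a9e1271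5444778726caf810c804476f5c2fc0b70292afba9d081fd8422ecf587ccb7689a1bedffdafc8fc9f6dc23af43d7ab60496cea078849f8db2c48668f4810069b418a07bda31d68929c60652636f90a2381f32f6bb5e7fea658e29f5967746f136042e00f4194f0d79324b678dd5bced3eb1786c19018b4d21438e868489819b6930a5d621460f202cabca5c16ab0c495be9f13ae010610f3854aebf12deeafd5be0ed16bb8f9090eacdcce7b573c1e9e312dae779b3262a725d560387300f7ffd846557eb4eac2a7b2d52fa4f441a273f953d2faa7a2cb631b4733e7f4af8134f700ab16885c9bd51e5e483a2712233f340d4be11f58b0efcb1f3c20000000000000000034b9374ad801204111e8ffae21f7adc17271bb639027f63f01b55a6477ca0b2c2584cb3132acabb1ace051e82a898692a4ac0792b4b9f57f625dc5879467954e33e9b69a9cf569cc55cdd5d1a618342781e10b7455d96c84f7e4829c80b77e9427fc671e53b6e60ac6d6f52b3a267efd284ff8ce3ca76cefd284ff8ce3ca76c77e9427fc671e53b6efd284ff8ce3ca76c2e3c8e27d719ac2865bae49ba76692252b7cd05d5eb0fadc419ac6187a35c32239227539dc44c989ccce4de5050a4b85a416cd09549322b55d201c5401d5f3113dd378962d5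2fa4f441a273f9597903d24dc80ca182352013d9261197d997935c83a980da1391ad6d5c90b99035ab81bfdcbcb4145cf0c0d9493d1d28f2b28d7c4f76c0e9b6f829f78917d2c04ca44b68bb242c478dc67c5974bb14ae20de87310178eeb2d5d942d036a7ae8e2cb4a56725ce8c2154bd2d919fdc36ea23428585ea2418a0d96c5d18b12eafd72e846929bee57de977b50e706c78957a6916162a51903fe03f840e8f15fe077986e6fd9cba6ad4e289c36fd9cba6ad4e289c3,
  0x8aede4d7bb2eae3ec55ea43521c93d833f58479a3d146ad931645aaea0386a82468024c6de81d0441ec3b34b9374ad801204112376b16d94f51479338b6234b5634ccccc07907384a1e4c15a33696b1919c161b6d42af401cff3dbc1ce26fe688f13a63417b61438da74c9b56598812ddcbcd89794a0c80ad306673b4f5cf487cac46bf6a9bbe38a56d17dd878363c234b58d2f0e57d8add652a358446bcb4dffd04a03b43285e2760e03c5d5ad0da55b1201b4469d50a0c7965b77cc2234eb34dd4768ecfb593568c236bb25ca241ef828f1e5ec7b24ea87ebb9691f36602dadc6dfd5b48d72b5e7580ef89d56973b78aa22567fdbc092b4b9f57f625dc580d8c600747532c6aa4d682e3f42f30c5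fd1c9b3748d746871b022982b4176f66967205435295eb68f739c7606649100aa7b7171cc990fb7eb8887b75627833effbdf4e482ba21fdf1caadc36c6ea4f5dfa54be28d23eaaf9ce9b003d9c5a38f99f66cb559d45192cc754555535c1b480665c35ba7e3e242574c6baedd184f059d5e093ab4436a2bb8610606577193a5f9d8b9f4121ab71c69e27a64e663e0f2bc8a2ef7db093b47e1cda03a7e739af5224a56583f287be362f06334bc338fcbcc3ffd979659812d3f1bbdd54039facfaa97b332bb7ac58fdab6267373d1591cf65bc2416a413bbad12a632a2307929c8aebf50813f8f39e1244446d77f19ee731c7aa1f5e7a79f9781d768f206b34fc65ee7b732a52e56b4e5970266d495c3f1607ff8b958df95a1da977e9427fc671e53b64aabda8bfb178814d76e3d229b3a0fa4025f63f22be63716e877ae8e2cb4a56725ce813050d7348528354aa207ab486c471a9b20ee5231daedd6ca745aaea0386a824680025e574fbb72fab3524a15252e1321d96724bdd9d1bdf68250d7e17216f64ed8b7510000000000000000072b5e7580ef89d569246a3f25f92039f5c39054dc17e198f45d0f67b373cd800d6b48750f5f393f1f2a6a4a7786ed27226f11194243b45167aa82417c664fee834a8cebc926be7a8db6129c0c7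a98a8bac359fda88e0ffb6dfb54259d9f09c7be2897b89050509c7be2897b89050509c7be2897b89050577e9427fc671e53b677e9427fc671e53b6efd284ff8ce3ca76c1f9043a3909ad422b36d2ecf23718a9d610b869669d748ea86a50791d8b1dd06a33e30249822ff3e4ae338f6d5ec893d9a6f4d000000000000000007696222477a6c9bde23927d35ae96ae9e45bfc5a492a4ecd4d13cb6da46cca63affdb4a01cc69318203b35169422767c0a95fb9bff8a57ea18675b88772127bbbb6aa3d98f7aa512ce509b7266c3013dd58f089a21d5662a0e8249c3a2d2922bcc5a3c53f2143ffcc6f0bb78117dc6337e495e114cf665adf6ac82bb36378027d752efc05b3baf6dddd241faf42c98632,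
  0xca78dc64eced12c3e7bc8113372a5c7491687bc993e81dde9d1335602e843669e5ba50c7ee025a2aed88e0a12ed7f224d6b27b5483adc9fc13d3ed75a95d2bc9d1aca9cf2166dc667537d920b0000000000000000020f8f700695faaf0b52d3195384073415728882fc120cadee0569ef0c2c2797fc2c1134c24904ab970b1c62c182b4372024ca87c9c0ac7b7744b332d2d0337b4b82641dc122e960c7c7a167cf158a2851119cff4883d2eaaf997b0a5b6ab517ed795e228af20788919af0cceaffeeee7f64a43e18aef94528f99e5267b2d88861a38351734c260d0528f99e5267b2d88872e846929bee57de97f5574f2a629023f181fc2ffee8bf5063114b03b6dc89f55ca24a0d93ab2519499f10b69f7b6df6d686a101e6501ebbfbbfbbe02519e5a1041a670564b22afd6e7368e75000000000000000004244528aefb9b9b652af3d1cd0eb5da3d35d59e43b9a994e0ce3f5836e33beeb42fda22411c1ee665d5b42c7c678a03e04c6e25d3d47d1af99366de3b860f037634116f2b36f51833ca5f6aa88a0709d556879429defd284ff8ce3ca76c7b88ef7a6fed186717add8ab2e4416dcce084a702f77d9c8f71000000000000000006192def74e7119308663da22c1ccfaefbe039facfaa97b332bb79a29f5bb3f158ab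30000000000000000000000000000000000039facfaa97b332bb77e9427fc671e53b677e9427fc671e53b60500fbed2a838d5cd00000000000000000000000000000000007542877383db971760000000000000000063312adfdb525667c60318a94576dc94640000000000000000002ffa04b83e48d2187542877383db9717677e9427fc671e53b640582019e036b605c40582019e036b605c2db32c6e42bc48b90128ab42f0b0e6dea417107d758cda126f274036eb26ebafb98300f4194f0d79324b678dd5bced3eb1786c0e27e63ce0a1c59c612f24ec924ee6149e12f24ec924ee6149e8adb9148eb604685477e9427fc671e53b67cea3e6cf0f572983736c351109993d8b073089f3619424bf147542877383db9717677e9427fc671e53b609549322b55d201c509549322b55d201c50000000000000000062cbdadeb277a92b76c206e0167d4c947cdab51d5e78e98e66d2bf132cca30f9304a2e8d86ecd0382bcc0143c376ddc1748b7e5c64c2eb0fd9735642a9e12715444778727696222477a6c9bde0000000000000000077e9427fc671e53b608def50d122c4ac215337d326b4378d5414fd98c158d8947e19c7c2ce9553fb2d1cf5b695eb3b53c78297c5be0d61a91f323c069133c2e11a5e5b0b6c9c4f14b6ac026b172854c978a1cddaa7db9bc0f778ed524901ad6d5c90b99035ab176eed163f587117b74e9a234428d5819edab51d5e78e98e66d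77e9427fc671e53b6efd284ff8ce3ca76c,
  0xda017d48dccfb454863f41ec7e96e57f9965e0538513b509ef80288164bb54c46768009be18e8b05948090463fa4a885ccf56f62183ac9165dcf1925f137b7e3c3ebeaf7093cca13573e542db09c7be2897b8905055dc28b94a9a871f1a7cd05d5eb0fadc419022b8fa4fd40cd7a316bc94eb6549ef3c9022b8fa4fd40cd7a36337e495e114cf6650a12ed7f224d6b27b77c8e9dc491df128b097e37c79810a6fd26dc7b15f38c1a79d0725390db11b193b40916162a51903fe03f81fc2ffee8bf50631ead1891262603d19f807b47b1fa2d6609156b8437c77afc86b25c988a423c4393f5f3402353525a25bf1b311c886bd2fe4c7856dc7b15f38c1a79d077e9427fc671e53b66bfcb45ed371d819a6ffddff782f17967a55b584b0719b4356455b584b0719b4356455b584b0719b43564651798f1563458b7264792508bb60fce4f5d0f065a439a6782555b584b0719b435646fd5b9cd3ba8b5a666fd5b9cd3ba8b5a66549b6f4e14898f1656b7fe41540e0ffdb6566382281ec6348536a2d8e9ed8056f7f3817b47746350b777786cc6d35129379a0b915e42d6b3165630c7ede5faf38415fffa46e27a2dea669ec710f67b373cd800d6b43a205faf9b87110ca6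18342781e10b74554637d8dab877dd8a195bc650e7a8ce28f15258c96c7231f34d951d5915ae86b14b6d4cf66c72f7c47be5d688b78a90c245c303556c2592cd7310fc53eaaf9ce9b003d9c528deef1b74392d4a05d5dbd9ccbdd2505f77b4e9f87a1a8f88477e9427fc671e53b621933551e8d05e3782a17efe5c81106fce1441942637eebb78871e847fcd196bdd3a830b829130693b31da2aef341f6196e00f22a5288cfca8055131c21bc159c41e21f5110fab4f3bd42fd013cb6da46cca63affd158a2851119cff488617396011aafaedbf26a7bc21799aac8b7887d41ec86409407a2b402831ae6f970e05d7eeaedc9e68514962fef15dfb31b0b66a0013a81abbeb9e7c39b6182887dde73df8610606577193a5f96ff284c0a7fddf8b477e9427fc671e53b6830b829130693b31db7d23dfe8285717432e8d86ecd0382bcc05de587ac082b180912bd1428716bc065826f441646f8e8749b267bfa85e67e450dc4b73d6e47bb36c479d2ec9f5259209cce686b7fe41540e0ffdb672d71d58169c0cb7978917d2c04ca44b685d3d47d1af99366ded5268a51760b1ba942e06c2c9350b777668cc3dde37b7e874cc274d3ca9093bdbbd272a27d71a782a726377e9427fc671e53b6bb889a793cad8c142349262e605c4e08f47689a1bedf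fdafc8f77e9427fc671e53b6b181f58d48e51aab367bfa85e67e450dc4ab1687f828915588677e9427fc671e53b6ce05f6526f25f409387de65a0b40ef4ec3a39b6696092288be59e6db67f25f2bc7249e6db67f25f2bc724,
  0xef3de6caa579f39827754a44adf080e5cc7b1cbd06dc5f4933203337a8715ed63f7c164c2d108fee136f30288164bb54c467687754a44adf080e5cc4d064b38d8aa5ccbc154ebe12839bd52f709c7be2897b8905051fc39761b137c3a2d2e3c8e27d719ac286106d490002a7f011f00000000000000000000000000000000002922bcc5a3c53f214335602e843669e5ba72e846929bee57de9097e37c79810a6fd23402353525a25bf1b2faf9a0be4dd26bc272e846929bee57de972e846929bee57de9ead1891262603d19fc15238fdd1c7bb1796201fcea5c8ffd4bf5d2b13d877723b246000000000000000001e6b63263f21acb0b16bc94eb6549ef3c977e9427fc671e53b656826619513a0c1ab77e9427fc671e53b65640cb957f25104575640cb957f2510457554cb24671abddfa1812f30bc4251d24716e9e36084b769c2944033b0669c447010e5b82a966d00facdd15ae6f0fb85107ee265ae6f0fb85107ee2643bacbd7a6ec228631c21bc159c41e21f5479b7cd0cbc942cd86f0caa28733fd25a15426e8da03872078277e9427f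c671e53b6559d45bba33d9f8e24186b467cd546b9a822f6fb20fc79ca80c24bdd9d1bdf68250d10634f978104b22a455a6477ca0b2c258427b197eecf8b670d953e5a4f61a67c19743bc1517967b21678157104a799b7d534441fbf3fd261cc4a4ab6b601bc2e02e28ead56d17dd878363c23456d17dd878363c23446d7793a097111b175d062979371c72fcd71d90ee692bd8ca9c77e9427fc671e53b628da759f7c78c471006100227972583f741d047ce13c321834f622f5044d5389f07d61ba924098c683f00944fdb98bcd41d99b576fa997c70aad6466e9e36084b769c29443aa20fb969e5fff230249822ff3e4ae3369ef0c2c2797fc2c19311babefe1fc00a2397e0069621d9f55a8e68ff352f0c5e6144553f927a2644b91b5b82a966d00facdd132be6f1c2d6b5e6888da334bab7ab2b6ef61df0a4823f86237f7cc2234eb34dd476871d90ee692bd8ca9c77e9427fc671e53b661ba924098c683f0092cc5b8655c75779f40582019e036b605c2873e45bda0b3122a2c48668f4810069b48472693cacb5a18bf5c9a497f92a6a86f398c23a85f1667732860750ffb8dacb465764792508bb60fce4f464e09f45097947dc2352013d9261197d94244528aefb9b9b658033b2af3e4bae327580799d3286440bf7887d41ec86409407a5426e8da03872078277e9427fc6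71e53b6507815281efb55aed80c5dad719a3f81cb36edc22a20648305348e30472cc408b28577e9427fc671e53b694eb940407d34b9465c9a497f92a6a86f3944fdb98bcd41d99b78dd5bced3eb1786c99501ee63ba9be5c178dd5bced3eb1786c9a85d2b91b37ec7cb9991b96a0dbeba3159991b96a0dbeba315,
  0xcc7bd6b135d80dc9055b584b0719b43564549294316f66288da00c35f9fb9c6a4f3402519e5a1041a670501e6501ebbfbbfbbe549294316f66288da4cf66c72f7c47be5d178434fef390d61b60000000000000000005435295eb68f739c3c24b972a468c5b7e156f0c6153c59ca5729c772ddcf37edc931546408364c65a27c42e1f080e3befd01b2fa681f5cd705d28e81cee717439f11f8e039facfaa97b332bb39b0f4c6d50beabad29c8aebf50813f8f38b5b344fc8d92e9e17bea6e1875f186896e7e7227749635ea3062f25fcc5769fe326566382281ec6348533689cfa5cd1b2750c2814516d046bd56693b860f037634116f27833f33cdab5af2c10ff52320ed9d0fb0d274d3ca9093bdbbd200000000000000000000000000000000000580adfbeb7e054f96d74cd5ac452dada200000000000000000299eacac3597006ed17b4fb5ec6f84a4cc6732c1481a4abdea525af3830b9a34c29f9d987ab080153165508def50d122c4ac2159d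7a2d77f037d75d18855053e03ace52f906e92d3a6acb38e587de65a0b40ef4ec3efd284ff8ce3ca76c000000000000000001441942637eebb7881375a65fc8a50d9e066183b6005c44caa22574c6baedd184f05989ea235b23290c410000000000000000077e9427fc671e53b617b4fb5ec6f84a4cc5b0bdaf887a54ef8e50c74a2764630bb84b47455394ebda83bc3f776fba111576240aaef657ba45f9476977b4e9f87a1a8f88497585aa93fcac257677e9427fc671e53b6efd284ff8ce3ca76c23927d35ae96ae9e45a92eb1905cbb12ac77e9427fc671e53b6c2df7887dc8554fc185a778747dd17c6f8ef968f700209c71fb000000000000000005cf93d9f8e34b064411d1071fc0ad989148985f1183ac828198a01bc4b2028a5f5d4e67f2eb7c8fcd87dc232255c70ab466faa9b0b9846d1264c36077b4e9f87a1a8f884ac7ba565cc36c5caa57e911345cd09d3d0cfd253b423428278677b4e9f87a1a8f884ef9e2c78408c74c3aef9e2c78408c74c3aefd284ff8ce3ca76c8aede4d7bb2eae3ecefd284ff8ce3ca76c6ffddff782f17967a81cee717439f11f8e77e9427fc671e53b69b3ff0ce1d7da1e9293548e45d9fd361569b3ff0ce1d7da1e92000000000000000005b83c14c5a66ff2985f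63f22be63716e879d34ffddc06b0b24c898ed026ee19e70c7efd284ff8ce3ca76c69133c2e11a5e5b0bc496fd7a6c0ce4da3906e92d3a6acb38e5e0ef5a4a40c236117cbf87796d1ba4f087e0ef5a4a40c2361178772127bbbb6aa3d9c08bae2c1776c7d28efd284ff8ce3ca76cda0f979d882f698f993548e45d9fd361569b3ff0ce1d7da1e92e7e7227749635ea30e7e7227749635ea30efd284ff8ce3ca76c9b3ff0ce1d7da1e9293548e45d9fd361562356ae4e570bbcadc,
  0xce2a0e154596f580d5640cb957f25104575640cb957f2510457158478742c8a5aefb20f8f700695faaf0b0d33ccedd328935105640cb957f25104571fbf3fd261cc4a4ab0850c6db05509d988000000000000000002af401cff3dbc1ce23aa5427247804eb901b80249dec1aafa4927712d57a7768f8c90153205b4ecb1b7d825b551305812ab044202c2f351fec13e395a92eb1905cbb12ac6192def74e71193084297146986c36be534bc338fcbcc3ffd9786280c3aa73119cc88a9f58ee18b8c228ec08bae2c1776c7d285c427ae1a716c3052479b7cd0cbc942cd817a1747bf33aceb6423927d35ae96ae9e43d2eaaf997b0a5b6a703af1841f6c934c120244faa1934895995426e8da0387207820000000000000000000000000000000000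01f2f78a9527e641059b7ea6042654222d0a7c5265f6fac7b473187ae39bb50525fb0b3bc00111866c49c517e35315330e8c5a4af430a34fe00fad49fbb1d5c0b9d8dee0143c376ddc1748b7e50c74a2764630bb842bf132cca30f9304a966a0abec5cb7133e77e9427fc671e53b6efd284ff8ce3ca76c18e68bf8fecd0a4eb1d047ce13c321834f048a1114e23acbb343ec6080b0fb3d6dcf3c5d5ad0da55b12019ced3159ec493c49e0000000000000000077e9427fc671e53b6173ee60c4984455d238f3ffd87be811ade21b519cc3263cc50c914cfeb4b1bf22c6929dc43abcfaacfa495e957af6a7abefe5a624cac1957e5c21bf8ffb94c8b80522c633b13941a1296d931b9ff83441e44bf569b0b869669d748ea86a3aa5427247804eb901af65142e490fc125866685274eb0832b86519f6010b92739c0da712904f2e178cdb0c824c686021041da338da83c24768ec8e25137b3ff126800435e957af6a7abefe5a20b55fb5ebc0ab88b989ea235b23290c41178cdc85ce0cb2d3c8f761f05947e980f2624cac1957e5c21bf93ad7607eeff818b1698d6427f144a4a1ae176a6a7b7b689dd0624cac1957e5c21bfd67ebd766e1dd5210da35ee991e57a7575ee565afa85a454c8477e9427fc671e53b6efd284ff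8ce3ca76c000000000000000003c24b972a468c5b7e1d5d268d2a9b9073f7fd75cab9d47d909e694e2c5ee1019bab1d8b03e8ad55a03c0863312adfdb525667c4db42c8114347e8764aabda8bfb178814d62bf5887dd64f826050d9425d7556eac789d34ffddc06b0b24c5b695eb3b53c782975e143e20d7914c9c57b512b3292b2777e688e97e0be46870e0b669a6bd279716d7ada7f9deac72c82b6575169422767c0a95fb86280c3aa73119cc877e9427fc671e53b6972723003fcfe06ec73cab42faab4c44249b3ff0ce1d7da1e926ffddff782f17967a8b5b344fc8d92e9e177e9427fc671e53b69b3ff0ce1d7da1e9293548e45d9fd361569b3ff0ce1d7da1e92,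
  0xd65cd9a85b10a49ff5e739728949ebf6495e739728949ebf6492308da8af2910453315d580bb090b3aa9300000000000000000a4ea884d0ef6e58a57746b72f0c11bd9e14cb1dfeb0e74209a6209fbdb38c1e325ec25f10c033998ca52b456d4d99b33094eb02ac0a0e71e5b0016137fa21a96c442f7373a4498ca4af675c1a4b134fb91957260d16ceda6ec614de05d8aaef657ba45f94769000000000000000001d69e30ed913279cd4779bf94deb55abed77b4e9f87a1a8f8847c7464284de83f6b6ef9e2c78408c74c3a700ded48ffa0451d63c4edb2ecdcbbb1953396d21d70eb7e6e5246a3f25f92039f5c232abe59059e34d445ac3d0bc7a1450a93149e114a842db90524241e2688712e0f160afc9bee15957cc411546408364c65a27c178434fef390d61b678121b62173e0353340615cbb84eb2a44021dd313b92af1cbeb0bcf8cee6e11a1e40354e67bb489a86ae64b27b38120e0abd5f4b5c0c086d38018912f0b52b7b47a783213d6a526ab13cb4a8a1375a65fc8a50d9e08117bf719e1c22ef4795ef3aa9475a7465b1d0c67049d2165db664eec5f5b705f8297d39be68c558e376222f779acabd802a731e842b7ff23c0d8554779bf94deb55abed7c0b8f61f58ee31ed0000000000000000077e9427fc671e53b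6000000000000000001546408364c65a27c1546408364c65a27c8d2f83032b383f632496c52d879f6b9178250213b280d67f21c0dfa2b8442399a8b356c7eca524658e574547c0d4a443c7d9816a18a3b0b2c8a0b78219a6699be2476bc2456d4d99b33094eb011d1071fc0ad9891462c23ca9596bf74527a572d8e596ed7103b0b535894c32f25d75c9ea015f9ea2cb98356d13bf05d3123c61c61a1342198c39f821d1d1f5669148d4b2e6bf7c217a3d088c66183b6005c44caa231c1db0ad636ebc345be1ecead3f1c8acb418b3a84d3adc9ee23f1d4f7640b0d819526f80cf62db3868788d1048563377d331a26da84c52028a38fa5e957af6a7abefe5a624cac1957e5c21bf85b9e14eda1b29bf42f1b815ee445f16f5990a985a687e3c1f800000000000000000000000000000000000000000000000000062a301fc61ab8b13a62a301fc61ab8b13ada8c447c281d704f04abfcf9389d90f4832fcfcab3519bda711219a6699be2476bc24116a83037bc415474c3b95ea7dd68b9748985f1183ac82819823e1c36225400b8ff463bcaadd433c287d3f776fba1115762403e01be8f4311b41910a47296df0facfea26ebac58deec7a787843231a2b63410728477b4e9f87a1a8f88477b4e9f87a1a8f884a47678f71fabc8edb4e6a67b2ebe900710ba841d44444943c860db9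e6c0342c7bc2842e1f080e3befd01b175b5c1ca2c4b803977c0699d75a5c72396d9f9dea774107d7bda8c447c281d704f0,
  0xba0eba2c040c0dada8200dd6021fb0ef44762c6451bfafedafc1fc39761b137c3a2d36dff49b1081d6ba65dc28b94a9a871f1a5780c1649c66c3bac5a0353f0c6ed0e12c11e667a3587489f2905335b27b77947e4d15d580bb090b3aa93250213b280d67f21c0d099d9c059ad682910634f978104b22a4141bc2ba437ab913d26b872f3d13d6ddd324c6de81d0441ec3b5e957af6a7abefe5a000000000000000003a205faf9b87110ca232abe59059e34d445e957af6a7abefe5a73b78aa22567fdbc0d67ebd766e1dd5210a6310f044b38ff55675b6530af1570e0f06e7f5722327de12f02faf9a0be4dd26bc23b024267f1e90c768725390db11b193b4077e9427fc671e53b65c8bee27808a3004f6ffddff782f17967a549294316f66288da549294316f66288da549294316f66288da76f40639b25a43703464e09f45097947dc507405e153a907948549294316f66288da58ab61ff4d13ea08058ab61ff4d13ea08056719c24aa9126a5b72d71d58169c0cb793689cfa5cd1b2750c47d8a6531a1b9f1156a50efa674bbebd9166e906f3a87b5996192c30943553b441f2501f1e07b3783fc91395df24381056c6910000000000000000000000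0000000000001e842b7ff23c0d85525e456e0fcb50d99e42987f4d905e7298a08873053d2197d25f17224674b789c6b64156f0c6153c59ca576ffb2853ef9bf16ce77e9427fc671e53b605335b27b77947e4d000000000000000000000000000000000063c8d61e5f2537ca7017c2a05073f75ae84abfcf9389d90f483209fbdb38c1e325ec000000000000000000e5bde57d52d4099c468878912f5825cc45c250ef79de448ebb6358bebb7372ee5b728da759f7c78c471000000000000000000015b0ea7403c1b8c02a358446bcb4dffd03ec6080b0fb3d6dcf1201ca54ec6af195636edc22a20648305302920f7bdf22e009b15615bfa9a0251a910c790e9b5c525e223696bffd83e33474b44b750ac57cf7bb7ac26b872f3d13d6ddd31304a257f4bcc90364fda50bda897d50d14a3a59d06652849125fd6f036d4dea7b091f9043a3909ad422b0000000000000000008515d9747168ec595e85864adb24a7b03563428b3940e18eaab6de852710fbb8c8e549294316f66288da21933551e8d05e3782f0b52b7b47a7832121d1d1f5669148d4b192cc754555535c1b5e957af6a7abefe5a17b4fb5ec6f84a4cc349262e605c4e08f400000000000000000000000000000000000d706a8da3b6070c259687a40c7185942e23e1c36225400b8ff4b134fb91957260d1232255c70ab466faa501767a381463c88c31a6cd4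f84c768bf89e544fce39b2e1b120000000000000000025b551305812ab04420244faa193489599961a9a9f4a7e8853f77e9427fc671e53b6efd284ff8ce3ca76c,
  0xda5d312929ba73a96644fd2a83659174e76e48d8c141fed0f0a164c2d108fee136f313243a84726b602e9009be18e8b05948096903b4ac605e6570b4a759040d0f9512401597382499621069209c7be2897b89050536dff49b1081d6ba64858183b1b3a9dead22a5288cfca8055131e6b63263f21acb0b000000000000000002d2a7a92ec507d21950c7ee025a2aed88e70a5216149aefb545126473f225fee6d4a311c886bd2fe4c7853b024267f1e90c768853c160ee16e69b877f5574f2a629023f1e82ace061fc9eef5fef1fbb554c6b04ff4773678d585f91fc3e773678d585f91fc3e097e37c79810a6fd2126473f225fee6d4a097e37c79810a6fd2efd284ff8ce3ca76c77e9427fc671e53b6e7e7227749635ea30cc7bd6b135d80dc90cc7bd6b135d80dc90549294316f66288dad85e527b541e99a0d60750ffb8dacb46576ffddff782f17967a549294316f66288da8dac2fe1cb264622915c2ed6204b460e738a4db671ec70cc1002ec9f5259209cce6862f25fcc5769fe3260ee32ab54c219465527687b092c5c62b840ee32ab54c2194655ccb02f38822f637c254c6ecb8bbbd7e40c54c6e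cb8bbbd7e40c00000000000000000000000000000000000000000000000000077e9427fc671e53b666183b6005c44caa26ffddff782f17967a549294316f66288da549294316f66288da549294316f66288da8aede4d7bb2eae3ec1304a257f4bcc90361304a257f4bcc90360000000000000000077b4e9f87a1a8f88400000000000000000549294316f66288da00000000000000000000000000000000002000314b69a147fe6432287127455aef904356df99c0ad04ac29a8e6b0cc319ea8c943bacbd7a6ec2286328ec912ef25d263e800000000000000000122e960c7c7a167cf1875feae722f376a46250f0ce5a14d1285580799d3286440bf70dfa2b8442399a8b3003bf58f8ada035712cf30c77b05e757ab2cf30c77b05e757ab383d7a3e690519644253faed322d40331100000000000000000000000000000000005845d1cf00c1b26c4587a2a564d19081f62bf132cca30f9304a0d706a8da3b6070c2143c376ddc1748b7e3b5e2fc63e26223b0349262e605c4e08f494c6aa07053e7b7de8a4db671ec70cc100549b6f4e14898f16556719c24aa9126a5b355693643d75ad9872c7c678a03e04c6e270898fbc88728c3f31f9b7e67bbab9341b2e06c2c9350b777660ff52320ed9d0fb0d00000000000000000000000000000000005f63f22be63716e8717b4fb5ec6f84a4cc247c081af72bbd58f00000000000000000523a0a4f0cce99117286b7c96731f719dd889f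c3b772990c8c700000000000000000561cb3d2a8b40ecdd0ff52320ed9d0fb0d825db7a4c890ef9ca77e9427fc671e53b6efd284ff8ce3ca76c,
  0x765199d11c1b9cc6462f1144e2681e663175f5e5f0cf30dd7167754a44adf080e5cc644fd2a83659174e763f41ec7e96e57f99765199d11c1b9cc64676e21bce35a8e13756346736687bd638677e9427fc671e53b68200dd6021fb0ef4461e3aac56e5b4866660a33e904cb8cc6096201fcea5c8ffd4bf5f72314ac169b1aea6aa2e29e368c269aa7bc8113372a5c7491784cd85ab6c8d6d52773678d585f91fc3e56b8437c77afc86b275b6530af1570e0f07d60d3452243fcda461a38351734c260d077e9427fc671e53b67acea73fd8f44476a676e21bce35a8e137694eae24b9b9a3cbe4d064b38d8aa5ccbc4a759040d0f9512405f137b7e3c3ebeaf781e0cc5e16d42707e6550ca447c17af3e577e9427fc671e53b663c8d61e5f2537ca75e739728949ebf649547c0d4a443c7d98161aee948e6ffa6a6c4186b467cd546b9a868c10e6724df893804a3a59d066528491255ea43521c93d833f3b13941a1296d931b54c6ecb8bbbd7e40c7ede5faf38415fffa3c4edb2ecdcbbb1952f1b815ee445f16f57b24ea87ebb9691f377e9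427fc671e53b67a1ac49d7e636a1d06550ca447c17af3e5560de3b36c0f79356543a520853e2aad365a0353f0c6ed0e12c634e33e441788feb57e97d20c3b3c11cd681bfa06d14dc837ce4d15e58582d44ab04468878912f5825cc47746b72f0c11bd9e17a572d8e596ed7103511584c2456d0571455e89786ffdb0c58d56043d133017790bf31a6cd4f84c768bf86ff284c0a7fddf8b477e9427fc671e53b6501f1e07b3783fc9134e66c7f3dd0dee507d39be68c558e37624e6a67b2ebe900710436a73fe6ecded7f78aede4d7bb2eae3ec77e9427fc671e53b656826619513a0c1ab53c732a291806660d4852b41654ab165fd5a95d2bc9d1aca9cf731ed9f38225498de5d7fa4e2e6358832e53e5a4f61a67c1974803a095acbc282d3e563428b3940e18eaa38b6234b5634ccccc6519f6010b92739c0618b67eed6fd683c877e9427fc671e53b677e9427fc671e53b677e9427fc671e53b645aa7fc3aafaf734d85a778747dd17c6f87add8ab2e4416dcce458330113a8e716bb2ef7db093b47e1cda73cab42faab4c44247f42c42998710967793548e45d9fd3615677e9427fc671e53b66bfcb45ed371d819a5c8bee27808a3004f51c040bb1f6bd8d7e4a0d93ab2519499f177e9427fc671e53b666183b6005c44caa2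95bc650e7a8ce28f14241e2688712e0f1662a301fc61ab8b13a4d682e3f42f30c5fd694e2c5ee1019bab142987f4d905e7298a71ec4e8726c202ef477e9427fc671e53b66d9f9dea774107d7b786c7a915038c3d2293548e45d9fd3615679a29f5bb3f158ab3816cea17e9e38de997ac58fdab6267373d93548e45d9fd3615692319dc6d7c81b4cc93548e45d9fd36156,
  0xe7e7227749635ea306ffddff782f17967a6ffddff782f17967a039facfaa97b332bb0b69f7b6df6d686a1039facfaa97b332bb6ffddff782f17967a5258c96c7231f34d90afc9bee15957cc41000000000000000001c9b3748d746871b025e456e0fcb50d99e08873053d2197d25f0d8c600747532c6aa00000000000000000149e114a842db90524637d8dab877dd8a177e9427fc671e53b60000000000000000014b03b6dc89f55ca21591cf65bc2416a4177e9427fc671e53b677e9427fc671e53b6efd284ff8ce3ca76c6ffddff782f17967a5d0f065a439a67825507405e153a90794827a64e663e0f2bc8a2af3d1cd0eb5da3d37b88ef7a6fed186710dfa2b8442399a8b32b402831ae6f970e0000000000000000000000000000000000000000000000000000614f725f4c2364e5702920f7bdf22e009b2376b16d94f514793173ee60c4984455d2673862b8fe901e53927b197eecf8b670d99f9ada6e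95fd4c48f0e27e63ce0a1c59c65483adc9fc13d3ed719018b4d21438e868889a22468e53ac23377e9427fc671e53b6efd284ff8ce3ca76c1304a257f4bcc903628deef1b74392d4a00bcf8cee6e11a1e40664eec5f5b705f8292ba21fdf1caadc36c92c30943553b441f2000000000000000006ff284c0a7fddf8b40b3bc00111866c49c558f3b34177e2e4384beeb877565f28a97b6dead9363a19328f418b3a84d3adc9ee2a4ea884d0ef6e58a5624cac1957e5c21bf889a22468e53ac2337e97d20c3b3c11cd6ebf9700ec99cc7bf6246a3f25f92039f5c5780c1649c66c3bac79467954e33e9b69ab8e2edd026563dfa681e0cc5e16d42707eebf9700ec99cc7bf6000000000000000005ca241ef828f1e5ec0dfa2b8442399a8b3700ded48ffa0451d6915e42d6b3165630cccb02f38822f637c21304a257f4bcc90368aede4d7bb2eae3ec624cac1957e5c21bfa4e54f7d066698a6b559d45bba33d9f8e2bc632540e801922c9624cac1957e5c21bfd65cd9a85b10a49ffda35ee991e57a7575efd284ff8ce3ca76c7a1ac49d7e636a1d0ebf9700ec99cc7bf662183ac9165dcf1926903b4ac605e6570b7754a44adf080e5cc8b324f7297db1cb50765199d11c1b9cc648b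8e0352e4c5dc09e00000000000000000528f99e5267b2d8885ee7b732a52e56b4ea6310f044b38ff556807b47b1fa2d66091ef1fbb554c6b04ff4736c351109993d8b0ca78dc64eced12c3e90eacdcce7b573c1ed52fe4258a9ac96fdc15238fdd1c7bb179d52fe4258a9ac96fd7c664fee834a8cebcba0eba2c040c0dadaefd284ff8ce3ca76cc5cedb952a76408367acea73fd8f44476a8b8e0352e4c5dc09eda017d48dccfb4548da5d312929ba73a96ef3de6caa579f39828b324f7297db1cb50765199d11c1b9cc6413a4c0d31e53f6ce8,
  0xefd284ff8ce3ca76c77e9427fc671e53b678dd5bced3eb1786c00f4194f0d79324b62166dc667537d920b00f4194f0d79324b677e9427fc671e53b63bc1517967b2167811d0251844161665900000000000000000007907384a1e4c15a31201ca54ec6af195614a6fe10db4d8037a000000000000000000000000000000000020244faa19348959926a7bc21799aac8b76250f0ce5a14d1285084a702f77d9c8f710000000000000000003a7e739af5224a5676f40639b25a43703651798f1563458b72d85e527b541e99a0d7c5ba16cfb043ed434033b0669c447010e3b185a6395dd658870496cea078849f8db134c24904ab970b1c40582019e036b605c1de00a1927418db4b4553f927a2644b91b0000000000000000000000000000000000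07b00c9910fd82f6c61b944ffb02dda7d715b9f23af1394633919d7e3232e9e5419d02fcf11297ec1b7621de00a1927418db4b397e0069621d9f55a5c7c441d5ba0c58562db32c6e42bc48b9028882fc120cadee0518a07bda31d68929c89c74a0f96af9ddd8812f30bc4251d2471cf58ec178d7c929fc1f638a2b8e4e53d4746d7793a097111b170000000000000000018e68bf8fecd0a4eb0ad306673b4f5cf486358bebb7372ee5b70000000000000000071d90ee692bd8ca9c02fcf11297ec1b7621f638a2b8e4e53d47192d9149e6cf738859116d3c9ad4158c3b2e8f33a6af99a937e5640cb957f25104575b82a966d00facdd177e9427fc671e53b65d7fa4e2e6358832e9f9ada6e95fd4c48f025e574fbb72fab350d099d9c059ad68291e8ffae21f7adc172514c7238b902caa7d61aee948e6ffa6a6cbc632540e801922c9000000000000000003402992fea52971e90bca65b9881b6d5655c427ae1a716c305222a5288cfca8055139a8e6b0cc319ea8c90000000000000000077e9427fc671e53b65b82a966d00facdd17c5ba16cfb043ed43576fa997c70aad646cf58ec178d7c929fc5640cb957f2510457ce2a0e154596f580dce2a0e154596f580defd284ff8ce3ca76c77e9427fc671e53b6efd284ff8ce3ca76c022b8fa4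fd40cd7a322a5288cfca805513106d490002a7f011f6ce4f263e6034f51660a33e904cb8cc609d52fe4258a9ac96fd77e9427fc671e53b6528f99e5267b2d888731c7aa1f5e7a79f96e7f5722327de12f05c988a423c4393f5f773678d585f91fc3e77e9427fc671e53b6687bc993e81dde9d1610f3854aebf12dee5f72314ac169b1aea5d2b13d877723b2466ce4f263e6034f5164a7786ed27226f111762c6451bfafedafc77e9427fc671e53b65f7d720dff4d9e165694eae24b9b9a3cbe8b324f7297db1cb5065e0538513b509ef86e48d8c141fed0f0a7b1cbd06dc5f493328ad69b924af05d60275f5e5f0cf30dd7168b324f7297db1cb50,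
  0xefd284ff8ce3ca76c77e9427fc671e53b68149db6cb1e0222571e82a898692a4ac0711e667a3587489f2900000000000000000889a22468e53ac2334d15e58582d44ab0410b0dfc6c7e1c6e7d178cdc85ce0cb2d3c4cb1dfeb0e74209a631c1db0ad636ebc3453ed19aef7792e24c0e84660ca5227400d000000000000000000a7c5265f6fac7b4739b6182887dde73df383d7a3e690519644395df24381056c6911cc990fb7eb8887b722f779acabd802a7340615cbb84eb2a440556c2592cd7310fc58aede4d7bb2eae3eca4e54f7d066698a6b68c10e6724df8938039ce9c74d767d121f00000000000000000141bc2ba437ab913d20ee5231daedd6ca7673862b8fe901e539803a095acbc282d3e1d025184416166590000000000000000000850c6db05509d9881f937029abce734be24584100ab6861c440fc7bd3c58696ae450000000000000000015b9f23af1394633961df0a4823f86237f61b944ffb02dda7d7000000000000000001438da74c9b565988048a1114e23acbb3424584100ab6861c4456d17dd878363c2349116d3c9ad4158c3b558f3b34177e2e43856043d133017790bf000000000000000000c824c686021041da3a4498ca4af675c1a5c9ea015f9ea2cb980000000000000000077e9427fc671e53b600000000000000000000000000000000000153205b4ecb1b7d877e9427fc671e53b639728444faf8267451b80249dec1aaf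a490bca65b9881b6d56514a6fe10db4d8037a618b67eed6fd683c8614f725f4c2364e571c61a1342198c39f82ac0a0e71e5b0016125137b3ff1268004353ed19aef7792e24c511584c2456d05714b6dead9363a19328f77e9427fc671e53b65233f14f6e5f3a37239728444faf82674517a1747bf33aceb64110fab4f3bd42fd0128ec912ef25d263e81f937029abce734be3f23b3cd3c69476e92e8f33a6af99a937e3b185a6395dd6588743aa20fb969e5fff289c74a0f96af9ddd84684051dc4bc7ba905640cb957f25104575640cb957f251045778dd5bced3eb1786c53c732a291806660d889a22468e53ac233022b8fa4fd40cd7a300000000000000000000000000000000005f72314ac169b1aea5f72314ac169b1aead52fe4258a9ac96fd77e9427fc671e53b66602dadc6dfd5b48d496c52d879f6b91783396d21d70eb7e6e546e27a2dea669ec7154c6ecb8bbbd7e40c4b750ac57cf7bb7ac58479a3d146ad931629dc43abcfaacfa4939ce9c74d767d121f22f6fb20fc79ca80c514c7238b902caa7d26da84c52028a38fa5e739728949ebf649624cac1957e5c21bf8149db6cb1e022257560de3b36c0f79356b8e2edd026563dfa6093cca13573e542db15973824996210692154ebe12839bd52f75f7d720dff4d9e16556346736687bd6386c5cedb952a7640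836,
  0xc5cedb952a764083656346736687bd63865f7d720dff4d9e165154ebe12839bd52f715973824996210692093cca13573e542dbb8e2edd026563dfa6560de3b36c0f793568149db6cb1e022257624cac1957e5c21bf5e739728949ebf64926da84c52028a38fa514c7238b902caa7d22f6fb20fc79ca80c39ce9c74d767d121f29dc43abcfaacfa4958479a3d146ad93164b750ac57cf7bb7ac54c6ecb8bbbd7e40c46e27a2dea669ec713396d21d70eb7e6e5496c52d879f6b91786602dadc6dfd5b48d77e9427fc671e53b6d52fe4258a9ac96fd5f72314ac169b1aea5f72314ac169b1aea0000000000000000000000000000000000022b8fa4fd40cd7a3889a22468e53ac23353c732a291806660d78dd5bced3eb1786c5640cb957f25104575640cb957f25104574684051dc4bc7ba9089c74a0f96af9ddd843aa20fb969e5fff23b185a6395dd658872e8f33a6af99a937e3f23b3cd3c69476e91f937029abce734be28ec912ef25d263e8110fab4f3bd42fd0117a1747bf33aceb6439728444faf8267455233f14f6e5f3a37277e9427fc671e53b6b6dead9363a19328f511584c2456d0571453ed19aef7792e24c25137b3ff126800432ac0a0e71e5b001611c61a1342198c39f8614f725f4c2364e57618b67eed6fd683c814a6fe10db4d8037a0b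ca65b9881b6d5651b80249dec1aafa4939728444faf82674577e9427fc671e53b60153205b4ecb1b7d8000000000000000000000000000000000077e9427fc671e53b6000000000000000005c9ea015f9ea2cb983a4498ca4af675c1a0c824c686021041da0000000000000000056043d133017790bf558f3b34177e2e4389116d3c9ad4158c3b56d17dd878363c23424584100ab6861c44048a1114e23acbb341438da74c9b5659880000000000000000061b944ffb02dda7d761df0a4823f86237f15b9f23af13946339000000000000000000fc7bd3c58696ae4524584100ab6861c441f937029abce734be0850c6db05509d988000000000000000001d025184416166590803a095acbc282d3e673862b8fe901e53920ee5231daedd6ca7141bc2ba437ab913d0000000000000000039ce9c74d767d121f68c10e6724df89380a4e54f7d066698a6b8aede4d7bb2eae3ec556c2592cd7310fc540615cbb84eb2a44022f779acabd802a731cc990fb7eb8887b7395df24381056c691383d7a3e69051964439b6182887dde73df0a7c5265f6fac7b47000000000000000000e84660ca5227400d53ed19aef7792e24c31c1db0ad636ebc344cb1dfeb0e74209a6178cdc85ce0cb2d3c10b0dfc6c7e1c6e7d4d15e58582d44ab04889a22468e53ac2330000000000000000011e667a3587489f291e82a898692a4ac078149db6cb1e02225777e9427fc671e53b6efd284ff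8ce3ca76c,
  0x8b324f7297db1cb5075f5e5f0cf30dd7168ad69b924af05d6027b1cbd06dc5f493326e48d8c141fed0f0a65e0538513b509ef88b324f7297db1cb50694eae24b9b9a3cbe5f7d720dff4d9e16577e9427fc671e53b6762c6451bfafedafc4a7786ed27226f1116ce4f263e6034f5165d2b13d877723b2465f72314ac169b1aea610f3854aebf12dee687bc993e81dde9d177e9427fc671e53b6773678d585f91fc3e5c988a423c4393f5f6e7f5722327de12f0731c7aa1f5e7a79f9528f99e5267b2d88877e9427fc671e53b6d52fe4258a9ac96fd60a33e904cb8cc6096ce4f263e6034f516106d490002a7f011f22a5288cfca805513022b8fa4fd40cd7a3efd284ff8ce3ca76c77e9427fc671e53b6efd284ff8ce3ca76cce2a0e154596f580dce2a0e154596f580d5640cb957f2510457cf58ec178d7c929fc576fa997c70aad6467c5ba16cfb043ed435b82a966d00facdd177e9427fc671e53b6000000000000000009a8e6b0cc319ea8c922a5288cfca8055135c427ae1a716c30520bca65b9881b6d5653402992fea52971e900000000000000000bc632540e801922c961aee948e6ffa6a6c514c7238b902caa7d1e8ffae21f7adc1720d099d9c059ad6829025e574fbb72fab359f9ada6e95f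d4c48f5d7fa4e2e6358832e77e9427fc671e53b65b82a966d00facdd15640cb957f25104572e8f33a6af99a937e9116d3c9ad4158c3b192d9149e6cf738851f638a2b8e4e53d4702fcf11297ec1b76271d90ee692bd8ca9c000000000000000006358bebb7372ee5b70ad306673b4f5cf4818e68bf8fecd0a4eb0000000000000000046d7793a097111b171f638a2b8e4e53d47cf58ec178d7c929fc812f30bc4251d247189c74a0f96af9ddd818a07bda31d68929c28882fc120cadee052db32c6e42bc48b905c7c441d5ba0c5856397e0069621d9f55a1de00a1927418db4b02fcf11297ec1b76219d7e3232e9e5419d15b9f23af1394633961b944ffb02dda7d707b00c9910fd82f6c00000000000000000000000000000000004553f927a2644b91b1de00a1927418db4b40582019e036b605c134c24904ab970b1c0496cea078849f8db3b185a6395dd658874033b0669c447010e7c5ba16cfb043ed43d85e527b541e99a0d651798f1563458b7276f40639b25a4370303a7e739af5224a5600000000000000000084a702f77d9c8f716250f0ce5a14d128526a7bc21799aac8b720244faa193489599000000000000000000000000000000000014a6fe10db4d8037a1201ca54ec6af195607907384a1e4c15a3000000000000000001d0251844161665903bc1517967b21678177e9427fc671e53b600f4194f0d79324b62166dc667537d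920b00f4194f0d79324b678dd5bced3eb1786c77e9427fc671e53b6efd284ff8ce3ca76c,
  0x13a4c0d31e53f6ce8765199d11c1b9cc648b324f7297db1cb50ef3de6caa579f3982da5d312929ba73a96da017d48dccfb45488b8e0352e4c5dc09e7acea73fd8f44476ac5cedb952a7640836efd284ff8ce3ca76cba0eba2c040c0dada7c664fee834a8cebcd52fe4258a9ac96fdc15238fdd1c7bb179d52fe4258a9ac96fd90eacdcce7b573c1eca78dc64eced12c3e736c351109993d8b0ef1fbb554c6b04ff4807b47b1fa2d66091a6310f044b38ff5565ee7b732a52e56b4e528f99e5267b2d888000000000000000008b8e0352e4c5dc09e765199d11c1b9cc648b324f7297db1cb507754a44adf080e5cc6903b4ac605e6570b62183ac9165dcf192ebf9700ec99cc7bf67a1ac49d7e636a1d0efd284ff8ce3ca76cda35ee991e57a7575d65cd9a85b10a49ff624cac1957e5c21bfbc632540e801922c9559d45bba33d9f8e2a4e54f7d066698a6b624cac1957e5c21bf8aede4d7bb2eae3ec1304a257f4bcc9036ccb02f38822f637c2915e42d6b3165630c700ded48ffa0451d60dfa2b8442399a8b35ca241ef828f1e5ec00000000000000000ebf9700ec9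9cc7bf681e0cc5e16d42707eb8e2edd026563dfa679467954e33e9b69a5780c1649c66c3bac246a3f25f92039f5cebf9700ec99cc7bf67e97d20c3b3c11cd6889a22468e53ac233624cac1957e5c21bfa4ea884d0ef6e58a5418b3a84d3adc9ee2b6dead9363a19328f4beeb877565f28a97558f3b34177e2e4380b3bc00111866c49c6ff284c0a7fddf8b40000000000000000092c30943553b441f22ba21fdf1caadc36c664eec5f5b705f8290bcf8cee6e11a1e4028deef1b74392d4a01304a257f4bcc9036efd284ff8ce3ca76c77e9427fc671e53b6889a22468e53ac23319018b4d21438e8685483adc9fc13d3ed70e27e63ce0a1c59c69f9ada6e95fd4c48f27b197eecf8b670d9673862b8fe901e539173ee60c4984455d22376b16d94f51479302920f7bdf22e009b614f725f4c2364e570000000000000000000000000000000000000000000000000002b402831ae6f970e00dfa2b8442399a8b37b88ef7a6fed186712af3d1cd0eb5da3d327a64e663e0f2bc8a507405e153a9079485d0f065a439a678256ffddff782f17967aefd284ff8ce3ca76c77e9427fc671e53b677e9427fc671e53b61591cf65bc2416a4114b03b6dc89f55ca20000000000000000077e9427fc671e53b64637d8dab877dd8a1149e114a842db9052000000000000000000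d8c600747532c6aa08873053d2197d25f25e456e0fcb50d99e1c9b3748d746871b0000000000000000000afc9bee15957cc415258c96c7231f34d96ffddff782f17967a039facfaa97b332bb0b69f7b6df6d686a1039facfaa97b332bb6ffddff782f17967a6ffddff782f17967ae7e7227749635ea30]

set_option maxHeartbeats 4000000 in
theorem isCertified_eight : IsCertified 8 (5242130799984621832318 / 2419342933460499216625) ∧
    (8 ! : ℝ) * lieTheta 8 = 5242130799984621832318 / 2419342933460499216625 := by
  -- The tests are split up by first letters, and by the bracketed words in the first three letters.
  have hc : hasMagnusCoeffsFrom 483868586692099843325 7 (orbits 8 repsEight)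
      (List.range' 1 7) = true :=
    hasMagnusCoeffsFrom_append (l := [1, 2]) (by decide +kernel)
      (hasMagnusCoeffsFrom_append (l := [3, 4]) (by decide +kernel)
        (hasMagnusCoeffsFrom_append (l := [5, 6]) (l' := [7]) (by decide +kernel)
          (by decide +kernel)))
  have hb : boundedOn (lookup 68 (2 ^ 76 - 138248167626314240950) tableEight) (2 ^ 76)
      138248167626314240950 (List.range' 1 7) (.of 0) = true :=
    boundedOn_pair (l := List.range' 3 5) (by decide +kernel) (by decide +kernel)
      (by decide +kernel)
  have h := isCertified_of_tables (k := 7) (E := 483868586692099843325)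
    (C := 42272542771075990455812352) (b := 68) (D := 138248167626314240950)
    (V := 12077869363164568701660672) (by decide) (by decide)
    repsEight tableEight (by decide) (by decide) (by decide) (by decide +kernel) (by decide +kernel)
    hc hb (by decide +kernel)
    (v := 5242130799984621832318 / 2419342933460499216625) (by norm_num [Nat.factorial])
  exact h

end Magnus

end

theorem mainTheorem8 :
    (∀ k ∈ Finset.Icc 1 8,
      (∃! L : FreeLieAlgebra ℝ (Fin k), Magnus.toAssoc k L = Magnus.magnus k) ∧
      Magnus.IsCertified k ((k ! : ℝ) * Magnus.lieTheta k)) ∧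
    (1 ! : ℝ) * Magnus.lieTheta 1 = 1 ∧
    (2 ! : ℝ) * Magnus.lieTheta 2 = 1 / 2 ∧
    (3 ! : ℝ) * Magnus.lieTheta 3 = 1 / 3 ∧
    (4 ! : ℝ) * Magnus.lieTheta 4 = 1 / 3 ∧
    (5 ! : ℝ) * Magnus.lieTheta 5 = 2 / 5 ∧
    (6 ! : ℝ) * Magnus.lieTheta 6 = 37 / 60 ∧
    (7 ! : ℝ) * Magnus.lieTheta 7 = 1621 / 1540 ∧
    (8 ! : ℝ) * Magnus.lieTheta 8 = 5242130799984621832318 / 2419342933460499216625 := by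
  have h₁ := Magnus.isCertified_one
  have h₂ := Magnus.isCertified_two
  have h₃ := Magnus.isCertified_three
  have h₄ := Magnus.isCertified_four
  have h₅ := Magnus.isCertified_five
  have h₆ := Magnus.isCertified_six
  have h₇ := Magnus.isCertified_seven
  have h₈ := Magnus.isCertified_eight
  refine ⟨fun k hk => ?_, h₁.2, h₂.2, h₃.2, h₄.2, h₅.2, h₆.2, h₇.2, h₈.2⟩
  have hk' : k ≠ 0 := (Nat.pos_of_ne_zero fun h => by simp [h] at hk).ne'
  refine ⟨@Magnus.existsUnique_toAssoc_eq_magnus k ⟨hk'⟩, ?_⟩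
  rw [Finset.mem_Icc] at hk
  obtain ⟨hk₁, hk₈⟩ := hk
  interval_cases k
  · rw [h₁.2]; exact h₁.1
  · rw [h₂.2]; exact h₂.1
  · rw [h₃.2]; exact h₃.1
  · rw [h₄.2]; exact h₄.1
  · rw [h₅.2]; exact h₅.1
  · rw [h₆.2]; exact h₆.1
  · rw [h₇.2]; exact h₇.1
  · rw [h₈.2]; exact h₈.1
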